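/- **Problem (CC-DIM).** An instance consists of a simple directed graph $G=(V,E)$ with $n$ nodes and $m$ edges, edge probabilities $p_e\in[0,1]$, a finite set $Q$ of metrics, and for each $q\in Q$ a weight $w_q\ge 0$ (with $\sum_q w_q=1$), a partition of $V$ into nonempty communities $C^q_1,\dots,C^q_{r_q}$ and coefficients $a_{q,j}>0$; and $\lambda\in[0,1]$. A realization $g\subseteq E$ contains each edge $e$ independently with probability $p_e$ (independent cascade model); $I_g(S)$ is the set of nodes reachable from $S$ in $g$. Put $\sigma(S)=\mathbb E_g|I_g(S)|$, $\phi(S)=\sum_q w_q\sum_j a_{q,j}\,\mathbb E_g|I_g(S)\cap C^q_j|$ and $$f(S)=(1-\lambda)\frac{\sigma(S)}{\sigma(V)}+\lambda\frac{\phi(S)}{\phi(V)} .$$ Given $1\le k\le n$, one wants to maximize $f(S)$ over $|S|\le k$. A set $S$ is an $\alpha$-approximate solution if $|S|\le k$ and $f(S)\ge\alpha f(T)$ for all $T$ with $|T|\le k$. **Sampling.** A random G-RR set with sentinel set $B$ is obtained by sampling one realization $g$ and, for every $(q,j)$, a uniform node $v_{q,j}\in C^q_j$; its $(q,j)$ entry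 is the set $R$ of nodes that can reach $v_{q,j}$ in $g$, found by reverse breadth-first search, except that the search stops with the placeholder $\square$ as soon as it meets $B$. For a collection $\mathcal R$ of such samples (and $S\supseteq B$), the coverage is $$\Omega(S;\mathcal R)=\sum_{\tilde R\in\mathcal R}\sum_{q,j}\Big(\frac{1-\lambda}{n|Q|}+\frac{\lambda w_qa_{q,j}}{\phi(V)}\Big)|C^q_j|\cdot\mathbb 1\big[\tilde R_{q,j}=\square\text{ or }S\cap\tilde R_{q,j}\ne\emptyset\big].$$ Greedy adds nodes of maximum marginal coverage one at a time, to a start set $S_0$; for its successive sets $S_0\subset S_1\subset\cdots$ (all with at most $k$ elements) let $\overline\Omega=\min_a\{\Omega(S_a)+\text{sum of the }k\text{ largest marginal coverages with respect to }S_a\}$. With $\eta=\ln(1/\delta')$ put $$\underline f(\Omega,\theta,\delta')=\frac1\theta\Big[\Big(\sqrt{\Omega+\tfrac{2\eta}{9}}-\sqrt{\tfrac{\eta}{2}}\Big)^2-\tfrac{\eta}{18}\Big],\qquad \overline f(\Omega,\theta,\delta')=\frac1\theta\Big(\sqrt{\Omega+\tfrac{\eta}{2}}+\sqrt{\tfrac{\eta}{2}}\Big)^2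 .$$ Let $f_{\min}=(1-\lambda)\frac kn+\lambda\frac{k\min a_{q,j}}{\sum_q w_q\sum_j a_{q,j}|C^q_j|}$. **Algorithm G-HIST$(k,\varepsilon,\delta)$.** Put $\varepsilon_1=\varepsilon_2=\varepsilon/2$, $\delta_1=\delta_2=\delta/2$. *Stage 1 (sentinel set).* $\theta=\lceil 3\ln(1/\delta_1)\rceil$, $\theta_{\max}=\dfrac{2\big(\sqrt{\ln(6/\delta_1)}+\sqrt{\ln\binom nk+\ln(6/\delta_1)}\big)^2}{\varepsilon_1^2f_{\min}}$, $i_{\max}=\lceil\log_2(\theta_{\max}/\theta)\rceil$; let $\mathcal R_1$ consist of $\theta$ samples with sentinel set $\emptyset$. Repeat $i_{\max}$ times: run greedy for $k$ steps from $\emptyset$ on $\mathcal R_1$, giving $S_0,\dots,S_k$; let $\overline f=\overline f(\overline\Omega,|\mathcal R_1|,\frac{\delta_1}{3i_{\max}})$; let $b\in\{0,\dots,k\}$ be the largest index with $\underline f(\Omega(S_b;\mathcal R_1),|\mathcal R_1|,\frac{\delta_1}{6i_{\max}})/\overline f\ge 1-(1-1/k)^b-\varepsilon_1$; draw $|\mathcal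 R_1|$ fresh samples $\mathcal R_2$ with sentinel set $S_b$ and return $S_b$ if $\underline f(\Omega(S_b;\mathcal R_2),|\mathcal R_2|,\frac{\delta_1}{6i_{\max}})/\overline f\ge 1-(1-1/k)^b-\varepsilon_1$; otherwise enlarge $\mathcal R_2$ to $4|\mathcal R_1|$ samples and repeat this test; if it fails again, double $\mathcal R_1$. After the last iteration return the last $S_b$. *Stage 2 (remaining set).* Given $S_b$ of size $b$, $\theta=\lceil 3\ln(1/\delta_2)\rceil$, $\theta_{\max}=\dfrac{2\big(\sqrt{\ln(9/\delta_2)}+\sqrt{(1-\frac1e)(\ln\binom{n-b}{k-b}+\ln(9/\delta_2))}\big)^2}{\varepsilon_2^2f_{\min}}$, $i_{\max}=\lceil\log_2(\theta_{\max}/\theta)\rceil$; let $\mathcal R_1,\mathcal R_2$ consist of $\theta$ samples each, with sentinel set $S_b$. Repeat $i_{\max}$ times: run greedy for $k-b$ steps from $S_b$ on $\mathcal R_1$, giving $S_k$; return $S_k\setminus S_b$ if $\underline f(\Omega(S_k;\mathcal R_2),|\mathcal R_2|,\frac{\delta_2}{3i_{\max}})/\overline f(\overline\Omega,|\mathcal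 R_1|,\frac{\delta_2}{3i_{\max}})\ge1-1/e-\varepsilon$; otherwise double $\mathcal R_1$ and $\mathcal R_2$. After the last iteration return the last $S_k\setminus S_b$. The output is the union of the sets returned by the two stages. Time is counted in steps of a real random-access machine (unit cost for an array access, an arithmetic operation, comparison or elementary function on reals, a biased coin, a uniform draw from a stored array); greedy maintains the array of marginal coverages, and sums of the $k$ largest entries are found by randomized selection. **Main Theorem.** Let $1\le k\le n$ and $\varepsilon,\delta\in(0,1)$. 1. With probability at least $1-\delta$, G-HIST returns a $(1-1/e-\varepsilon)$-approximate solution. 2. If $n\le 2m$ (for instance if $G$ has no isolated node), then the expected number of steps of G-HIST is, in the worst case over all instances, $$O\!\left(\frac{\sum_{q\in Q}r_q\cdot m\,n\,\big(k\ln n+\ln(1/\delta)\big)}{\varepsilon^2k}\right),$$ where the implied constant depends only on an upper bound $\rho$ for the ratio $\max a_{q,j}/\min a_{q,j}$ of the coefficients. -/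

import Mathlib

/-! ## Timed and randomized computations

The cost model is a real random-access machine: reading or writing an array cell, pushing to or
popping from a queue or a list, one arithmetic operation, comparison or elementary function
(`√`, `log`, power, rounding) on real numbers, tossing one biased coin and drawing one uniform
element of a stored array all take a bounded number of steps.  Every program below charges
(`tick`) for what it does, loop by loop.
Arrays are modelled by functions, lists and finsets; a test `v ∈ S` for a node set is the reading of
an indicator array. -/

namespace CCDIM

/-- A value together with the number of steps that were spent on computing it. -/
@[ext]
structure Timed (α : Type) where
  val : α
  cost : ℕ

instance : Monad Timed where
  pure a := ⟨a, 0⟩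
  bind x f := ⟨(f x.val).val, x.cost + (f x.val).cost⟩

/-- Spend `c` steps. -/
def Timed.tick (c : ℕ) : Timed Unit := ⟨(), c⟩

/-- A randomized computation: the joint law of the returned value and of the number of steps. -/
def Rand (α : Type) : Type := PMF (Timed α)

noncomputable instance : Monad Rand where
  pure a := PMF.pure ⟨a, 0⟩
  bind x f := PMF.bind x fun s => PMF.map (fun t => ⟨t.val, s.cost + t.cost⟩) (f s.val)

noncomputable section

namespace Rand

/-- Run a deterministic computation. -/
def lift {α : Type} (t : Timed α) : Rand α := PMF.pure t

/-- Spend `c` steps. -/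
def tick (c : ℕ) : Rand Unit := lift (Timed.tick c)

/-- Draw from the law `μ` (only used for biased coins and uniform draws), in one step. -/
def draw {α : Type} (μ : PMF α) : Rand α := PMF.map (fun a => ⟨a, 1⟩) μ

/-- The law of the returned value. -/
def law {α : Type} (x : Rand α) : PMF α := PMF.map Timed.val x

/-- The probability that the returned value lies in `A`. -/
def prob {α : Type} (x : Rand α) (A : Set α) : ENNReal := x.law.toOuterMeasure A

/-- The expected number of steps. -/
def expectedCost {α : Type} (x : Rand α) : ENNReal :=
  ∑' t : Timed α, (show PMF (Timed α) from x) t * (t.cost : ENNReal)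

end Rand

/-- A coin that shows `true` with probability `p`. -/
def coin (p : unitInterval) : PMF Bool :=
  PMF.ofFintype (fun b => ENNReal.ofReal (if b then (p : ℝ) else 1 - (p : ℝ))) (by
    rw [Fintype.sum_bool, ← ENNReal.ofReal_add]
    · simp
    · simpa using p.2.1
    · simpa using p.2.2)

/-! ## The problem -/

/-- An instance: a simple directed graph on the nodes `0, …, n - 1` with edge set `E`, where
`(u, v) ∈ E` is an edge from `u` to `v`; a diffusion probability for every edge; `numMetrics`
metrics, the metric `q` with weight `w q` and with a partition of the nodes into `r q` nonempty
communities (`comm q v` is the index of the community of `v`); a coefficient `a q j > 0` for every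
community; and the parameter `lam`, which balances spread and diversity. -/
structure Problem where
  n : ℕ
  E : Finset (Fin n × Fin n)
  loopless : ∀ v, (v, v) ∉ E
  p : Fin n × Fin n → unitInterval
  numMetrics : ℕ
  r : Fin numMetrics → ℕ
  comm : (q : Fin numMetrics) → Fin n → Fin (r q)
  comm_surjective : ∀ q, Function.Surjective (comm q)
  w : Fin numMetrics → ℝ
  w_nonneg : ∀ q, 0 ≤ w q
  w_sum : ∑ q, w q = 1
  a : (q : Fin numMetrics) → Fin (r q) → ℝ
  a_pos : ∀ q j, 0 < a q j
  lam : ℝ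
  lam_nonneg : 0 ≤ lam
  lam_le_one : lam ≤ 1

namespace Problem

variable (I : Problem)

/-- The number of edges. -/
def m : ℕ := I.E.card

/-- The nodes. -/
abbrev Node : Type := Fin I.n

/-- The pairs `(q, j)` that index all communities of all metrics. -/
abbrev Key : Type := Σ q : Fin I.numMetrics, Fin (I.r q)

/-- The total number `∑ q, r q` of communities. -/
def numKeys : ℕ := ∑ q, I.r q

/-- The community with index `(q, j)`. -/
def community (x : I.Key) : Finset I.Node := Finset.univ.filter fun v => I.comm x.1 v = x.2

theorem community_nonempty (x : I.Key) : (I.community x).Nonempty := by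
  obtain ⟨v, hv⟩ := I.comm_surjective x.1 x.2
  exact ⟨v, by simp [community, hv]⟩

/-- The probability of the realization whose set of live edges is `g ⊆ E`. -/
def realizationProb (g : Finset (I.Node × I.Node)) : ℝ :=
  (∏ e ∈ g, (I.p e : ℝ)) * ∏ e ∈ I.E \ g, (1 - (I.p e : ℝ))

open Classical in
/-- The nodes that can be reached from `S` along live edges of `g`. -/
def activated (g : Finset (I.Node × I.Node)) (S : Finset I.Node) : Finset I.Node :=
  Finset.univ.filter fun v => ∃ s ∈ S, Relation.ReflTransGen (fun x y => (x, y) ∈ g) s v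

/-- The influence spread. -/
def spread (S : Finset I.Node) : ℝ :=
  ∑ g ∈ I.E.powerset, I.realizationProb g * ((I.activated g S).card : ℝ)

/-- The composite diversified function, with linear utilities. -/
def diversity (S : Finset I.Node) : ℝ :=
  ∑ q, I.w q * ∑ j, ∑ g ∈ I.E.powerset,
    I.realizationProb g * (I.a q j * ((I.activated g S ∩ I.community ⟨q, j⟩).card : ℝ))

/-- The objective function. -/
def objective (S : Finset I.Node) : ℝ :=
  (1 - I.lam) * (I.spread S / I.spread Finset.univ)
    + I.lam * (I.diversity S / I.diversity Finset.univ)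

/-- `S` is an `α`-approximate solution for the budget `k`: it is feasible and its objective value is
at least `α` times that of every feasible set. -/
def IsApproxSolution (k : ℕ) (α : ℝ) (S : Finset I.Node) : Prop :=
  S.card ≤ k ∧ ∀ T : Finset I.Node, T.card ≤ k → α * I.objective T ≤ I.objective S

/-! ## Constants used by the algorithm -/

/-- The closed form of the diversity of the set of all nodes. -/
def diversityTotal : ℝ := ∑ q, I.w q * ∑ j, I.a q j * ((I.community ⟨q, j⟩).card : ℝ)

/-- The contribution of a covered reverse reachable set of the community `x` to the generalized
coverage. -/
def coef (x : I.Key) : ℝ :=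
  ((1 - I.lam) / ((I.n : ℝ) * (I.numMetrics : ℝ)) + I.lam * I.w x.1 * I.a x.1 x.2 / I.diversityTotal)
    * ((I.community x).card : ℝ)

/-- The a priori lower bound for the optimum over sets of size `k`. -/
def fmin (k : ℕ) : ℝ :=
  (1 - I.lam) * ((k : ℝ) / (I.n : ℝ))
    + I.lam * ((⨅ x : I.Key, I.a x.1 x.2) * (k : ℝ) / I.diversityTotal)

/-- The maximum number of samples in the sentinel stage. -/
def thetaMaxSentinel (k : ℕ) (ε₁ δ₁ : ℝ) : ℝ :=
  2 * (√(Real.log (6 / δ₁)) + √(Real.log (I.n.choose k) + Real.log (6 / δ₁))) ^ 2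
    / (ε₁ ^ 2 * I.fmin k)

/-- The maximum number of samples in the remaining-set stage, after a sentinel set of size `b`. -/
def thetaMaxRemaining (k b : ℕ) (ε₂ δ₂ : ℝ) : ℝ :=
  2 * (√(Real.log (9 / δ₂)) + √((1 - 1 / Real.exp 1) *
      (Real.log ((I.n - b).choose (k - b)) + Real.log (9 / δ₂)))) ^ 2
    / (ε₂ ^ 2 * I.fmin k)

/-- The initial number `3 ln (1 / δ)` of samples, rounded up. -/
def thetaInit (δ : ℝ) : ℕ := ⌈3 * Real.log (1 / δ)⌉₊

/-- The maximum number of iterations. -/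
def iMax (θmax : ℝ) (θ : ℕ) : ℕ := ⌈Real.logb 2 (θmax / (θ : ℝ))⌉₊

/-- The lower confidence bound, from the coverage `Ω` of a set in `θ` samples. -/
def lowerBound (Ω : ℝ) (θ : ℕ) (δl : ℝ) : ℝ :=
  ((√(Ω + 2 * Real.log (1 / δl) / 9) - √(Real.log (1 / δl) / 2)) ^ 2 - Real.log (1 / δl) / 18)
    * (1 / (θ : ℝ))

/-- The upper confidence bound, from an upper bound `Ω` for the coverage of the optimum in `θ`
samples. -/
def upperBound (Ω : ℝ) (θ : ℕ) (δu : ℝ) : ℝ :=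
  (√(Ω + Real.log (1 / δu) / 2) + √(Real.log (1 / δu) / 2)) ^ 2 * (1 / (θ : ℝ))

/-! ## Sampling generalized reverse reachable sets -/

/-- The input adjacency list of in-neighbours. -/
def inNbrs (v : I.Node) : List I.Node := (List.finRange I.n).filter fun u => (u, v) ∈ I.E

/-- The list of all keys `(q, j)`. -/
def keys : List I.Key :=
  (List.finRange I.numMetrics).flatMap fun q => (List.finRange (I.r q)).map fun j => ⟨q, j⟩

/-- The lists of live in-neighbours of all nodes, in a random realization. -/
def sampleRealization : Rand (I.Node → List I.Node) :=
  (List.finRange I.n).foldlM (fun live v => do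
    Rand.tick 1
    let L ← (I.inNbrs v).foldlM (fun L u => do
      Rand.tick 1
      let b ← Rand.draw (coin (I.p (u, v)))
      pure (if b then L ++ [u] else L)) []
    pure (Function.update live v L)) (fun _ => [])

variable {I}

/-- Scan the live in-neighbours of a node that was popped from the queue: an unmarked one either
lies in the sentinel set `S`, and then the search is stopped with the answer `none`, or is marked
and pushed to the queue.  The arguments are the rest of the scan, the queue, and the marked nodes. -/
def scan (S : Finset I.Node) :
    List I.Node → List I.Node → List I.Node → Timed (Option (List I.Node × List I.Node))
  | [], H, R => pure (some (H, R))
  | w :: ws, H, R => do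
    Timed.tick 1
    if w ∈ R then scan S ws H R
    else if w ∈ S then pure none
    else scan S ws (H ++ [w]) (R ++ [w])

/-- The reverse search with queue `H` and marked nodes `R`.  Every node enters the queue at most
once, so that `n` is enough for the first argument, which bounds the number of rounds. -/
def search (S : Finset I.Node) (live : I.Node → List I.Node) :
    ℕ → List I.Node → List I.Node → Timed (Option (List I.Node))
  | 0, _, R => pure (some R)
  | _ + 1, [], R => pure (some R)
  | fuel + 1, u :: H, R => do
    Timed.tick 1
    let out ← scan S (live u) H R
    match out with
    | none => pure none
    | some (H', R') => search S live fuel H' R'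

variable (I) in
/-- A generalized reverse reachable set: for every key a reverse reachable set, or `none` if the
search has hit the sentinel set. -/
abbrev GRR : Type := I.Key → Option (List I.Node)

/-- Sample a generalized reverse reachable set with the sentinel set `S`; for `S = ∅` this is an
ordinary generalized reverse reachable set. Clearing the marks takes `n` steps per community. -/
def sampleGRR (S : Finset I.Node) : Rand (GRR I) := do
  let live ← I.sampleRealization
  I.keys.foldlM (fun (R : GRR I) x => do
    Rand.tick 1
    let v ← Rand.draw (PMF.uniformOfFinset (I.community x) (I.community_nonempty x))
    if v ∈ S then pure (Function.update R x none)
    else do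
      Rand.tick I.n
      let out ← Rand.lift (search S live I.n [v] [v])
      pure (Function.update R x out)) (fun _ => none)

/-- A collection of independent samples. -/
def sampleMany (S : Finset I.Node) : ℕ → Rand (List (GRR I))
  | 0 => pure []
  | N + 1 => do
    Rand.tick 1
    let R ← sampleGRR S
    let Rs ← sampleMany S N
    pure (R :: Rs)

/-- Is the reverse reachable set, or placeholder `none`, covered by `S`? -/
def covered (S : Finset I.Node) : Option (List I.Node) → Timed Bool
  | none => pure true
  | some R => R.foldlM (fun b v => do
      Timed.tick 1
      pure (b || decide (v ∈ S))) false

/-- The generalized coverage of `S` in a collection. -/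
def coverage (S : Finset I.Node) (Rs : List (GRR I)) : Timed ℝ :=
  Rs.foldlM (fun Ω R => I.keys.foldlM (fun Ω x => do
    Timed.tick 1
    let b ← covered S (R x)
    pure (if b then Ω + I.coef x else Ω)) Ω) 0

/-! ## Greedy maximum coverage -/

/-- The sum of the `k` largest entries of a list, by randomized selection with a uniformly random
pivot. The length of the list is enough for the first argument, which bounds the depth of the
recursion. -/
def topSum : ℕ → List ℝ → ℕ → Rand ℝ
  | 0, _, _ => pure 0
  | _ + 1, [], _ => pure 0
  | fuel + 1, x :: l, k => do
    let i ← Rand.draw (PMF.uniformOfFintype (Fin (l.length + 1)))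
    let y := (x :: l)[i.val]
    let hi := (x :: l).filter fun z => y < z
    let eq := (x :: l).filter fun z => z = y
    let lo := (x :: l).filter fun z => z < y
    Rand.tick (4 * (l.length + 1))
    if k ≤ hi.length then topSum fuel hi k
    else if k ≤ hi.length + eq.length then pure (hi.sum + ((k - hi.length : ℕ) : ℝ) * y)
    else do
      let s ← topSum fuel lo (k - hi.length - eq.length)
      pure (hi.sum + (eq.length : ℝ) * y + s)

variable (I) in
/-- The state of the greedy algorithm: the current set `S`, its coverage, the marginal coverage of
every node, and the uncovered reverse reachable sets with their coefficients. -/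
structure GreedyState where
  S : Finset I.Node
  cov : ℝ
  gain : I.Node → ℝ
  rest : List (ℝ × List I.Node)

/-- Add `c` to the gain of every node of `R`. -/
def bump (c : ℝ) (R : List I.Node) (gain : I.Node → ℝ) : Timed (I.Node → ℝ) :=
  R.foldlM (fun g u => do
    Timed.tick 1
    pure (Function.update g u (g u + c))) gain

/-- The state for the initial set `S₀`, the sentinel set with which the collection was sampled (so
that it covers exactly the placeholders). -/
def initState (S₀ : Finset I.Node) (Rs : List (GRR I)) : Timed (GreedyState I) := do
  Timed.tick I.n
  Rs.foldlM (fun (st : GreedyState I) R => I.keys.foldlM (fun (st : GreedyState I) x => do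
    Timed.tick 1
    match R x with
    | none => pure { st with cov := st.cov + I.coef x }
    | some L => do
      let gain ← bump (I.coef x) L st.gain
      pure { st with gain := gain, rest := (I.coef x, L) :: st.rest }) st)
    { S := S₀, cov := 0, gain := fun _ => 0, rest := [] }

/-- A node outside the current set with the largest marginal coverage. -/
def pickMax (st : GreedyState I) : Timed (Option I.Node) :=
  (List.finRange I.n).foldlM (fun best v => do
    Timed.tick 1
    if v ∈ st.S then pure best
    else match best with
      | none => pure (some v)
      | some u => pure (if st.gain u < st.gain v then some v else some u)) none

/-- Insert `v` into the current set and update the coverage and the gains. -/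
def insertNode (v : I.Node) (st : GreedyState I) : Timed (GreedyState I) := do
  Timed.tick 1
  st.rest.foldlM (fun (s : GreedyState I) item => do
    Timed.tick 1
    if v ∈ item.2 then do
      let gain ← bump (-item.1) item.2 s.gain
      pure { s with cov := s.cov + item.1, gain := gain }
    else pure { s with rest := item :: s.rest })
    { st with S := insert v st.S, rest := [] }

variable (I) in
/-- What the greedy algorithm records about each of its sets: the set, its coverage, and the upper
bound for the coverage of every `k`-set given by the `k` largest marginal coverages. -/
structure Snapshot where
  S : Finset I.Node
  cov : ℝ
  ub : ℝ

/-- Record a snapshot. -/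
def snapshot (k : ℕ) (st : GreedyState I) : Rand (Snapshot I) := do
  Rand.tick (2 * I.n)
  let s ← topSum I.n ((List.finRange I.n).map st.gain) k
  pure ⟨st.S, st.cov, st.cov + s⟩

/-- Select `j` further nodes greedily; the result is the list of the `j + 1` snapshots. -/
def greedyLoop (k : ℕ) : ℕ → GreedyState I → Rand (List (Snapshot I))
  | 0, st => do
    let s ← snapshot k st
    pure [s]
  | j + 1, st => do
    let s ← snapshot k st
    let v ← Rand.lift (pickMax st)
    match v with
    | none => pure [s]
    | some v => do
      let st' ← Rand.lift (insertNode v st)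
      let l ← greedyLoop k j st'
      pure (s :: l)

/-- Greedy maximum coverage: select `j` nodes in addition to `S₀`. -/
def greedy (k j : ℕ) (S₀ : Finset I.Node) (Rs : List (GRR I)) : Rand (List (Snapshot I)) := do
  let st ← Rand.lift (initState S₀ Rs)
  greedyLoop k j st

/-- The smallest of the recorded upper bounds for the coverage of the optimum. -/
def bestUb : List (Snapshot I) → Timed ℝ
  | [] => pure 0
  | s :: l => l.foldlM (fun x t => do
      Timed.tick 1
      pure (min x t.ub)) s.ub

/-! ## The two stages -/

/-- The approximation ratio `1 - (1 - 1 / k) ^ b` of the first `b` greedy choices. -/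
def sentinelRatio (k b : ℕ) : ℝ := 1 - (1 - 1 / (k : ℝ)) ^ b

/-- The largest `b` such that the rough lower bound for the `b`-th greedy set (computed from the
same `θ` samples), divided by the upper bound `fu`, is at least `1 - (1 - 1 / k) ^ b - ε₁`; together
with that set. The empty set, for `b = 0`, always qualifies. -/
def chooseSentinel (k : ℕ) (ε₁ δl fu : ℝ) (θ : ℕ) (l : List (Snapshot I)) :
    Timed (ℕ × Finset I.Node) :=
  l.zipIdx.foldlM (fun best t => do
    Timed.tick 1
    pure (if sentinelRatio k t.2 - ε₁ ≤ lowerBound t.1.cov θ δl / fu then (t.2, t.1.S) else best))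
    (0, ∅)

/-- The loop of the sentinel stage; the arguments are the number of iterations left, the collection
`R₁`, and the sentinel set of the previous iteration. -/
def sentinelLoop (k : ℕ) (ε₁ δ₁ : ℝ) (imax : ℕ) :
    ℕ → List (GRR I) → Finset I.Node → Rand (Finset I.Node)
  | 0, _, S => pure S
  | t + 1, R₁, _ => do
    Rand.tick 1
    let θ := R₁.length
    let δl := δ₁ / (6 * (imax : ℝ))
    let snaps ← greedy k k ∅ R₁
    let Ωu ← Rand.lift (bestUb snaps)
    let fu := upperBound Ωu θ (δ₁ / (3 * (imax : ℝ)))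
    let (b, S) ← Rand.lift (chooseSentinel k ε₁ δl fu θ snaps)
    let R₂ ← sampleMany S θ
    let Ω₂ ← Rand.lift (coverage S R₂)
    if sentinelRatio k b - ε₁ ≤ lowerBound Ω₂ θ δl / fu then pure S
    else do
      let R₂' ← sampleMany S (3 * θ)
      let Ω₂' ← Rand.lift (coverage S (R₂ ++ R₂'))
      if sentinelRatio k b - ε₁ ≤ lowerBound Ω₂' (4 * θ) δl / fu then pure S
      else do
        let R₁' ← sampleMany ∅ θ
        sentinelLoop k ε₁ δ₁ imax t (R₁ ++ R₁') S

variable (I)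

/-- Sentinel-set selection. -/
def sentinelSet (k : ℕ) (ε₁ δ₁ : ℝ) : Rand (Finset I.Node) := do
  -- evaluation of the closed formulas for the constants
  Rand.tick (I.numKeys + k + 1)
  let θ := thetaInit δ₁
  let imax := iMax (I.thetaMaxSentinel k ε₁ δ₁) θ
  let R₁ ← sampleMany ∅ θ
  sentinelLoop k ε₁ δ₁ imax imax R₁ ∅

variable {I}

/-- The loop of the remaining-set stage with the sentinel set `S`; the arguments are the number of
iterations left, the collections `R₁` and `R₂`, and the remaining set of the previous iteration. -/
def remainingLoop (k : ℕ) (S : Finset I.Node) (ε δ₂ : ℝ) (imax : ℕ) :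
    ℕ → List (GRR I) → List (GRR I) → Finset I.Node → Rand (Finset I.Node)
  | 0, _, _, T => pure T
  | t + 1, R₁, R₂, _ => do
    Rand.tick (I.n + 1)
    let θ := R₁.length
    let snaps ← greedy k (k - S.card) S R₁
    let Sk := (snaps.getLast?.map Snapshot.S).getD S
    let T := Sk \ S
    let Ωu ← Rand.lift (bestUb snaps)
    let fu := upperBound Ωu θ (δ₂ / (3 * (imax : ℝ)))
    let Ωl ← Rand.lift (coverage Sk R₂)
    let fl := lowerBound Ωl R₂.length (δ₂ / (3 * (imax : ℝ)))
    if 1 - 1 / Real.exp 1 - ε ≤ fl / fu then pure T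
    else do
      let R₁' ← sampleMany S θ
      let R₂' ← sampleMany S R₂.length
      remainingLoop k S ε δ₂ imax t (R₁ ++ R₁') (R₂ ++ R₂') T

variable (I)

/-- Remaining-set selection. -/
def remainingSet (k : ℕ) (S : Finset I.Node) (ε ε₂ δ₂ : ℝ) : Rand (Finset I.Node) := do
  -- evaluation of the closed formulas for the constants
  Rand.tick (I.numKeys + I.n + k + 1)
  let θ := thetaInit δ₂
  let imax := iMax (I.thetaMaxRemaining k S.card ε₂ δ₂) θ
  let R₁ ← sampleMany S θ
  let R₂ ← sampleMany S θ
  remainingLoop k S ε δ₂ imax imax R₁ R₂ ∅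

/-- The two-stage algorithm G-HIST. -/
def gHist (k : ℕ) (ε δ : ℝ) : Rand (Finset I.Node) := do
  let S ← I.sentinelSet k (ε / 2) (δ / 2)
  let T ← I.remainingSet k S ε (ε / 2) (δ / 2)
  Rand.tick (I.n + 1)
  pure (S ∪ T)

/-- The time bound, up to a constant factor. -/
def timeBound (k : ℕ) (ε δ : ℝ) : ℝ :=
  (I.numKeys : ℝ) * (I.m : ℝ) * (I.n : ℝ) * ((k : ℝ) * Real.log (I.n : ℝ) + Real.log (1 / δ))
    / (ε ^ 2 * (k : ℝ))

end Problem

end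

end CCDIM

/-! ### Expectation calculus for costed and randomized programs -/

namespace CCDIM

open scoped ENNReal

/-! ## Expectations of randomized computations -/

namespace Timed

variable {α β : Type}

/-! Unbiasedness. Reading reachability backwards, a community entry sampled with sentinel set B is
covered by A exactly when its random root is reached from A ∪ B. Averaging over the root and the
realization, the coverage of one sample has mean f(A ∪ B) (`E_value`). The coefficients add up to
f(V) = 1, so a sample contributes a number in [0, 1]. Exponential moments then give a Bernstein
upper tail and a Chernoff lower tail (`upper_tail`, `lower_tail`); solving these for the mean
produces the two confidence bounds (`lowerBound_tail`, `upperBound_tail`).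

Greedy. Coverage is monotone and subadditive in marginals, so with b nodes chosen the best node
closes at least a fraction 1/min(k, n - b) of the gap to any k-set. The product t of the factors 1 -
1/min(k, n - i), for i from b to k - 1, is `contraction`. It never exceeds (1 - 1/k)^(k - b), and it
satisfies t · log C(n, b) ≤ log C(n, k), because the logarithms of binomial coefficients are concave
(`contraction_mul_log_choose_le`).

Approximation. Fix an optimal T with value O and put c = 1 - 1/e. If `fmin` exceeds cO, every k-set
is good enough. Otherwise `fmin` ≤ cO, and the collection of the last iteration is large relative to
O. A bad set passes a test only if a confidence bound fails; over all iterations this uses two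
thirds of the failure budget of a stage. What remains is a last iteration that returns an untested
set. In the sentinel stage the union bound runs over sets of every size b, and C(n, b) may exceed
C(n, k). The inequality for t pays for this at the price of a tolerance cε/√t instead of ε, which is
why `GoodSentinel` has its peculiar form (`misleadsSentinel_le`). In the second stage marginal
coverages over S are compared: greedy gains at least the fraction 1 - t of what T would gain. A set
that falls short of (c - ε)O then forces a deviation of T or of that set (`misleadsRemaining_le`).
That the weaker guarantee for S still suffices is a numerical fact, `exists_variance_bound`.

Time. A sample costs O(m) steps per community. Greedy on N samples costs O(N · (number of
communities) · m + kn), since an uncovered set is subtracted from the gains only once and randomized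
selection is linear in expectation (`topSum_cost`). Collections double, so the last one dominates;
its size is at most 2θ_max, and `fmin` ≥ k/(ρn) turns this into the stated bound. The per-iteration
overhead kn is absorbed because the number of iterations is O(log n / ε²) (`iMax_le`). -/

@[simp] theorem val_pure (a : α) : (pure a : Timed α).val = a := rfl
@[simp] theorem cost_pure (a : α) : (pure a : Timed α).cost = 0 := rfl
@[simp] theorem val_bind (x : Timed α) (f : α → Timed β) : (x >>= f).val = (f x.val).val := rfl
@[simp] theorem cost_bind (x : Timed α) (f : α → Timed β) :
    (x >>= f).cost = x.cost + (f x.val).cost := rfl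
@[simp] theorem val_tick (c : ℕ) : (tick c).val = () := rfl
@[simp] theorem cost_tick (c : ℕ) : (tick c).cost = c := rfl

theorem val_foldlM (f : β → α → Timed β) (l : List α) (b : β) :
    (l.foldlM f b).val = l.foldl (fun b a => (f b a).val) b := by
  induction l generalizing b with
  | nil => simp
  | cons a l ih => simp [ih]

theorem cost_foldlM_le (f : β → α → Timed β) (g : α → ℕ) (l : List α)
    (h : ∀ b, ∀ a ∈ l, (f b a).cost ≤ g a) (b : β) : (l.foldlM f b).cost ≤ (l.map g).sum := by
  induction l generalizing b with
  | nil => simp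
  | cons a l ih =>
    simp only [List.foldlM_cons, cost_bind, List.map_cons, List.sum_cons]
    exact add_le_add (h b a (by simp)) (ih (fun b a ha => h b a (by simp [ha])) _)

theorem cost_foldlM_le_length (f : β → α → Timed β) (c : ℕ) (l : List α)
    (h : ∀ b, ∀ a ∈ l, (f b a).cost ≤ c) (b : β) : (l.foldlM f b).cost ≤ l.length * c := by
  have := cost_foldlM_le f (fun _ => c) l h b
  simpa using this

end Timed

noncomputable section

namespace Rand

variable {α β : Type}

/-- The law of the value and the number of steps. -/
def toPMF (x : Rand α) : PMF (Timed α) := x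

/-- The expectation of a nonnegative function of the returned value. -/
def E (x : Rand α) (φ : α → ℝ≥0∞) : ℝ≥0∞ := ∑' t : Timed α, x.toPMF t * φ t.val

/-- The values that are returned with positive probability. -/
def Supp (x : Rand α) : Set α := {a | ∃ t ∈ x.toPMF.support, t.val = a}

theorem tsum_pure {γ : Type} (a : γ) (φ : γ → ℝ≥0∞) : ∑' t, PMF.pure a t * φ t = φ a := by
  rw [tsum_eq_single a]
  · simp
  · intro b hb
    simp [PMF.pure_apply, hb]

theorem tsum_bind {γ δ : Type} (p : PMF γ) (f : γ → PMF δ) (φ : δ → ℝ≥0∞) :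
    ∑' t, p.bind f t * φ t = ∑' s, p s * ∑' t, f s t * φ t := by
  simp only [PMF.bind_apply, ← ENNReal.tsum_mul_right, ← ENNReal.tsum_mul_left]
  rw [ENNReal.tsum_comm]
  simp only [mul_assoc]

theorem tsum_map {γ δ : Type} (p : PMF γ) (f : γ → δ) (φ : δ → ℝ≥0∞) :
    ∑' t, p.map f t * φ t = ∑' s, p s * φ (f s) := by
  rw [PMF.map, tsum_bind]
  simp only [Function.comp, tsum_pure]

theorem toPMF_pure (a : α) : (pure a : Rand α).toPMF = PMF.pure ⟨a, 0⟩ := rfl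

theorem toPMF_bind (x : Rand α) (f : α → Rand β) :
    (x >>= f).toPMF = x.toPMF.bind fun s =>
      PMF.map (fun t => ⟨t.val, s.cost + t.cost⟩) (f s.val).toPMF := rfl

theorem toPMF_lift (t : Timed α) : (lift t).toPMF = PMF.pure t := rfl

theorem toPMF_draw (μ : PMF α) : (draw μ).toPMF = PMF.map (fun a => ⟨a, 1⟩) μ := rfl

@[simp] theorem E_pure (a : α) (φ : α → ℝ≥0∞) : (pure a : Rand α).E φ = φ a := by
  rw [E, toPMF_pure, tsum_pure]

@[simp] theorem E_bind (x : Rand α) (f : α → Rand β) (φ : β → ℝ≥0∞) :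
    (x >>= f).E φ = x.E fun a => (f a).E φ := by
  simp only [E, toPMF_bind, tsum_bind, tsum_map]

@[simp] theorem E_lift (t : Timed α) (φ : α → ℝ≥0∞) : (lift t).E φ = φ t.val := by
  rw [E, toPMF_lift, tsum_pure]

@[simp] theorem E_tick (c : ℕ) (φ : Unit → ℝ≥0∞) : (tick c).E φ = φ () := E_lift _ _

@[simp] theorem E_draw (μ : PMF α) (φ : α → ℝ≥0∞) : (draw μ).E φ = ∑' a, μ a * φ a := by
  rw [E, toPMF_draw, tsum_map]

theorem prob_eq_E (x : Rand α) (A : Set α) : x.prob A = x.E (A.indicator 1) := by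
  rw [prob, PMF.toOuterMeasure_apply, law, E]
  have : ∀ a, A.indicator (⇑(PMF.map Timed.val x)) a
      = PMF.map Timed.val x a * A.indicator 1 a := by
    intro a; by_cases h : a ∈ A <;> simp [h]
  simp only [this]
  exact tsum_map _ _ _

@[simp] theorem E_const (x : Rand α) (c : ℝ≥0∞) : (x.E fun _ => c) = c := by
  rw [E, ENNReal.tsum_mul_right, PMF.tsum_coe, one_mul]

theorem mem_Supp {x : Rand α} {t : Timed α} (h : x.toPMF t ≠ 0) : t.val ∈ x.Supp :=
  ⟨t, h, rfl⟩

/-- Only values of positive probability matter. This is the door through which deterministic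
invariants of samples (length, absence of repetitions) enter probabilistic estimates. -/
theorem E_mono {x : Rand α} {φ ψ : α → ℝ≥0∞} (h : ∀ a ∈ x.Supp, φ a ≤ ψ a) : x.E φ ≤ x.E ψ := by
  refine ENNReal.tsum_le_tsum fun t => ?_
  by_cases ht : x.toPMF t = 0
  · simp [ht]
  · gcongr
    exact h _ (mem_Supp ht)

theorem E_congr {x : Rand α} {φ ψ : α → ℝ≥0∞} (h : ∀ a ∈ x.Supp, φ a = ψ a) : x.E φ = x.E ψ :=
  le_antisymm (E_mono fun a ha => (h a ha).le) (E_mono fun a ha => (h a ha).ge)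

theorem E_le_const {x : Rand α} {φ : α → ℝ≥0∞} {c : ℝ≥0∞} (h : ∀ a ∈ x.Supp, φ a ≤ c) :
    x.E φ ≤ c := (E_mono h).trans (E_const x c).le

theorem E_add (x : Rand α) (φ ψ : α → ℝ≥0∞) : (x.E fun a => φ a + ψ a) = x.E φ + x.E ψ := by
  simp only [E, mul_add, ENNReal.tsum_add]

theorem E_const_mul (x : Rand α) (c : ℝ≥0∞) (φ : α → ℝ≥0∞) :
    (x.E fun a => c * φ a) = c * x.E φ := by
  simp only [E, ← ENNReal.tsum_mul_left]
  exact tsum_congr fun t => by ring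

theorem E_mul_const (x : Rand α) (c : ℝ≥0∞) (φ : α → ℝ≥0∞) :
    (x.E fun a => φ a * c) = x.E φ * c := by
  simp only [mul_comm _ c, E_const_mul]

theorem E_finset_sum {ι : Type} (x : Rand α) (s : Finset ι) (φ : ι → α → ℝ≥0∞) :
    (x.E fun a => ∑ i ∈ s, φ i a) = ∑ i ∈ s, x.E (φ i) := by
  classical
  induction s using Finset.induction_on with
  | empty => simp
  | insert i s hi ih => simp only [Finset.sum_insert hi, E_add, ih]

/-- Tonelli: independent runs may be performed in either order. It allows a candidate set to be
fixed before its validation samples are drawn. -/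
theorem E_comm (x : Rand α) (y : Rand β) (φ : α → β → ℝ≥0∞) :
    (x.E fun a => y.E fun b => φ a b) = y.E fun b => x.E fun a => φ a b := by
  simp only [E, ← ENNReal.tsum_mul_left]
  rw [ENNReal.tsum_comm]
  exact tsum_congr fun s => tsum_congr fun t => by ring

/-! ### Possible values of a computation -/

@[simp] theorem mem_Supp_pure {a b : α} : b ∈ (pure a : Rand α).Supp ↔ b = a := by
  simp [Supp, toPMF_pure, eq_comm]

@[simp] theorem mem_Supp_bind {x : Rand α} {f : α → Rand β} {b : β} :
    b ∈ (x >>= f).Supp ↔ ∃ a ∈ x.Supp, b ∈ (f a).Supp := by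
  simp only [Supp, toPMF_bind, PMF.mem_support_bind_iff, PMF.mem_support_map_iff, Set.mem_ofPred_eq]
  constructor
  · rintro ⟨t, ⟨s, hs, u, hu, rfl⟩, rfl⟩
    exact ⟨s.val, ⟨s, hs, rfl⟩, u, hu, rfl⟩
  · rintro ⟨_, ⟨s, hs, rfl⟩, u, hu, rfl⟩
    exact ⟨_, ⟨s, hs, u, hu, rfl⟩, rfl⟩

@[simp] theorem mem_Supp_lift {t : Timed α} {b : α} : b ∈ (lift t).Supp ↔ b = t.val := by
  simp [Supp, toPMF_lift, eq_comm]

@[simp] theorem mem_Supp_tick {c : ℕ} {b : Unit} : b ∈ (tick c).Supp ↔ True := by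
  simp [tick]

@[simp] theorem mem_Supp_draw {μ : PMF α} {b : α} : b ∈ (draw μ).Supp ↔ b ∈ μ.support := by
  simp [Supp, toPMF_draw]

/-! ### Expected cost -/

theorem expectedCost_eq (x : Rand α) :
    x.expectedCost = ∑' t, x.toPMF t * (t.cost : ℝ≥0∞) := rfl

@[simp] theorem expectedCost_pure (a : α) : (pure a : Rand α).expectedCost = 0 := by
  rw [expectedCost_eq, toPMF_pure, tsum_pure]; simp

@[simp] theorem expectedCost_lift (t : Timed α) : (lift t).expectedCost = t.cost := by
  rw [expectedCost_eq, toPMF_lift, tsum_pure]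

@[simp] theorem expectedCost_tick (c : ℕ) : (tick c).expectedCost = c := expectedCost_lift _

@[simp] theorem expectedCost_draw (μ : PMF α) : (draw μ).expectedCost = 1 := by
  rw [expectedCost_eq, toPMF_draw, tsum_map]
  simp [PMF.tsum_coe]

@[simp] theorem expectedCost_bind (x : Rand α) (f : α → Rand β) :
    (x >>= f).expectedCost = x.expectedCost + x.E fun a => (f a).expectedCost := by
  simp only [expectedCost_eq, toPMF_bind, tsum_bind, tsum_map, E]
  rw [← ENNReal.tsum_add]
  refine tsum_congr fun s => ?_
  rw [← mul_add]
  congr 1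
  simp only [Nat.cast_add, mul_add]
  rw [ENNReal.tsum_add, ENNReal.tsum_mul_right, PMF.tsum_coe, one_mul]

theorem expectedCost_bind_le {x : Rand α} {f : α → Rand β} {c d : ℝ≥0∞}
    (hx : x.expectedCost ≤ c) (hf : ∀ a ∈ x.Supp, (f a).expectedCost ≤ d) :
    (x >>= f).expectedCost ≤ c + d := by
  rw [expectedCost_bind]
  exact add_le_add hx (E_le_const hf)

/-- An invariant of a fold is an invariant of all possible results. -/
theorem Supp_foldlM (P : β → Prop) (f : β → α → Rand β) (l : List α)
    (h : ∀ b, ∀ a ∈ l, P b → ∀ b' ∈ (f b a).Supp, P b') :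
    ∀ b, P b → ∀ b' ∈ (l.foldlM f b).Supp, P b' := by
  induction l with
  | nil => intro b hb b' hb'; simpa [mem_Supp_pure.1 hb'] using hb
  | cons a l ih =>
    intro b hb b' hb'
    rw [List.foldlM_cons, mem_Supp_bind] at hb'
    obtain ⟨d, hd, hb'⟩ := hb'
    exact ih (fun b a ha => h b a (by simp [ha])) d (h b a (by simp) hb d hd) b' hb'

theorem expectedCost_foldlM_le (P : β → Prop) (f : β → α → Rand β) (g : α → ℕ) (l : List α)
    (h : ∀ b, ∀ a ∈ l, P b → ∀ b' ∈ (f b a).Supp, P b')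
    (hc : ∀ b, ∀ a ∈ l, P b → (f b a).expectedCost ≤ g a) :
    ∀ b, P b → (l.foldlM f b).expectedCost ≤ ((l.map g).sum : ℕ) := by
  induction l with
  | nil => intro b hb; simp
  | cons a l ih =>
    intro b hb
    rw [List.foldlM_cons, List.map_cons, List.sum_cons, Nat.cast_add]
    refine expectedCost_bind_le (hc b a (by simp) hb) fun b' hb' => ?_
    exact ih (fun b a ha => h b a (by simp [ha])) (fun b a ha => hc b a (by simp [ha])) b'
      (h b a (by simp) hb b' hb')

/-- Markov's inequality. -/
theorem prob_mul_le_E (x : Rand α) (A : α → Prop) [DecidablePred A] (φ : α → ℝ≥0∞) (c : ℝ≥0∞)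
    (h : ∀ a ∈ x.Supp, A a → c ≤ φ a) :
    c * (x.E fun a => if A a then 1 else 0) ≤ x.E φ := by
  rw [← E_const_mul]
  refine E_mono fun a ha => ?_
  split_ifs with hA
  · simpa using h a ha hA
  · simp

end Rand

end

end CCDIM

namespace CCDIM

open scoped ENNReal

/-! ## Concentration of sums of independent samples -/

noncomputable section

/-- Convexity: on [0, 1] the function exp(s·) lies below its chord. The exponential moment of a [0,
1]-valued variable is thereby controlled by its mean alone. -/
theorem exp_mul_le_one_add {s h : ℝ} (h0 : 0 ≤ h) (h1 : h ≤ 1) :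
    Real.exp (s * h) ≤ 1 + h * (Real.exp s - 1) := by
  have := convexOn_exp.2 (Set.mem_univ 0) (Set.mem_univ s) (sub_nonneg.2 h1) h0 (by ring)
  simp only [smul_eq_mul, mul_zero, zero_add, Real.exp_zero, mul_one] at this
  rw [mul_comm s h]
  linarith

/-- Bernstein's bound for the remainder of the exponential series. -/
theorem bernstein_exp_bound {s : ℝ} (hs : 0 ≤ s) :
    (1 - s / 3) * (Real.exp s - 1 - s) ≤ s ^ 2 / 2 := by
  -- The difference of the two sides and its first derivative both vanish at 0, and the second
  -- derivative is nonnegative everywhere. Integrating the sign twice gives the claim for s ≥ 0.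
  have hd1 : ∀ x : ℝ, HasDerivAt (fun s : ℝ => s ^ 2 / 2 - (1 - s / 3) * (Real.exp s - 1 - s))
      (x + (1 / 3) * (Real.exp x - 1 - x) - (1 - x / 3) * (Real.exp x - 1)) x := by
    intro x
    have h1 : HasDerivAt (fun s : ℝ => 1 - s / 3) (-(1 / 3)) x := by
      simpa using ((hasDerivAt_id x).div_const 3).const_sub 1
    have h2 : HasDerivAt (fun s : ℝ => Real.exp s - 1 - s) (Real.exp x - 1) x := by
      exact ((Real.hasDerivAt_exp x).sub_const 1).sub (hasDerivAt_id' x)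
    have h3 : HasDerivAt (fun s : ℝ => s ^ 2 / 2) x x := by
      simpa using ((hasDerivAt_pow 2 x).div_const 2)
    exact (h3.sub (h1.mul h2)).congr_deriv (by ring)
  have hd2 : ∀ x : ℝ, HasDerivAt
      (fun x : ℝ => x + (1 / 3) * (Real.exp x - 1 - x) - (1 - x / 3) * (Real.exp x - 1))
      ((1 + Real.exp x * (x - 1)) / 3) x := by
    intro x
    have h1 : HasDerivAt (fun s : ℝ => 1 - s / 3) (-(1 / 3)) x := by
      simpa using ((hasDerivAt_id x).div_const 3).const_sub 1
    have h2 : HasDerivAt (fun s : ℝ => Real.exp s - 1 - s) (Real.exp x - 1) x := by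
      exact ((Real.hasDerivAt_exp x).sub_const 1).sub (hasDerivAt_id' x)
    have h3 : HasDerivAt (fun s : ℝ => Real.exp s - 1) (Real.exp x) x := by
      simpa using (Real.hasDerivAt_exp x).sub_const 1
    exact (((hasDerivAt_id' x).add (h2.const_mul (1 / 3))).sub (h1.mul h3)).congr_deriv (by ring)
  -- Multiplied by exp(-x), this is exp(-x) ≥ 1 - x.
  have hpos : ∀ x : ℝ, 0 ≤ (1 + Real.exp x * (x - 1)) / 3 := by
    intro x
    have h1 := Real.add_one_le_exp (-x)
    have h2 : Real.exp x * Real.exp (-x) = 1 := by rw [← Real.exp_add]; simp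
    have := mul_le_mul_of_nonneg_left h1 (Real.exp_pos x).le
    rw [h2] at this
    linarith
  have mono2 : Monotone
      (fun x : ℝ => x + (1 / 3) * (Real.exp x - 1 - x) - (1 - x / 3) * (Real.exp x - 1)) :=
    monotone_of_hasDerivAt_nonneg hd2 hpos
  have mono1 : MonotoneOn (fun s : ℝ => s ^ 2 / 2 - (1 - s / 3) * (Real.exp s - 1 - s))
      (Set.Ici 0) := by
    refine monotoneOn_of_deriv_nonneg (convex_Ici 0)
      (fun x _ => (hd1 x).continuousAt.continuousWithinAt)
      (fun x _ => (hd1 x).differentiableAt.differentiableWithinAt) fun x hx => ?_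
    rw [(hd1 x).deriv]
    rw [interior_Ici] at hx
    have := mono2 (le_of_lt hx)
    simpa using this
  have := mono1 (Set.self_mem_Ici) hs hs
  simp at this
  linarith

/-- The exponent of the upper tail. -/
theorem upper_exponent {m l : ℝ} (hm : 0 ≤ m) (hl : 0 < l) :
    ∃ s : ℝ, 0 ≤ s ∧ m * (Real.exp s - 1) - s * (m + l) ≤ -(l ^ 2 / (2 * m + 2 * l / 3)) := by
  have hD : 0 < m + l / 3 := by positivity
  -- With this s one has m = (m + l/3)(1 - s/3). The factor 1 - s/3 in Bernstein's inequality thus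
  -- cancels, m(exp s - 1 - s) is at most sl/2, and the exponent is at most sl/2 - sl.
  refine ⟨l / (m + l / 3), by positivity, ?_⟩
  set s := l / (m + l / 3) with hs
  have hsl : s * (m + l / 3) = l := by rw [hs]; field_simp
  have hb := bernstein_exp_bound (s := s) (by positivity)
  have h1 : (m + l / 3) * (1 - s / 3) = m := by linear_combination (-1 / 3) * hsl
  have h2 : m * (Real.exp s - 1 - s) ≤ s * l / 2 := by
    have := mul_le_mul_of_nonneg_left hb hD.le
    rw [← mul_assoc, h1] at this
    refine this.trans (le_of_eq ?_)
    linear_combination (s / 2) * hsl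
  have h3 : l ^ 2 / (2 * m + 2 * l / 3) = s * l / 2 := by
    rw [hs]; field_simp
  rw [h3]
  linarith

/-- The exponent of the lower tail. -/
theorem lower_exponent {m l : ℝ} (hm : 0 < m) (hl : 0 ≤ l) :
    ∃ s : ℝ, 0 ≤ s ∧ -(m * (1 - Real.exp (-s))) + s * (m - l) ≤ -(l ^ 2 / (2 * m)) := by
  -- The minimizer of the quadratic majorant -ms + ms²/2 + s(m - l).
  refine ⟨l / m, by positivity, ?_⟩
  set s := l / m with hs
  have hs0 : 0 ≤ s := by positivity
  have hsl : s * m = l := by rw [hs]; field_simp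
  -- Dual to exp s ≥ 1 + s + s²/2, since (1 + s + s²/2)(1 - s + s²/2) = 1 + s⁴/4 ≥ 1.
  have key : Real.exp (-s) ≤ 1 - s + s ^ 2 / 2 := by
    have hq := Real.quadratic_le_exp_of_nonneg hs0
    have h2 : Real.exp s * Real.exp (-s) = 1 := by rw [← Real.exp_add]; simp
    have h3 : (1 + s + s ^ 2 / 2) * Real.exp (-s) ≤ 1 := by
      calc _ ≤ Real.exp s * Real.exp (-s) := by gcongr
        _ = 1 := h2
    have h4 : (1 + s + s ^ 2 / 2) * (1 - s + s ^ 2 / 2) ≥ 1 := by nlinarith [sq_nonneg (s ^ 2)]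
    have h5 : 0 < 1 + s + s ^ 2 / 2 := by positivity
    by_contra hcon
    push Not at hcon
    nlinarith
  have h3 : l ^ 2 / (2 * m) = s * l / 2 := by rw [hs]; field_simp
  rw [h3]
  have := mul_le_mul_of_nonneg_left key hm.le
  nlinarith

/-! ### Exponential moments of sums of independent samples -/

namespace Problem

variable {I : Problem}

/-- The only form in which independence of the samples within a collection is needed. -/
theorem E_sampleMany_prod (B : Finset I.Node) (φ : GRR I → ℝ≥0∞) (N : ℕ) :
    (sampleMany B N).E (fun Rs => (Rs.map φ).prod) = ((sampleGRR B).E φ) ^ N := by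
  induction N with
  | zero => simp [sampleMany]
  | succ N ih =>
    simp only [sampleMany, Rand.E_bind, Rand.E_tick, Rand.E_pure, List.map_cons, List.prod_cons,
      Rand.E_const_mul, ih, Rand.E_mul_const]
    ring

theorem sampleMany_length {B : Finset I.Node} {N : ℕ} {Rs : List (GRR I)}
    (h : Rs ∈ (sampleMany B N).Supp) : Rs.length = N := by
  induction N generalizing Rs with
  | zero => simp [sampleMany] at h; simp [h]
  | succ N ih =>
    simp only [sampleMany, Rand.mem_Supp_bind, Rand.mem_Supp_pure] at h
    obtain ⟨_, _, R, _, Rs', h', rfl⟩ := h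
    simp [ih h']

theorem sampleMany_supp {B : Finset I.Node} {N : ℕ} {Rs : List (GRR I)}
    (h : Rs ∈ (sampleMany B N).Supp) : ∀ R ∈ Rs, R ∈ (sampleGRR B).Supp := by
  induction N generalizing Rs with
  | zero => simp [sampleMany] at h; simp [h]
  | succ N ih =>
    simp only [sampleMany, Rand.mem_Supp_bind, Rand.mem_Supp_pure] at h
    obtain ⟨_, _, R, hR, Rs', h', rfl⟩ := h
    intro R' hR'
    rcases List.mem_cons.1 hR' with rfl | hR'
    · exact hR
    · exact ih h' _ hR'

/-- An enlarged collection has the law of a collection drawn at once, so repeated doubling leaves no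
trace in the analysis. -/
theorem E_sampleMany_append (B : Finset I.Node) (M N : ℕ) (φ : List (GRR I) → ℝ≥0∞) :
    ((sampleMany B M).E fun Rs => (sampleMany B N).E fun Rs' => φ (Rs ++ Rs'))
      = (sampleMany B (M + N)).E φ := by
  induction M generalizing φ with
  | zero => simp [sampleMany]
  | succ M ih =>
    rw [Nat.add_right_comm]
    simp only [sampleMany, Rand.E_bind, Rand.E_tick, Rand.E_pure, List.cons_append]
    refine Rand.E_congr fun R _ => ?_
    exact ih fun Rs => φ (R :: Rs)

theorem E_exp_le (B : Finset I.Node) (h : GRR I → ℝ) (s : ℝ) (N : ℕ) (w : ℝ)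
    (hs : (sampleGRR B).E (fun R => ENNReal.ofReal (Real.exp (s * h R)))
      ≤ ENNReal.ofReal (Real.exp w)) :
    (sampleMany B N).E (fun Rs => ENNReal.ofReal (Real.exp (s * (Rs.map h).sum)))
      ≤ ENNReal.ofReal (Real.exp (N * w)) := by
  have : ∀ Rs : List (GRR I), ENNReal.ofReal (Real.exp (s * (Rs.map h).sum))
      = (Rs.map fun R => ENNReal.ofReal (Real.exp (s * h R))).prod := by
    intro Rs
    induction Rs with
    | nil => simp
    | cons R Rs ih =>
      rw [List.map_cons, List.sum_cons, mul_add, Real.exp_add, List.map_cons, List.prod_cons, ← ih,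
        ENNReal.ofReal_mul (Real.exp_pos _).le]
  simp only [this, E_sampleMany_prod]
  calc _ ≤ (ENNReal.ofReal (Real.exp w)) ^ N := by gcongr
    _ = _ := by rw [← ENNReal.ofReal_pow (Real.exp_pos _).le, ← Real.exp_nat_mul]

/-- Markov's inequality for the exponential moment; the sign of s is free, so both tails follow from
it. -/
theorem tail_of_exp (B : Finset I.Node) (h : GRR I → ℝ) (s : ℝ) (N : ℕ) (w y : ℝ)
    (hs : (sampleGRR B).E (fun R => ENNReal.ofReal (Real.exp (s * h R)))
      ≤ ENNReal.ofReal (Real.exp w)) (A : List (GRR I) → Prop) [DecidablePred A]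
    (hA : ∀ Rs, A Rs → y ≤ s * (Rs.map h).sum) :
    (sampleMany B N).E (fun Rs => if A Rs then 1 else 0)
      ≤ ENNReal.ofReal (Real.exp (N * w - y)) := by
  have h1 := Rand.prob_mul_le_E (sampleMany B N) A
    (fun Rs => ENNReal.ofReal (Real.exp (s * (Rs.map h).sum))) (ENNReal.ofReal (Real.exp y))
    (fun Rs _ hR => ENNReal.ofReal_le_ofReal (Real.exp_le_exp.2 (hA Rs hR)))
  have h2 := h1.trans (E_exp_le B h s N w hs)
  have h3 : ENNReal.ofReal (Real.exp (-y)) * ENNReal.ofReal (Real.exp y) = 1 := by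
    rw [← ENNReal.ofReal_mul (Real.exp_pos _).le, ← Real.exp_add]; simp
  calc (sampleMany B N).E (fun Rs => if A Rs then 1 else 0)
      = ENNReal.ofReal (Real.exp (-y)) * (ENNReal.ofReal (Real.exp y) *
        (sampleMany B N).E (fun Rs => if A Rs then 1 else 0)) := by rw [← mul_assoc, h3, one_mul]
    _ ≤ ENNReal.ofReal (Real.exp (-y)) * ENNReal.ofReal (Real.exp (N * w)) := by gcongr
    _ = _ := by
      rw [← ENNReal.ofReal_mul (Real.exp_pos _).le, ← Real.exp_add]
      congr 2; ring

/-- The upper tail of a sum of independent random variables with values in `[0, 1]`. -/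
theorem upper_tail (B : Finset I.Node) (h : GRR I → ℝ)
    (h01 : ∀ R ∈ (sampleGRR B).Supp, 0 ≤ h R ∧ h R ≤ 1) {μ : ℝ} (hμ0 : 0 ≤ μ)
    (hμ : (sampleGRR B).E (fun R => ENNReal.ofReal (h R)) ≤ ENNReal.ofReal μ) (N : ℕ) {l : ℝ}
    (hl : 0 < l) (A : List (GRR I) → Prop) [DecidablePred A]
    (hA : ∀ Rs, A Rs → N * μ + l ≤ (Rs.map h).sum) :
    (sampleMany B N).E (fun Rs => if A Rs then 1 else 0)
      ≤ ENNReal.ofReal (Real.exp (-(l ^ 2 / (2 * (N * μ) + 2 * l / 3)))) := by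
  obtain ⟨s, hs, hexp⟩ := upper_exponent (m := N * μ) (l := l) (by positivity) hl
  have hs1 : 0 ≤ Real.exp s - 1 := by have := Real.add_one_le_exp s; linarith
  refine (tail_of_exp B h s N (μ * (Real.exp s - 1)) (s * (N * μ + l)) ?_ A
    fun Rs hR => by gcongr; exact hA Rs hR).trans
    (ENNReal.ofReal_le_ofReal (Real.exp_le_exp.2 (by linarith)))
  calc (sampleGRR B).E (fun R => ENNReal.ofReal (Real.exp (s * h R)))
      ≤ (sampleGRR B).E (fun R => 1 + ENNReal.ofReal (h R) * ENNReal.ofReal (Real.exp s - 1)) := by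
        refine Rand.E_mono fun R hR => ?_
        obtain ⟨h0, h1⟩ := h01 R hR
        rw [← ENNReal.ofReal_mul h0, ← ENNReal.ofReal_one, ← ENNReal.ofReal_add zero_le_one
          (by positivity)]
        exact ENNReal.ofReal_le_ofReal (exp_mul_le_one_add h0 h1)
    _ ≤ 1 + ENNReal.ofReal μ * ENNReal.ofReal (Real.exp s - 1) := by
        rw [Rand.E_add, Rand.E_const, Rand.E_mul_const]
        gcongr
    _ ≤ _ := by
        rw [← ENNReal.ofReal_mul hμ0, ← ENNReal.ofReal_one, ← ENNReal.ofReal_add zero_le_one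
          (by positivity)]
        refine ENNReal.ofReal_le_ofReal ?_
        have := Real.add_one_le_exp (μ * (Real.exp s - 1))
        linarith

/-- The lower tail of a sum of independent random variables with values in `[0, 1]`. -/
theorem lower_tail (B : Finset I.Node) (h : GRR I → ℝ)
    (h01 : ∀ R ∈ (sampleGRR B).Supp, 0 ≤ h R ∧ h R ≤ 1) {μ : ℝ} (hμ0 : 0 < μ)
    (hμ : ENNReal.ofReal μ ≤ (sampleGRR B).E (fun R => ENNReal.ofReal (h R))) {N : ℕ}
    (hN : 0 < N) {l : ℝ} (hl : 0 ≤ l) (A : List (GRR I) → Prop) [DecidablePred A]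
    (hA : ∀ Rs, A Rs → (Rs.map h).sum ≤ N * μ - l) :
    (sampleMany B N).E (fun Rs => if A Rs then 1 else 0)
      ≤ ENNReal.ofReal (Real.exp (-(l ^ 2 / (2 * (N * μ))))) := by
  obtain ⟨s, hs, hexp⟩ := lower_exponent (m := N * μ) (l := l) (by positivity) hl
  have hs1 : 0 ≤ 1 - Real.exp (-s) := by
    have := Real.exp_le_one_iff.2 (neg_nonpos.2 hs); linarith
  refine (tail_of_exp B h (-s) N (-(μ * (1 - Real.exp (-s)))) (-s * (N * μ - l)) ?_ A
    fun Rs hR => ?_).trans (ENNReal.ofReal_le_ofReal (Real.exp_le_exp.2 (by linarith)))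
  · have key : (sampleGRR B).E (fun R => ENNReal.ofReal (Real.exp (-s * h R)))
        + ENNReal.ofReal μ * ENNReal.ofReal (1 - Real.exp (-s)) ≤ 1 := by
      calc _ ≤ (sampleGRR B).E (fun R => ENNReal.ofReal (Real.exp (-s * h R)))
            + (sampleGRR B).E (fun R => ENNReal.ofReal (h R))
              * ENNReal.ofReal (1 - Real.exp (-s)) := by gcongr
        _ ≤ 1 := by
          rw [← Rand.E_mul_const, ← Rand.E_add]
          refine Rand.E_le_const fun R hR => ?_
          obtain ⟨h0, h1⟩ := h01 R hR
          rw [← ENNReal.ofReal_mul h0, ← ENNReal.ofReal_add (Real.exp_pos _).le (by positivity),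
            ← ENNReal.ofReal_one]
          have := exp_mul_le_one_add (s := -s) h0 h1
          exact ENNReal.ofReal_le_ofReal (by linarith)
    rw [← ENNReal.ofReal_mul hμ0.le] at key
    have h2 := ENNReal.le_sub_of_add_le_right ENNReal.ofReal_ne_top key
    refine h2.trans ?_
    rw [← ENNReal.ofReal_one, ← ENNReal.ofReal_sub _ (by positivity)]
    refine ENNReal.ofReal_le_ofReal ?_
    have := Real.add_one_le_exp (-(μ * (1 - Real.exp (-s))))
    linarith
  · have := mul_le_mul_of_nonneg_left (hA Rs hR) hs
    linarith

/-- The upper confidence bound is valid with probability `1 - δ`. -/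
theorem upperBound_tail (B : Finset I.Node) (h : GRR I → ℝ)
    (h01 : ∀ R ∈ (sampleGRR B).Supp, 0 ≤ h R ∧ h R ≤ 1) {μ : ℝ} (hμ0 : 0 ≤ μ)
    (hμ : ENNReal.ofReal μ ≤ (sampleGRR B).E (fun R => ENNReal.ofReal (h R))) {N : ℕ}
    (hN : 0 < N) {δ : ℝ} (hδ : 0 < δ) (hδ1 : δ ≤ 1) (A : List (GRR I) → Prop) [DecidablePred A]
    (hA : ∀ Rs, A Rs → 0 ≤ (Rs.map h).sum ∧ upperBound (Rs.map h).sum N δ < μ) :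
    (sampleMany B N).E (fun Rs => if A Rs then 1 else 0) ≤ ENNReal.ofReal δ := by
  set η := Real.log (1 / δ) with hη
  have hη0 : 0 ≤ η := Real.log_nonneg (by rw [le_div_iff₀ hδ]; linarith)
  have hexp : Real.exp (-η) = δ := by
    rw [hη, Real.exp_neg, Real.exp_log (by positivity)]; simp
  have hN' : (0 : ℝ) < N := by exact_mod_cast hN
  -- For mean 0 the event is empty, as the bound is nonnegative. The lower tail below divides by the
  -- mean and needs it positive.
  rcases hμ0.eq_or_lt with rfl | hμ0
  · have : ∀ Rs, ¬ A Rs := by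
      intro Rs hR
      have h2 := (hA Rs hR).2
      unfold upperBound at h2
      have : 0 ≤ (√((Rs.map h).sum + Real.log (1 / δ) / 2) + √(Real.log (1 / δ) / 2)) ^ 2
        * (1 / (N : ℝ)) := by positivity
      linarith
    simp [this]
  -- This deviation makes the exponent equal to η. Writing r² = Nμ, q² = η/2 and p² = Ω + η/2, it
  -- equals 2rq; from p + q ≤ r one gets Ω = p² - q² ≤ r² - 2rq.
  refine (lower_tail B h h01 hμ0 hμ hN (l := √(2 * (N * μ) * η)) (Real.sqrt_nonneg _) A
    fun Rs hR => ?_).trans ?_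
  · obtain ⟨h0, hu⟩ := hA Rs hR
    set Ω := (Rs.map h).sum
    unfold upperBound at hu
    rw [← hη, mul_one_div, div_lt_iff₀ hN'] at hu
    set p := √(Ω + η / 2)
    set q := √(η / 2)
    have hp : p ^ 2 = Ω + η / 2 := Real.sq_sqrt (by positivity)
    have hq : q ^ 2 = η / 2 := Real.sq_sqrt (by positivity)
    set r := √(N * μ)
    have hr : r ^ 2 = N * μ := Real.sq_sqrt (by positivity)
    have hrq : √(2 * (N * μ) * η) = 2 * r * q := by
      rw [Real.sqrt_eq_iff_mul_self_eq (by positivity) (by positivity)]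
      nlinarith
    have hp0 : 0 ≤ p := Real.sqrt_nonneg _
    have hq0 : 0 ≤ q := Real.sqrt_nonneg _
    have hr0 : 0 ≤ r := Real.sqrt_nonneg _
    have hpr : p + q ≤ r := by
      refine le_of_lt (lt_of_pow_lt_pow_left₀ 2 hr0 ?_)
      rw [hr]; linarith
    rw [hrq]
    nlinarith
  · rw [Real.sq_sqrt (by positivity)]
    have : 2 * (N * μ) * η / (2 * (N * μ)) = η := by field_simp
    rw [this, hexp]

/-- The lower confidence bound is valid with probability `1 - δ`. -/
theorem lowerBound_tail (B : Finset I.Node) (h : GRR I → ℝ)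
    (h01 : ∀ R ∈ (sampleGRR B).Supp, 0 ≤ h R ∧ h R ≤ 1) {μ : ℝ} (hμ0 : 0 ≤ μ)
    (hμ : (sampleGRR B).E (fun R => ENNReal.ofReal (h R)) ≤ ENNReal.ofReal μ) {N : ℕ}
    (hN : 0 < N) {δ : ℝ} (hδ : 0 < δ) (hδ1 : δ < 1) (A : List (GRR I) → Prop) [DecidablePred A]
    (hA : ∀ Rs, A Rs → 0 ≤ (Rs.map h).sum ∧ μ < lowerBound (Rs.map h).sum N δ) :
    (sampleMany B N).E (fun Rs => if A Rs then 1 else 0) ≤ ENNReal.ofReal δ := by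
  set η := Real.log (1 / δ) with hη
  have hη0 : 0 < η := Real.log_pos (by rw [lt_div_iff₀ hδ]; linarith)
  have hexp : Real.exp (-η) = δ := by
    rw [hη, Real.exp_neg, Real.exp_log (by positivity)]; simp
  have hN' : (0 : ℝ) < N := by exact_mod_cast hN
  set r := √(N * μ + η / 18)
  have hr : r ^ 2 = N * μ + η / 18 := Real.sq_sqrt (by positivity)
  have hr0 : 0 ≤ r := Real.sqrt_nonneg _
  set q := √(η / 2)
  have hq : q ^ 2 = η / 2 := Real.sq_sqrt (by positivity)
  have hq0 : 0 < q := Real.sqrt_pos.2 (by positivity)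
  have hrq : q / 3 ≤ r := by
    refine le_of_sq_le_sq ?_ hr0
    have : 0 ≤ N * μ := by positivity
    nlinarith
  -- The deviation l = η/3 + 2qr is the positive root of l² = η(2Nμ + 2l/3), so Bernstein's exponent
  -- is exactly η.
  have hl : 0 < η / 3 + 2 * q * r := by positivity
  refine (upper_tail B h h01 hμ0 hμ N hl A fun Rs hR => ?_).trans ?_
  · obtain ⟨h0, hu⟩ := hA Rs hR
    set Ω := (Rs.map h).sum
    unfold lowerBound at hu
    rw [← hη, mul_one_div, lt_div_iff₀ hN'] at hu
    set p := √(Ω + 2 * η / 9)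
    have hp : p ^ 2 = Ω + 2 * η / 9 := Real.sq_sqrt (by positivity)
    have hp0 : 0 ≤ p := Real.sqrt_nonneg _
    have hp1 : 2 * q / 3 ≤ p := by
      refine le_of_sq_le_sq ?_ hp0
      nlinarith
    have hsq : r ^ 2 < (p - q) ^ 2 := by
      change μ * N < (p - q) ^ 2 - η / 18 at hu
      rw [hr]; linarith
    -- Taking the root of r² < (p - q)² leaves a sign to decide. The negative branch is impossible:
    -- p ≥ 2q/3 and r ≥ q/3 give p - q ≥ -r.
    have hpr : q + r ≤ p := by
      by_contra hcon
      push Not at hcon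
      have h3 : -r ≤ p - q := by linarith
      have h4 : p - q ≤ r := by linarith
      have := abs_le.2 ⟨h3, h4⟩
      have := sq_le_sq' h3 h4
      linarith
    nlinarith
  · refine ENNReal.ofReal_le_ofReal ?_
    rw [← hexp]
    refine Real.exp_le_exp.2 (neg_le_neg ?_)
    rw [le_div_iff₀ (by positivity)]
    nlinarith

end Problem

end

end CCDIM

namespace CCDIM

open scoped ENNReal

/-! ## Reverse reachable sets -/

noncomputable section

namespace Problem

variable {I : Problem}

/-- A reverse reachable set or placeholder is hit by `A`. -/
def Hits (A : Finset I.Node) : Option (List I.Node) → Prop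
  | none => True
  | some L => ∃ v ∈ A, v ∈ L

instance (A : Finset I.Node) (o : Option (List I.Node)) : Decidable (Hits A o) :=
  Classical.propDecidable _

theorem scan_none {S : Finset I.Node} {ws H R : List I.Node} (h : (scan S ws H R).val = none) :
    ∃ w ∈ ws, w ∈ S := by
  induction ws generalizing H R with
  | nil => simp [scan] at h
  | cons w ws ih =>
    simp only [scan, Timed.val_bind] at h
    split_ifs at h with h1 h2
    · obtain ⟨u, hu, huS⟩ := ih h
      exact ⟨u, by simp [hu], huS⟩
    · exact ⟨w, by simp, h2⟩
    · obtain ⟨u, hu, huS⟩ := ih h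
      exact ⟨u, by simp [hu], huS⟩

theorem scan_some {S : Finset I.Node} {ws H R H' R' : List I.Node}
    (h : (scan S ws H R).val = some (H', R')) :
    ∃ N, H' = H ++ N ∧ R' = R ++ N ∧ (R.Nodup → R'.Nodup) ∧ (∀ w ∈ N, w ∈ ws ∧ w ∉ S) ∧
      ∀ w ∈ ws, w ∈ R' := by
  induction ws generalizing H R with
  | nil =>
    simp only [scan, Timed.val_pure, Option.some.injEq, Prod.mk.injEq] at h
    exact ⟨[], by simp [h.1], by simp [h.2], by simp [h.2], by simp, by simp⟩
  | cons w ws ih =>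
    simp only [scan, Timed.val_bind] at h
    split_ifs at h with h1 h2
    · obtain ⟨N, rfl, rfl, h3, h4, h5⟩ := ih h
      exact ⟨N, rfl, rfl, h3, fun u hu => ⟨by simp [(h4 u hu).1], (h4 u hu).2⟩,
        fun u hu => by rcases List.mem_cons.1 hu with rfl | hu; exacts [by simp [h1], h5 u hu]⟩
    · obtain ⟨N, rfl, rfl, h3, h4, h5⟩ := ih h
      refine ⟨w :: N, by simp, by simp, fun hR => h3 ?_, fun u hu => ?_, fun u hu => ?_⟩
      · rw [List.nodup_append]
        exact ⟨hR, by simp, fun a ha b hb => by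
          rw [List.mem_singleton] at hb; rintro rfl; exact h1 (hb ▸ ha)⟩
      · rcases List.mem_cons.1 hu with rfl | hu
        · exact ⟨by simp, h2⟩
        · exact ⟨by simp [(h4 u hu).1], (h4 u hu).2⟩
      · rcases List.mem_cons.1 hu with rfl | hu
        · simp
        · exact h5 u hu

/-- `s` reaches `v` along the edges given by the lists of live in-neighbours. -/
abbrev Reaches (live : I.Node → List I.Node) (s v : I.Node) : Prop :=
  Relation.ReflTransGen (fun x y => x ∈ live y) s v

/-- Invariant of breadth-first search: P holds the popped nodes, the marked list is P followed by
the queue, all marked nodes reach the root and avoid S, and live in-neighbours of popped nodes are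
marked. The last hypothesis says that the fuel is enough for all nodes that are not yet popped. -/
theorem search_spec {S : Finset I.Node} {live : I.Node → List I.Node} {v : I.Node} (fuel : ℕ)
    (P H R : List I.Node) (hR : R = P ++ H) (hnd : R.Nodup) (hS : ∀ x ∈ R, x ∉ S)
    (hreach : ∀ x ∈ R, Reaches live x v) (hclosed : ∀ u ∈ P, ∀ w ∈ live u, w ∈ R) (hv : v ∈ R)
    (hfuel : I.n ≤ fuel + P.length) :
    ((search S live fuel H R).val = none → ∃ s ∈ S, Reaches live s v) ∧
    ∀ R', (search S live fuel H R).val = some R' →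
      R'.Nodup ∧ (∀ x ∈ R', x ∉ S) ∧ ∀ x, x ∈ R' ↔ Reaches live x v := by
  -- With an empty queue all marked nodes are popped, so the marked set is closed under live
  -- in-neighbours; induction backwards along a path to v shows that it contains every node reaching
  -- v.
  have done : H = [] → R.Nodup ∧ (∀ x ∈ R, x ∉ S) ∧ ∀ x, x ∈ R ↔ Reaches live x v := by
    rintro rfl
    refine ⟨hnd, hS, fun x => ⟨hreach x, fun hx => ?_⟩⟩
    induction hx using Relation.ReflTransGen.head_induction_on with
    | refl => exact hv
    | head hab _ ih => exact hclosed _ (by simpa [hR] using ih) _ hab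
  induction fuel generalizing P H R with
  | zero =>
    -- At fuel 0 already n nodes are popped. The marked list has no repetition, so nothing is left
    -- for the queue.
    have : R.length ≤ I.n := by simpa using hnd.length_le_card
    have hH : H = [] := by
      rw [hR, List.length_append] at this
      exact List.length_eq_zero_iff.1 (by omega)
    simp only [search, Timed.val_pure]
    refine ⟨by simp, fun R' h => ?_⟩
    cases h
    exact done hH
  | succ fuel ih =>
    cases H with
    | nil =>
      simp only [search, Timed.val_pure]
      refine ⟨by simp, fun R' h => ?_⟩
      cases h
      exact done rfl
    | cons u H =>
      have hu : u ∈ R := by simp [hR]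
      simp only [search, Timed.val_bind]
      rcases hscan : (scan S (live u) H R).val with _ | ⟨H', R'⟩
      · simp only [Timed.val_pure]
        refine ⟨fun _ => ?_, by simp⟩
        obtain ⟨w, hw, hwS⟩ := scan_none hscan
        exact ⟨w, hwS, .head hw (hreach u hu)⟩
      · obtain ⟨N, rfl, rfl, h3, h4, h5⟩ := scan_some hscan
        have hS' : ∀ x ∈ R ++ N, x ∉ S := by
          intro x hx
          rcases List.mem_append.1 hx with hx | hx
          exacts [hS x hx, (h4 x hx).2]
        have hreach' : ∀ x ∈ R ++ N, Reaches live x v := by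
          intro x hx
          rcases List.mem_append.1 hx with hx | hx
          exacts [hreach x hx, .head (h4 x hx).1 (hreach u hu)]
        have hcl' : ∀ u' ∈ P ++ [u], ∀ w ∈ live u', w ∈ R ++ N := by
          intro u' hu' w hw
          rcases List.mem_append.1 hu' with hu' | hu'
          · simp [hclosed u' hu' w hw]
          · rw [List.mem_singleton] at hu'
            subst hu'
            exact h5 w hw
        have hv' : v ∈ R ++ N := by simp [hv]
        have hR' : R ++ N = (P ++ [u]) ++ (H ++ N) := by simp [hR]
        refine ih (P ++ [u]) (H ++ N) (R ++ N) hR' (h3 hnd) hS' hreach' hcl' hv' (by simp; omega)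
          ?_
        intro hH
        rw [hH] at hR'
        refine ⟨h3 hnd, hS', fun x => ⟨hreach' x, fun hx => ?_⟩⟩
        induction hx using Relation.ReflTransGen.head_induction_on with
        | refl => exact hv'
        | head hab _ ih => exact hcl' _ (by rw [hR'] at ih; simpa using ih) _ hab

theorem search_start {S : Finset I.Node} {live : I.Node → List I.Node} {v : I.Node}
    (hv : v ∉ S) :
    ((search S live I.n [v] [v]).val = none → ∃ s ∈ S, Reaches live s v) ∧
    ∀ R', (search S live I.n [v] [v]).val = some R' →
      R'.Nodup ∧ (∀ x ∈ R', x ∉ S) ∧ ∀ x, x ∈ R' ↔ Reaches live x v :=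
  search_spec I.n [] [v] [v] rfl (by simp) (by simpa using hv)
    (by simp only [List.mem_singleton]; rintro x rfl; exact .refl) (by simp) (by simp) (by simp)

/-- Stopping early loses no information for sets that contain the sentinel set: the placeholder
appears only if S reaches the root, and a completed search shows that S does not. A sample with
sentinel set S therefore tests A ∪ S. -/
theorem hits_search {S A : Finset I.Node} {live : I.Node → List I.Node} {v : I.Node}
    (hv : v ∉ S) :
    Hits A (search S live I.n [v] [v]).val ↔ ∃ s ∈ A ∪ S, Reaches live s v := by
  obtain ⟨h1, h2⟩ := search_start (live := live) hv
  rcases hs : (search S live I.n [v] [v]).val with _ | R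
  · obtain ⟨s, hs, hr⟩ := h1 hs
    simp only [Hits, true_iff]
    exact ⟨s, by simp [hs], hr⟩
  · obtain ⟨-, h3, h4⟩ := h2 R hs
    simp only [Hits, h4]
    constructor
    · rintro ⟨s, hs, hr⟩
      exact ⟨s, by simp [hs], hr⟩
    · rintro ⟨s, hs, hr⟩
      rcases Finset.mem_union.1 hs with hs | hs
      · exact ⟨s, hs, hr⟩
      · exact absurd hs (h3 s ((h4 s).2 hr))

/-! ## The law of the realization -/

/-- The expectation of a function of a random subset of `F` that contains `e` with probability
`p e`, independently. -/
def subsetExp {ι : Type} [DecidableEq ι] (p : ι → unitInterval) (F : Finset ι)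
    (ψ : Finset ι → ℝ≥0∞) : ℝ≥0∞ :=
  ∑ g ∈ F.powerset,
    ENNReal.ofReal ((∏ e ∈ g, (p e : ℝ)) * ∏ e ∈ F \ g, (1 - (p e : ℝ))) * ψ g

section subsetExp

variable {ι : Type} [DecidableEq ι] (p : ι → unitInterval)

theorem subsetExp_empty (ψ : Finset ι → ℝ≥0∞) : subsetExp p ∅ ψ = ψ ∅ := by
  simp [subsetExp]

theorem subsetExp_insert {e : ι} {F : Finset ι} (he : e ∉ F) (ψ : Finset ι → ℝ≥0∞) :
    subsetExp p (insert e F) ψ = ENNReal.ofReal (p e) * subsetExp p F (fun g => ψ (insert e g))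
      + ENNReal.ofReal (1 - p e) * subsetExp p F ψ := by
  rw [subsetExp, Finset.sum_powerset_insert he, add_comm, subsetExp, subsetExp, Finset.mul_sum,
    Finset.mul_sum]
  congr 1
  · refine Finset.sum_congr rfl fun g hg => ?_
    have heg : e ∉ g := fun h => he (Finset.mem_powerset.1 hg h)
    rw [← mul_assoc, ← ENNReal.ofReal_mul (p e).2.1, Finset.prod_insert heg,
      Finset.insert_sdiff_insert, Finset.sdiff_insert_of_notMem he, mul_assoc]
  · refine Finset.sum_congr rfl fun g hg => ?_
    have heg : e ∉ g := fun h => he (Finset.mem_powerset.1 hg h)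
    rw [← mul_assoc, ← ENNReal.ofReal_mul (by have := (p e).2.2; linarith),
      Finset.insert_sdiff_of_notMem _ heg, Finset.prod_insert (by simp [he])]
    congr 2; ring

theorem subsetExp_congr {F : Finset ι} {ψ ψ' : Finset ι → ℝ≥0∞} (h : ∀ g ⊆ F, ψ g = ψ' g) :
    subsetExp p F ψ = subsetExp p F ψ' :=
  Finset.sum_congr rfl fun g hg => by rw [h g (Finset.mem_powerset.1 hg)]

theorem subsetExp_union {F F' : Finset ι} (h : Disjoint F F') (ψ : Finset ι → ℝ≥0∞) :
    subsetExp p (F ∪ F') ψ = subsetExp p F fun g => subsetExp p F' fun g' => ψ (g ∪ g') := by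
  induction F using Finset.induction_on generalizing ψ with
  | empty => simp [subsetExp_empty]
  | insert e F he ih =>
    rw [Finset.disjoint_insert_left] at h
    rw [Finset.insert_union, subsetExp_insert p (by simp [he, h.1]), subsetExp_insert p he,
      ih h.2, ih h.2]
    simp only [Finset.insert_union]

end subsetExp

/-! ### The sampled in-neighbour lists as a random edge set -/

theorem tsum_coin (p : unitInterval) (φ : Bool → ℝ≥0∞) :
    ∑' b, coin p b * φ b = ENNReal.ofReal p * φ true + ENNReal.ofReal (1 - p) * φ false := by
  rw [tsum_fintype, Fintype.sum_bool]
  simp [coin]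

/-- The lists of live in-neighbours in the realization `g`. -/
def liveOf (I : Problem) (g : Finset (I.Node × I.Node)) (v : I.Node) : List I.Node :=
  (I.inNbrs v).filter fun u => (u, v) ∈ g

/-- Tossing the coins one after another is the recursion `subsetExp_insert` for a random subset; as
the list has no repetition, a later coin does not affect an earlier membership. -/
theorem E_coin_fold (v : I.Node) (l : List I.Node) (hl : l.Nodup) (L : List I.Node)
    (φ : List I.Node → ℝ≥0∞) :
    (l.foldlM (fun L u => do
      Rand.tick 1
      let b ← Rand.draw (coin (I.p (u, v)))
      pure (if b then L ++ [u] else L)) L : Rand (List I.Node)).E φ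
    = subsetExp I.p (l.map fun u => (u, v)).toFinset
        fun g => φ (L ++ l.filter fun u => (u, v) ∈ g) := by
  induction l generalizing L with
  | nil => simp [subsetExp_empty]
  | cons u l ih =>
    rw [List.nodup_cons] at hl
    have hu : (u, v) ∉ (l.map fun u => (u, v)).toFinset := by simp [hl.1]
    rw [List.foldlM_cons]
    simp only [Rand.E_bind, Rand.E_tick, Rand.E_draw, Rand.E_pure, tsum_coin, if_true,
      Bool.false_eq_true, if_false]
    rw [ih hl.2, ih hl.2, List.map_cons, List.toFinset_cons, subsetExp_insert I.p hu]
    congr 2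
    · refine subsetExp_congr I.p fun g hg => ?_
      congr 1
      rw [List.filter_cons_of_pos (by simp), List.append_assoc, List.singleton_append]
      congr 2
      refine List.filter_congr fun w hw => ?_
      have : w ≠ u := fun h => hl.1 (h ▸ hw)
      simp [this]
    · refine subsetExp_congr I.p fun g hg => ?_
      congr 2
      rw [List.filter_cons_of_neg]
      simpa using fun h => hu (hg h)

theorem inNbrs_nodup (v : I.Node) : (I.inNbrs v).Nodup := (List.nodup_finRange _).filter _

theorem mem_inNbrs {u v : I.Node} : u ∈ I.inNbrs v ↔ (u, v) ∈ I.E := by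
  simp [inNbrs]

/-- The edges are grouped by their heads. The in-edges of different nodes are disjoint, so the
random subsets drawn node by node combine, through `subsetExp_union`, into one random subset of all
edges with these heads. -/
theorem E_node_fold (vs : List I.Node) (hvs : vs.Nodup) (live : I.Node → List I.Node)
    (Φ : (I.Node → List I.Node) → ℝ≥0∞) :
    (vs.foldlM (fun live v => do
      Rand.tick 1
      let L ← (I.inNbrs v).foldlM (fun L u => do
        Rand.tick 1
        let b ← Rand.draw (coin (I.p (u, v)))
        pure (if b then L ++ [u] else L)) []
      pure (Function.update live v L)) live : Rand (I.Node → List I.Node)).E Φ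
    = subsetExp I.p (I.E.filter fun e => e.2 ∈ vs)
        fun g => Φ fun v => if v ∈ vs then I.liveOf g v else live v := by
  induction vs generalizing live with
  | nil => simp [subsetExp_empty]
  | cons v vs ih =>
    rw [List.nodup_cons] at hvs
    rw [List.foldlM_cons]
    simp only [Rand.E_bind, Rand.E_tick, Rand.E_pure, ih hvs.2]
    have := E_coin_fold (I := I) v (I.inNbrs v) (inNbrs_nodup v) []
      (fun L => subsetExp I.p (I.E.filter fun e => e.2 ∈ vs)
        fun g => Φ fun w => if w ∈ vs then I.liveOf g w else Function.update live v L w)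
    rw [this]
    have hF : (I.E.filter fun e => e.2 ∈ v :: vs) =
        ((I.inNbrs v).map fun u => (u, v)).toFinset ∪ I.E.filter fun e => e.2 ∈ vs := by
      ext ⟨a, b⟩
      simp only [Finset.mem_filter, List.mem_cons, Finset.mem_union, List.mem_toFinset,
        List.mem_map, mem_inNbrs, Prod.mk.injEq]
      constructor
      · rintro ⟨h1, rfl | h2⟩
        · exact Or.inl ⟨a, h1, rfl, rfl⟩
        · exact Or.inr ⟨h1, h2⟩
      · rintro (⟨u, h1, rfl, rfl⟩ | ⟨h1, h2⟩)
        · exact ⟨h1, Or.inl rfl⟩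
        · exact ⟨h1, Or.inr h2⟩
    have hdisj : Disjoint ((I.inNbrs v).map fun u => (u, v)).toFinset
        (I.E.filter fun e => e.2 ∈ vs) := by
      rw [Finset.disjoint_left]
      rintro ⟨a, b⟩ h1 h2
      simp only [List.mem_toFinset, List.mem_map, Prod.mk.injEq] at h1
      obtain ⟨u, _, rfl, rfl⟩ := h1
      exact hvs.1 (Finset.mem_filter.1 h2).2
    rw [hF, subsetExp_union I.p hdisj]
    refine subsetExp_congr I.p fun g hg => subsetExp_congr I.p fun g' hg' => ?_
    congr 1
    funext w
    by_cases hw : w = v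
    · subst hw
      simp only [hvs.1, if_false, Function.update_self, List.nil_append, List.mem_cons, true_or,
        if_true, liveOf]
      refine List.filter_congr fun u hu => ?_
      have : (u, w) ∉ g' := fun h => hvs.1 (Finset.mem_filter.1 (hg' h)).2
      simp [this]
    · simp only [List.mem_cons, hw, false_or, ne_eq, not_false_eq_true, Function.update_of_ne]
      split_ifs with h1
      · refine List.filter_congr fun u hu => ?_
        have : (u, w) ∉ g := by
          intro h
          have := hg h
          simp only [List.mem_toFinset, List.mem_map, Prod.mk.injEq] at this
          obtain ⟨_, _, _, h3⟩ := this
          exact hw h3.symm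
        simp [this]
      · rfl

theorem E_sampleRealization (Φ : (I.Node → List I.Node) → ℝ≥0∞) :
    I.sampleRealization.E Φ = subsetExp I.p I.E fun g => Φ (I.liveOf g) := by
  have := E_node_fold (I := I) (List.finRange I.n) (List.nodup_finRange _) (fun _ => []) Φ
  simp only [List.mem_finRange, if_true, Finset.filter_true] at this
  exact this

theorem reaches_liveOf {g : Finset (I.Node × I.Node)} (hg : g ⊆ I.E) (A : Finset I.Node)
    (v : I.Node) : (∃ s ∈ A, Reaches (I.liveOf g) s v) ↔ v ∈ I.activated g A := by
  have : (fun x y => x ∈ I.liveOf g y) = fun x y => (x, y) ∈ g := by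
    funext x y
    simp only [liveOf, List.mem_filter, mem_inNbrs, decide_eq_true_eq, eq_iff_iff]
    exact ⟨fun h => h.2, fun h => ⟨hg h, h⟩⟩
  simp [activated, Reaches, this]

end Problem

end

end CCDIM

namespace CCDIM

open scoped ENNReal

/-! ## The mean of the generalized coverage of one sample -/

noncomputable section

namespace Problem

variable {I : Problem}

theorem keys_eq_sigma : I.keys =
    (List.finRange I.numMetrics).sigma fun q => List.finRange (I.r q) := rfl

theorem keys_nodup : I.keys.Nodup := by
  rw [keys_eq_sigma]
  exact (List.nodup_finRange _).sigma fun _ => List.nodup_finRange _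

theorem mem_keys (x : I.Key) : x ∈ I.keys := by
  rw [keys_eq_sigma]
  obtain ⟨q, j⟩ := x
  simp [List.mem_sigma]

theorem sum_keys {M : Type} [AddCommMonoid M] (f : I.Key → M) :
    (I.keys.map f).sum = ∑ x, f x := by
  rw [← List.sum_toFinset _ keys_nodup]
  congr 1
  ext x
  simp [mem_keys]

theorem length_keys : I.keys.length = I.numKeys := by
  have := sum_keys (I := I) (fun _ => 1)
  simpa [numKeys] using this

/-- The law of one entry of a generalized reverse reachable set, given the realization. -/
def entry (S : Finset I.Node) (live : I.Node → List I.Node) (x : I.Key) :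
    Rand (Option (List I.Node)) := do
  let v ← Rand.draw (PMF.uniformOfFinset (I.community x) (I.community_nonempty x))
  if v ∈ S then pure none else pure (search S live I.n [v] [v]).val

/-- One round of the sampling loop. -/
def sampleStep (S : Finset I.Node) (live : I.Node → List I.Node) (R : GRR I) (x : I.Key) :
    Rand (GRR I) := do
  Rand.tick 1
  let v ← Rand.draw (PMF.uniformOfFinset (I.community x) (I.community_nonempty x))
  if v ∈ S then pure (Function.update R x none)
  else do
    Rand.tick I.n
    let out ← Rand.lift (search S live I.n [v] [v])
    pure (Function.update R x out)

theorem sampleGRR_eq (S : Finset I.Node) : sampleGRR S = (do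
    let live ← I.sampleRealization
    I.keys.foldlM (sampleStep S live) (fun _ => none)) := rfl

theorem E_sampleStep (S : Finset I.Node) (live : I.Node → List I.Node) (R : GRR I) (x : I.Key)
    (φ : GRR I → ℝ≥0∞) :
    (sampleStep S live R x).E φ = (entry S live x).E fun o => φ (Function.update R x o) := by
  simp only [sampleStep, entry, Rand.E_bind, Rand.E_tick, Rand.E_draw]
  refine tsum_congr fun v => ?_
  split_ifs <;> simp

theorem Supp_sampleStep {S : Finset I.Node} {live : I.Node → List I.Node} {R R' : GRR I}
    {x : I.Key} (h : R' ∈ (sampleStep S live R x).Supp) :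
    ∃ o ∈ (entry S live x).Supp, R' = Function.update R x o := by
  simp only [sampleStep, Rand.mem_Supp_bind, Rand.mem_Supp_tick, Rand.mem_Supp_draw] at h
  obtain ⟨_, _, v, hv, h⟩ := h
  split_ifs at h with hS
  · refine ⟨none, ?_, Rand.mem_Supp_pure.1 h⟩
    simp only [entry, Rand.mem_Supp_bind, Rand.mem_Supp_draw]
    exact ⟨v, hv, by simp [hS]⟩
  · simp only [Rand.mem_Supp_bind, Rand.mem_Supp_lift, Rand.mem_Supp_pure] at h
    obtain ⟨_, _, o, rfl, h⟩ := h
    refine ⟨_, ?_, h⟩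
    simp only [entry, Rand.mem_Supp_bind, Rand.mem_Supp_draw]
    exact ⟨v, hv, by simp [hS]⟩

theorem entry_valid {S : Finset I.Node} {live : I.Node → List I.Node} {x : I.Key}
    {L : List I.Node} (h : some L ∈ (entry S live x).Supp) : L.Nodup ∧ ∀ v ∈ L, v ∉ S := by
  simp only [entry, Rand.mem_Supp_bind, Rand.mem_Supp_draw] at h
  obtain ⟨v, hv, h⟩ := h
  split_ifs at h with hS
  · simp at h
  · rw [Rand.mem_Supp_pure] at h
    obtain ⟨h1, h2, -⟩ := (search_start (live := live) hS).2 L h.symm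
    exact ⟨h1, h2⟩

/-- The reverse reachable sets of a sample with sentinel set `S` are lists without repetitions that
avoid `S`. -/
def ValidGRR (S : Finset I.Node) (R : GRR I) : Prop :=
  ∀ x L, R x = some L → L.Nodup ∧ ∀ v ∈ L, v ∉ S

theorem sampleGRR_valid {S : Finset I.Node} {R : GRR I} (h : R ∈ (sampleGRR S).Supp) :
    ValidGRR S R := by
  rw [sampleGRR_eq, Rand.mem_Supp_bind] at h
  obtain ⟨live, -, h⟩ := h
  refine Rand.Supp_foldlM (ValidGRR S) (sampleStep S live) I.keys ?_ (fun _ => none) ?_ R h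
  · intro R x _ hR R' hR' y L hy
    obtain ⟨o, ho, rfl⟩ := Supp_sampleStep hR'
    by_cases hyx : y = x
    · subst hyx
      rw [Function.update_self] at hy
      exact entry_valid (hy ▸ ho)
    · rw [Function.update_of_ne hyx] at hy
      exact hR y L hy
  · intro x L hx
    simp at hx

/-- For a fixed realization the entries are drawn independently, but only linearity of expectation
is needed, so any sum of functions of single entries suffices. -/
theorem E_sample_fold (S : Finset I.Node) (live : I.Node → List I.Node) (l : List I.Key)
    (hl : l.Nodup) (R : GRR I) (h : I.Key → Option (List I.Node) → ℝ≥0∞) :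
    (l.foldlM (sampleStep S live) R).E (fun R => (l.map fun x => h x (R x)).sum)
      = (l.map fun x => (entry S live x).E (h x)).sum := by
  induction l generalizing R with
  | nil => simp
  | cons x l ih =>
    rw [List.nodup_cons] at hl
    rw [List.foldlM_cons, Rand.E_bind, E_sampleStep]
    simp only [List.map_cons, List.sum_cons, Rand.E_add, ih hl.2, Rand.E_const]
    congr 1
    refine Rand.E_congr fun o _ => ?_
    rw [← Rand.E_const (l.foldlM (sampleStep S live) (Function.update R x o)) (h x o)]
    refine Rand.E_congr fun R' hR' => ?_
    -- Later rounds write to other keys, because the keys are distinct.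
    have : R' x = o := by
      refine Rand.Supp_foldlM (fun R => R x = o) (sampleStep S live) l ?_ _ ?_ R' hR'
      · intro R y hy hR R' hR'
        obtain ⟨o', -, rfl⟩ := Supp_sampleStep hR'
        have hxy : x ≠ y := fun h => hl.1 (h ▸ hy)
        simpa [Function.update_of_ne hxy] using hR
      · simp
    rw [this]

/-- The probability that `A` covers the entry `x`, given the realization `g`. -/
theorem E_entry_hits (A B : Finset I.Node) {g : Finset (I.Node × I.Node)} (hg : g ⊆ I.E)
    (x : I.Key) (c : ℝ≥0∞) :
    (entry B (I.liveOf g) x).E (fun o => if Hits A o then c else 0)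
      = ((I.activated g (A ∪ B) ∩ I.community x).card : ℝ≥0∞) * ((I.community x).card : ℝ≥0∞)⁻¹ * c := by
  simp only [entry, Rand.E_bind, Rand.E_draw]
  have key : ∀ v, (if v ∈ B then pure none else pure (search B (I.liveOf g) I.n [v] [v]).val :
      Rand (Option (List I.Node))).E (fun o => if Hits A o then c else 0)
      = if v ∈ I.activated g (A ∪ B) then c else 0 := by
    intro v
    have hr := reaches_liveOf hg (A ∪ B) v
    split_ifs with h1 h2 h2
    · simp [Hits]
    · exact absurd (hr.1 ⟨v, by simp [h1], .refl⟩) h2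
    · rw [Rand.E_pure, if_pos ((hits_search h1).2 (hr.2 h2))]
    · rw [Rand.E_pure, if_neg (fun h => h2 (hr.1 ((hits_search h1).1 h)))]
  simp only [key, PMF.uniformOfFinset_apply]
  rw [tsum_fintype]
  have : ∀ v, (if v ∈ I.community x then ((I.community x).card : ℝ≥0∞)⁻¹ else 0) *
      (if v ∈ I.activated g (A ∪ B) then c else 0)
      = if v ∈ I.activated g (A ∪ B) ∩ I.community x
        then ((I.community x).card : ℝ≥0∞)⁻¹ * c else 0 := by
    intro v
    by_cases h1 : v ∈ I.community x <;> by_cases h2 : v ∈ I.activated g (A ∪ B) <;> simp [h1, h2]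
  refine (Finset.sum_congr rfl fun v _ => Eq.trans (by congr!) (this v)).trans ?_
  rw [Finset.sum_ite_mem, Finset.univ_inter, Finset.sum_const, nsmul_eq_mul, mul_assoc]

/-! ### The objective function -/

theorem sum_card_community (q : Fin I.numMetrics) (A : Finset I.Node) :
    ∑ j, ((A ∩ I.community ⟨q, j⟩).card : ℝ) = A.card := by
  rw [← Nat.cast_sum]
  congr 1
  rw [Finset.card_eq_sum_card_fiberwise (f := I.comm q) (t := Finset.univ) (by simp)]
  refine Finset.sum_congr rfl fun j _ => ?_
  congr 1
  ext v
  simp [community]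

theorem card_community_pos (x : I.Key) : 0 < ((I.community x).card : ℝ) := by
  exact_mod_cast (I.community_nonempty x).card_pos

theorem realizationProb_nonneg (g : Finset (I.Node × I.Node)) : 0 ≤ I.realizationProb g := by
  unfold realizationProb
  refine mul_nonneg (Finset.prod_nonneg fun e _ => (I.p e).2.1)
    (Finset.prod_nonneg fun e _ => ?_)
  have := (I.p e).2.2
  linarith

theorem sum_realizationProb : ∑ g ∈ I.E.powerset, I.realizationProb g = 1 := by
  have := Finset.prod_add (fun e => (I.p e : ℝ)) (fun e => 1 - (I.p e : ℝ)) I.E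
  simp only [add_sub_cancel, Finset.prod_const_one] at this
  exact this.symm

theorem activated_univ (g : Finset (I.Node × I.Node)) :
    I.activated g Finset.univ = Finset.univ := by
  ext v
  simp only [activated, Finset.mem_univ, true_and, Finset.mem_filter, iff_true]
  exact ⟨v, .refl⟩

theorem activated_mono (g : Finset (I.Node × I.Node)) {A B : Finset I.Node} (h : A ⊆ B) :
    I.activated g A ⊆ I.activated g B := by
  intro v
  simp only [activated, Finset.mem_univ, true_and, Finset.mem_filter]
  rintro ⟨s, hs, hr⟩
  exact ⟨s, h hs, hr⟩

theorem subset_activated (g : Finset (I.Node × I.Node)) (A : Finset I.Node) :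
    A ⊆ I.activated g A := by
  intro v hv
  simp only [activated, Finset.mem_univ, true_and, Finset.mem_filter]
  exact ⟨v, hv, .refl⟩

theorem spread_univ : I.spread Finset.univ = I.n := by
  simp [spread, activated_univ, ← Finset.sum_mul, sum_realizationProb]

theorem diversity_univ : I.diversity Finset.univ = I.diversityTotal := by
  simp [diversity, activated_univ, ← Finset.sum_mul, sum_realizationProb, diversityTotal]

/-- The expected number of nodes of the community `x` that are activated by `A`. -/
def communitySpread (A : Finset I.Node) (x : I.Key) : ℝ :=
  ∑ g ∈ I.E.powerset, I.realizationProb g * ((I.activated g A ∩ I.community x).card : ℝ)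

theorem communitySpread_nonneg (A : Finset I.Node) (x : I.Key) : 0 ≤ communitySpread A x :=
  Finset.sum_nonneg fun g _ => mul_nonneg (realizationProb_nonneg g) (by positivity)

theorem communitySpread_mono {A B : Finset I.Node} (h : A ⊆ B) (x : I.Key) :
    communitySpread A x ≤ communitySpread B x := by
  refine Finset.sum_le_sum fun g _ => mul_le_mul_of_nonneg_left ?_ (realizationProb_nonneg g)
  exact_mod_cast Finset.card_le_card (Finset.inter_subset_inter_right (activated_mono g h))

theorem card_le_communitySpread (A : Finset I.Node) (x : I.Key) :
    ((A ∩ I.community x).card : ℝ) ≤ communitySpread A x := by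
  calc ((A ∩ I.community x).card : ℝ)
      = ∑ g ∈ I.E.powerset, I.realizationProb g * ((A ∩ I.community x).card : ℝ) := by
        rw [← Finset.sum_mul, sum_realizationProb, one_mul]
    _ ≤ _ := by
      refine Finset.sum_le_sum fun g _ => mul_le_mul_of_nonneg_left ?_ (realizationProb_nonneg g)
      exact_mod_cast Finset.card_le_card (Finset.inter_subset_inter_right (subset_activated g A))

theorem sum_communitySpread (q : Fin I.numMetrics) (A : Finset I.Node) :
    ∑ j, communitySpread A ⟨q, j⟩ = I.spread A := by
  simp only [communitySpread, spread]
  rw [Finset.sum_comm]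
  refine Finset.sum_congr rfl fun g _ => ?_
  rw [← Finset.mul_sum, sum_card_community]

theorem diversity_eq (A : Finset I.Node) :
    I.diversity A = ∑ x : I.Key, I.w x.1 * I.a x.1 x.2 * communitySpread A x := by
  rw [Fintype.sum_sigma, diversity]
  refine Finset.sum_congr rfl fun q _ => ?_
  rw [Finset.mul_sum]
  refine Finset.sum_congr rfl fun j _ => ?_
  simp only [communitySpread]
  rw [mul_assoc, Finset.mul_sum (a := I.a q j)]
  congr 1
  exact Finset.sum_congr rfl fun g _ => by ring

theorem numMetrics_pos : 0 < I.numMetrics := by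
  rcases Nat.eq_zero_or_pos I.numMetrics with h | h
  · have h1 := I.w_sum
    have : IsEmpty (Fin I.numMetrics) := by rw [h]; infer_instance
    simp at h1
  · exact h

/-- The weight of a community in the objective function. -/
def weight (x : I.Key) : ℝ :=
  (1 - I.lam) / ((I.n : ℝ) * (I.numMetrics : ℝ)) + I.lam * I.w x.1 * I.a x.1 x.2 / I.diversityTotal

theorem coef_eq (x : I.Key) : I.coef x = weight x * (I.community x).card := rfl

/-- The communities of each metric partition the nodes, so the spread is the sum of the community
spreads of every single metric. Averaging over the metrics gives it the same shape as the diversity,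
whence the weight 1/(n · number of metrics). -/
theorem objective_eq (A : Finset I.Node) :
    I.objective A = ∑ x, weight x * communitySpread A x := by
  have hm : (I.numMetrics : ℝ) ≠ 0 := by exact_mod_cast numMetrics_pos.ne'
  simp only [objective, weight, add_mul, Finset.sum_add_distrib]
  rw [spread_univ, diversity_univ]
  congr 1
  · rw [← Finset.mul_sum, Fintype.sum_sigma]
    simp only [sum_communitySpread]
    rw [Finset.sum_const, Finset.card_univ, Fintype.card_fin, nsmul_eq_mul]
    by_cases hn : (I.n : ℝ) = 0
    · simp [hn]
    · field_simp
  · rw [diversity_eq, Finset.sum_div, Finset.mul_sum]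
    exact Finset.sum_congr rfl fun x _ => by ring

theorem diversityTotal_eq :
    I.diversityTotal = ∑ x : I.Key, I.w x.1 * I.a x.1 x.2 * (I.community x).card := by
  rw [diversityTotal, Fintype.sum_sigma]
  refine Finset.sum_congr rfl fun q _ => ?_
  rw [Finset.mul_sum]
  exact Finset.sum_congr rfl fun j _ => by ring

theorem diversityTotal_nonneg : 0 ≤ I.diversityTotal := by
  rw [diversityTotal_eq]
  exact Finset.sum_nonneg fun x _ =>
    mul_nonneg (mul_nonneg (I.w_nonneg _) (I.a_pos _ _).le) (by positivity)

theorem weight_nonneg (x : I.Key) : 0 ≤ weight x := by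
  have h1 := I.lam_le_one
  have h2 := I.lam_nonneg
  have h3 := I.w_nonneg x.1
  have h4 := (I.a_pos x.1 x.2).le
  have h5 := I.diversityTotal_nonneg
  unfold weight
  have : 0 ≤ 1 - I.lam := by linarith
  positivity

theorem coef_nonneg (x : I.Key) : 0 ≤ I.coef x := by
  rw [coef_eq]; exact mul_nonneg (weight_nonneg x) (by positivity)

/-- The weights sum to 1 and the communities of each metric to n nodes, so the total diversity is n
times a weighted mean of the coefficients. -/
theorem community_mul_le (a : ℝ) (ha : ∀ x : I.Key, a ≤ I.a x.1 x.2) :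
    a * I.n ≤ I.diversityTotal := by
  have h1 : ∀ q : Fin I.numMetrics, ∑ j, ((I.community ⟨q, j⟩).card : ℝ) = I.n := by
    intro q
    have := sum_card_community q Finset.univ
    simpa using this
  calc a * I.n = ∑ q, I.w q * (a * I.n) := by rw [← Finset.sum_mul, I.w_sum, one_mul]
    _ ≤ _ := by
      refine Finset.sum_le_sum fun q _ => mul_le_mul_of_nonneg_left ?_ (I.w_nonneg q)
      rw [← h1 q, Finset.mul_sum]
      exact Finset.sum_le_sum fun j _ => mul_le_mul_of_nonneg_right (ha ⟨q, j⟩) (by positivity)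

theorem le_community_mul (a : ℝ) (ha : ∀ x : I.Key, I.a x.1 x.2 ≤ a) :
    I.diversityTotal ≤ a * I.n := by
  have h1 : ∀ q : Fin I.numMetrics, ∑ j, ((I.community ⟨q, j⟩).card : ℝ) = I.n := by
    intro q
    have := sum_card_community q Finset.univ
    simpa using this
  calc _ ≤ ∑ q, I.w q * (a * I.n) := by
        refine Finset.sum_le_sum fun q _ => mul_le_mul_of_nonneg_left ?_ (I.w_nonneg q)
        rw [← h1 q, Finset.mul_sum]
        exact Finset.sum_le_sum fun j _ => mul_le_mul_of_nonneg_right (ha ⟨q, j⟩) (by positivity)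
    _ = a * I.n := by rw [← Finset.sum_mul, I.w_sum, one_mul]

/-- The smallest coefficient. -/
def aMin (I : Problem) : ℝ := ⨅ x : I.Key, I.a x.1 x.2

theorem aMin_le (x : I.Key) : I.aMin ≤ I.a x.1 x.2 :=
  ciInf_le (Finite.bddBelow_range _) x

theorem nonempty_key (hn : 0 < I.n) : Nonempty I.Key :=
  ⟨⟨⟨0, numMetrics_pos⟩, I.comm _ ⟨0, hn⟩⟩⟩

theorem exists_aMin (hn : 0 < I.n) : ∃ x : I.Key, I.a x.1 x.2 = I.aMin := by
  have := nonempty_key hn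
  exact exists_eq_ciInf_of_finite

theorem aMin_pos (hn : 0 < I.n) : 0 < I.aMin := by
  obtain ⟨x, hx⟩ := exists_aMin hn
  rw [← hx]
  exact I.a_pos _ _

theorem diversityTotal_pos (hn : 0 < I.n) : 0 < I.diversityTotal := by
  have h1 := community_mul_le I.aMin aMin_le
  have h2 := aMin_pos hn
  have : (0 : ℝ) < I.n := by exact_mod_cast hn
  have : 0 < I.aMin * I.n := by positivity
  linarith

/-! ### The scale of the objective function -/

theorem fmin_eq (k : ℕ) :
    I.fmin k = (1 - I.lam) * ((k : ℝ) / (I.n : ℝ))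
      + I.lam * (I.aMin * (k : ℝ) / I.diversityTotal) := rfl

theorem fmin_pos (hn : 0 < I.n) {k : ℕ} (hk : 0 < k) : 0 < I.fmin k := by
  have h0 : (0 : ℝ) < I.n := by exact_mod_cast hn
  have hk : (0 : ℝ) < k := by exact_mod_cast hk
  have h1 := aMin_pos hn
  have h2 := diversityTotal_pos hn
  have h3 := I.lam_nonneg
  have h4 : 0 ≤ 1 - I.lam := by have := I.lam_le_one; linarith
  have h5 : 0 < (k : ℝ) / I.n := by positivity
  have h6 : 0 < I.aMin * k / I.diversityTotal := by positivity
  rw [fmin_eq]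
  rcases h3.eq_or_lt with h | h
  · rw [← h]; simpa using h5
  · have : 0 < I.lam * (I.aMin * k / I.diversityTotal) := by positivity
    have : 0 ≤ (1 - I.lam) * ((k : ℝ) / I.n) := by positivity
    linarith

theorem fmin_le_one (hn : 0 < I.n) {k : ℕ} (hk : k ≤ I.n) : I.fmin k ≤ 1 := by
  have h0 : (0 : ℝ) < I.n := by exact_mod_cast hn
  have hk : (k : ℝ) ≤ I.n := by exact_mod_cast hk
  have h1 := aMin_pos hn
  have h2 := diversityTotal_pos hn
  have h3 := community_mul_le I.aMin aMin_le
  have h4 : (k : ℝ) / I.n ≤ 1 := by rw [div_le_one h0]; exact hk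
  have h5 : I.aMin * k / I.diversityTotal ≤ 1 := by
    rw [div_le_one h2]
    exact (mul_le_mul_of_nonneg_left hk h1.le).trans h3
  rw [fmin_eq]
  have h6 := I.lam_nonneg
  have h7 : 0 ≤ 1 - I.lam := by have := I.lam_le_one; linarith
  nlinarith

/-- Every node activates itself: already the k seeds contribute k to the spread and at least k times
the smallest coefficient to the diversity. -/
theorem fmin_le_objective (hn : 0 < I.n) {k : ℕ} {A : Finset I.Node} (hA : A.card = k) :
    I.fmin k ≤ I.objective A := by
  have h2 := diversityTotal_pos hn
  have h6 := I.lam_nonneg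
  have h7 : 0 ≤ 1 - I.lam := by have := I.lam_le_one; linarith
  have hsp : (k : ℝ) ≤ I.spread A := by
    rw [← sum_communitySpread ⟨0, numMetrics_pos⟩ A, ← hA,
      ← sum_card_community ⟨0, numMetrics_pos⟩ A]
    exact Finset.sum_le_sum fun j _ => card_le_communitySpread A _
  have hdiv : I.aMin * k ≤ I.diversity A := by
    rw [diversity_eq, Fintype.sum_sigma]
    calc I.aMin * k = ∑ q, I.w q * (I.aMin * k) := by rw [← Finset.sum_mul, I.w_sum, one_mul]
      _ ≤ _ := by
        refine Finset.sum_le_sum fun q _ => ?_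
        rw [← hA, ← sum_card_community q A, Finset.mul_sum, Finset.mul_sum]
        refine Finset.sum_le_sum fun j _ => ?_
        rw [mul_assoc]
        have h1 := I.w_nonneg q
        have h3 := (I.a_pos q j).le
        exact mul_le_mul_of_nonneg_left (mul_le_mul (aMin_le ⟨q, j⟩)
          (card_le_communitySpread A _) (by positivity) h3) h1
  rw [fmin_eq, objective, spread_univ, diversity_univ]
  gcongr

theorem objective_nonneg (A : Finset I.Node) : 0 ≤ I.objective A := by
  rw [objective_eq]
  exact Finset.sum_nonneg fun x _ => mul_nonneg (weight_nonneg x) (communitySpread_nonneg A x)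

theorem objective_mono {A B : Finset I.Node} (h : A ⊆ B) : I.objective A ≤ I.objective B := by
  rw [objective_eq, objective_eq]
  exact Finset.sum_le_sum fun x _ =>
    mul_le_mul_of_nonneg_left (communitySpread_mono h x) (weight_nonneg x)

/-- The coefficients sum to f(V), and f is normalized to 1 there. This places the coverage of one
sample in [0, 1], as the tail bounds require. -/
theorem sum_coef_le_one (hn : 0 < I.n) : ∑ x, I.coef x ≤ 1 := by
  have h : ∑ x, I.coef x = I.objective Finset.univ := by
    rw [objective_eq]
    refine Finset.sum_congr rfl fun x _ => ?_
    rw [coef_eq, communitySpread]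
    simp [activated_univ, ← Finset.sum_mul, sum_realizationProb]
  have h0 : (I.n : ℝ) ≠ 0 := by exact_mod_cast hn.ne'
  rw [h, objective, spread_univ, diversity_univ, div_self h0, div_self (diversityTotal_pos hn).ne']
  linarith

/-! ### The coverage of one sample -/

/-- The generalized coverage of `A` in one sample. -/
def value (A : Finset I.Node) (R : GRR I) : ℝ := ∑ x, if Hits A (R x) then I.coef x else 0

theorem value_nonneg (A : Finset I.Node) (R : GRR I) : 0 ≤ value A R :=
  Finset.sum_nonneg fun x _ => by split_ifs; exacts [coef_nonneg x, le_rfl]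

theorem Hits.mono {A B : Finset I.Node} (h : A ⊆ B) {o : Option (List I.Node)} (ho : Hits A o) :
    Hits B o := by
  cases o with
  | none => trivial
  | some L => obtain ⟨v, hv, hL⟩ := ho; exact ⟨v, h hv, hL⟩

theorem value_mono {A B : Finset I.Node} (h : A ⊆ B) (R : GRR I) : value A R ≤ value B R := by
  refine Finset.sum_le_sum fun x _ => ?_
  split_ifs with h1 h2 h2
  · exact le_rfl
  · exact absurd (h1.mono h) h2
  · exact coef_nonneg x
  · exact le_rfl

theorem value_le_one (hn : 0 < I.n) (A : Finset I.Node) (R : GRR I) : value A R ≤ 1 := by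
  refine le_trans (Finset.sum_le_sum fun x _ => ?_) (sum_coef_le_one hn)
  split_ifs
  exacts [le_rfl, coef_nonneg x]

/-- The coverage is an unbiased estimator of the objective function. -/
theorem E_value (A B : Finset I.Node) :
    (sampleGRR B).E (fun R => ENNReal.ofReal (value A R))
      = ENNReal.ofReal (I.objective (A ∪ B)) := by
  have h1 : ∀ R : GRR I, ENNReal.ofReal (value A R) =
      (I.keys.map fun x => if Hits A (R x) then ENNReal.ofReal (I.coef x) else 0).sum := by
    intro R
    rw [sum_keys (fun x => if Hits A (R x) then ENNReal.ofReal (I.coef x) else 0), value,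
      ENNReal.ofReal_sum_of_nonneg fun x _ => by split_ifs; exacts [coef_nonneg x, le_rfl]]
    exact Finset.sum_congr rfl fun x _ => by split_ifs <;> simp
  simp only [h1]
  rw [sampleGRR_eq, Rand.E_bind]
  -- All entries of a sample share one realization and are dependent; conditioning on the
  -- realization and using linearity avoids any statement about their joint law.
  have h3 := fun live => (E_sample_fold B live I.keys keys_nodup (fun _ => none)
    (fun x o => if Hits A o then ENNReal.ofReal (I.coef x) else 0)).trans (sum_keys _)
  rw [Rand.E_congr fun live _ => h3 live, E_sampleRealization]
  have h2 : ∀ g ⊆ I.E, ∑ x, (entry B (I.liveOf g) x).E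
        (fun o => if Hits A o then ENNReal.ofReal (I.coef x) else 0)
      = ENNReal.ofReal
        (∑ x, weight x * ((I.activated g (A ∪ B) ∩ I.community x).card : ℝ)) := by
    intro g hg
    rw [ENNReal.ofReal_sum_of_nonneg fun x _ => mul_nonneg (weight_nonneg x) (by positivity)]
    refine Finset.sum_congr rfl fun x _ => ?_
    have hc := card_community_pos x
    rw [E_entry_hits A B hg, coef_eq, ← ENNReal.ofReal_natCast, ← ENNReal.ofReal_natCast,
      ← ENNReal.ofReal_inv_of_pos hc, ← ENNReal.ofReal_mul (by positivity),
      ← ENNReal.ofReal_mul (by positivity)]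
    congr 1
    field_simp
  rw [subsetExp_congr I.p h2, subsetExp, objective_eq]
  simp only [communitySpread, Finset.mul_sum]
  rw [Finset.sum_comm, ENNReal.ofReal_sum_of_nonneg]
  · refine Finset.sum_congr rfl fun g _ => ?_
    have hg := realizationProb_nonneg g
    unfold realizationProb at hg ⊢
    rw [← ENNReal.ofReal_mul hg, Finset.mul_sum]
    congr 1
    exact Finset.sum_congr rfl fun x _ => by ring
  · intro g _
    exact Finset.sum_nonneg fun x _ => mul_nonneg (weight_nonneg x)
      (mul_nonneg (realizationProb_nonneg g) (by positivity))

/-- The mean of a marginal coverage. -/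
theorem E_value_sub (A B : Finset I.Node) :
    (sampleGRR B).E (fun R => ENNReal.ofReal (value (A ∪ B) R - value B R))
      = ENNReal.ofReal (I.objective (A ∪ B) - I.objective B) := by
  have h1 := E_value (A ∪ B) B
  have h2 := E_value B B
  rw [Finset.union_assoc, Finset.union_self] at h1
  rw [Finset.union_self] at h2
  have h3 : (sampleGRR B).E (fun R => ENNReal.ofReal (value (A ∪ B) R - value B R))
      + ENNReal.ofReal (I.objective B) = ENNReal.ofReal (I.objective (A ∪ B)) := by
    rw [← h1, ← h2, ← Rand.E_add]
    refine Rand.E_congr fun R _ => ?_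
    rw [← ENNReal.ofReal_add (sub_nonneg.2 (value_mono Finset.subset_union_right R))
      (value_nonneg B R), sub_add_cancel]
  rw [ENNReal.ofReal_sub _ (objective_nonneg B), ← h3, ENNReal.add_sub_cancel_right
    ENNReal.ofReal_ne_top]

end Problem

end

end CCDIM

namespace CCDIM

open scoped ENNReal

/-! ## Greedy maximum coverage -/

noncomputable section

namespace Problem

variable {I : Problem}

/-- The generalized coverage of `A` in a collection of samples. -/
def totalValue (A : Finset I.Node) (Rs : List (GRR I)) : ℝ := (Rs.map (value A)).sum

theorem totalValue_nonneg (A : Finset I.Node) (Rs : List (GRR I)) : 0 ≤ totalValue A Rs := by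
  refine List.sum_nonneg fun y hy => ?_
  obtain ⟨R, -, rfl⟩ := List.mem_map.1 hy
  exact value_nonneg A R

theorem totalValue_mono {A B : Finset I.Node} (h : A ⊆ B) (Rs : List (GRR I)) :
    totalValue A Rs ≤ totalValue B Rs :=
  List.sum_le_sum fun R _ => value_mono h R

theorem covered_val (S : Finset I.Node) (o : Option (List I.Node)) :
    (covered S o).val = true ↔ Hits S o := by
  cases o with
  | none => simp [covered, Hits]
  | some R =>
    simp only [covered, Timed.val_foldlM, Timed.val_bind, Timed.val_pure, Hits]
    have : ∀ b, R.foldl (fun b v => b || decide (v ∈ S)) b = true ↔ b = true ∨ ∃ v ∈ S, v ∈ R := by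
      induction R with
      | nil => simp
      | cons u R ih =>
        intro b
        rw [List.foldl_cons, ih]
        simp only [Bool.or_eq_true, decide_eq_true_eq, List.mem_cons]
        constructor
        · rintro ((h | h) | ⟨v, hv, h⟩)
          exacts [Or.inl h, Or.inr ⟨u, h, Or.inl rfl⟩, Or.inr ⟨v, hv, Or.inr h⟩]
        · rintro (h | ⟨v, hv, rfl | h⟩)
          exacts [Or.inl (Or.inl h), Or.inl (Or.inr hv), Or.inr ⟨v, hv, h⟩]
    simpa using this false

theorem foldl_add_eq {γ : Type} (f : ℝ → γ → ℝ) (g : γ → ℝ) (h : ∀ y x, f y x = y + g x)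
    (l : List γ) (y : ℝ) : l.foldl f y = y + (l.map g).sum := by
  induction l generalizing y with
  | nil => simp
  | cons x l ih => rw [List.foldl_cons, ih, h, List.map_cons, List.sum_cons, add_assoc]

theorem coverage_val (S : Finset I.Node) (Rs : List (GRR I)) :
    (coverage S Rs).val = totalValue S Rs := by
  simp only [coverage, Timed.val_foldlM, Timed.val_bind, Timed.val_pure, totalValue]
  rw [foldl_add_eq _ (value S), zero_add]
  intro y R
  rw [foldl_add_eq _ (fun x => if Hits S (R x) then I.coef x else 0), sum_keys]
  · rfl
  · intro y x
    by_cases h : Hits S (R x)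
    · rw [if_pos ((covered_val S (R x)).2 h), if_pos h]
    · rw [if_neg (fun h' => h ((covered_val S (R x)).1 h')), if_neg h, add_zero]

/-! ### The sum of the largest entries -/

theorem sum_map_filter_trichotomy (f : ℝ → ℝ) (y : ℝ) (l : List ℝ) :
    (l.map f).sum = ((l.filter fun z => y < z).map f).sum + ((l.filter fun z => z = y).map f).sum
      + ((l.filter fun z => z < y).map f).sum := by
  induction l with
  | nil => simp
  | cons z l ih =>
    rcases lt_trichotomy y z with h | h | h
    · simp [ih, h, h.ne', h.not_gt]; ring
    · subst h; simp [ih]; ring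
    · simp [ih, h, h.ne, h.not_gt]; ring

theorem length_filter_trichotomy (y : ℝ) (l : List ℝ) :
    l.length = (l.filter fun z => y < z).length + (l.filter fun z => z = y).length
      + (l.filter fun z => z < y).length := by
  have := sum_map_filter_trichotomy (fun _ => 1) y l
  simp only [List.map_const', List.sum_replicate, nsmul_eq_mul, mul_one] at this
  exact_mod_cast this

theorem length_filter_eq_pos {y : ℝ} {l : List ℝ} (hy : y ∈ l) :
    0 < (l.filter fun z => z = y).length :=
  List.length_pos_of_mem (a := y) (by simp [hy])

/-- Linear programming duality for the sum of the `k` largest entries. -/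
theorem topSum_dual (fuel : ℕ) (l : List ℝ) (k : ℕ) (hfuel : l.length ≤ fuel) (hk : 1 ≤ k)
    (hkl : k ≤ l.length) (lb ub : ℝ) (hlb : ∀ z ∈ l, lb ≤ z) (hub : ∀ z ∈ l, z ≤ ub) :
    ∀ s ∈ (topSum fuel l k).Supp, ∃ τ, lb ≤ τ ∧ τ ≤ ub ∧
      k * τ + (l.map fun z => max (z - τ) 0).sum ≤ s := by
  induction fuel generalizing l k lb ub with
  | zero => omega
  | succ fuel ih =>
    cases l with
    | nil => simp at hkl; omega
    | cons x l =>
      intro s hs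
      simp only [topSum, Rand.mem_Supp_bind, Rand.mem_Supp_tick, true_and] at hs
      obtain ⟨i, -, _, hs⟩ := hs
      have hyl : (x :: l)[i.val] ∈ x :: l := List.getElem_mem _
      generalize (x :: l)[i.val] = y at *
      generalize x :: l = l' at *
      set hi := l'.filter fun z => y < z with hhi
      set eq := l'.filter fun z => z = y with heq
      set lo := l'.filter fun z => z < y with hlo
      have hlen : l'.length = hi.length + eq.length + lo.length := length_filter_trichotomy y l'
      have heqpos : 0 < eq.length := length_filter_eq_pos hyl
      have mem_hi : ∀ z ∈ hi, z ∈ l' ∧ y < z := fun z hz => by simpa [hhi] using hz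
      have mem_eq : ∀ z ∈ eq, z = y := fun z hz => by
        have : z ∈ l' ∧ z = y := by simpa [heq] using hz
        exact this.2
      have mem_lo : ∀ z ∈ lo, z ∈ l' ∧ z < y := fun z hz => by simpa [hlo] using hz
      -- Entries on one side of the threshold have linear positive parts, those on the other side
      -- have none. The bounds `lb` and `ub`, updated to the pivot, guarantee that the threshold
      -- found recursively lies on the right side of the discarded blocks.
      have shift : ∀ (L : List ℝ) (τ : ℝ), (∀ z ∈ L, τ ≤ z) →
          (L.map fun z => max (z - τ) 0).sum = L.sum - L.length * τ := by
        intro L τ hL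
        induction L with
        | nil => simp
        | cons z L ihL =>
          rw [List.map_cons, List.sum_cons, ihL fun w hw => hL w (by simp [hw]),
            max_eq_left (sub_nonneg.2 (hL z (by simp)))]
          simp; ring
      have vanish : ∀ (L : List ℝ) (τ : ℝ), (∀ z ∈ L, z ≤ τ) →
          (L.map fun z => max (z - τ) 0).sum = 0 := by
        intro L τ hL
        refine List.sum_eq_zero fun w hw => ?_
        obtain ⟨z, hz, rfl⟩ := List.mem_map.1 hw
        exact max_eq_right (sub_nonpos.2 (hL z hz))
      have eq_sum : eq.sum = eq.length * y := by
        rw [List.eq_replicate_of_mem mem_eq]; simp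
      split_ifs at hs with h1 h2
      · obtain ⟨τ, hτ1, hτ2, hτ3⟩ := ih hi k (by omega) hk h1 y ub (fun z hz => (mem_hi z hz).2.le)
          (fun z hz => hub z (mem_hi z hz).1) s hs
        refine ⟨τ, (hlb y hyl).trans hτ1, hτ2, ?_⟩
        rw [sum_map_filter_trichotomy _ y, ← hhi, ← heq, ← hlo,
          vanish eq τ fun z hz => (mem_eq z hz).le.trans hτ1,
          vanish lo τ fun z hz => (mem_lo z hz).2.le.trans hτ1]
        linarith
      · rw [Rand.mem_Supp_pure] at hs
        refine ⟨y, hlb y hyl, hub y hyl, ?_⟩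
        rw [sum_map_filter_trichotomy _ y, ← hhi, ← heq, ← hlo,
          vanish eq y fun z hz => (mem_eq z hz).le,
          vanish lo y fun z hz => (mem_lo z hz).2.le, shift hi y fun z hz => (mem_hi z hz).2.le, hs,
          Nat.cast_sub (by omega)]
        linarith
      · simp only [Rand.mem_Supp_bind, Rand.mem_Supp_pure] at hs
        obtain ⟨s', hs', rfl⟩ := hs
        obtain ⟨τ, hτ1, hτ2, hτ3⟩ := ih lo (k - hi.length - eq.length) (by omega) (by omega)
          (by omega) lb y (fun z hz => hlb z (mem_lo z hz).1) (fun z hz => (mem_lo z hz).2.le) s' hs'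
        refine ⟨τ, hτ1, hτ2.trans (hub y hyl), ?_⟩
        rw [sum_map_filter_trichotomy _ y, ← hhi, ← heq, ← hlo,
          shift eq τ fun z hz => hτ2.trans (mem_eq z hz).ge,
          shift hi τ fun z hz => hτ2.trans (mem_hi z hz).2.le, eq_sum]
        rw [Nat.cast_sub (by omega), Nat.cast_sub (by omega)] at hτ3
        linarith

/-- Weak duality with a threshold τ ≥ 0: each gain is at most τ plus its excess over τ, and a set
has at most k nodes. No sorting and no description of the selected entries is needed. -/
theorem sum_le_topSum {k : ℕ} (hk : 1 ≤ k) (hkn : k ≤ I.n) (gain : I.Node → ℝ)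
    (hg : ∀ v, 0 ≤ gain v) {s : ℝ}
    (hs : s ∈ (topSum I.n ((List.finRange I.n).map gain) k).Supp) (A : Finset I.Node)
    (hA : A.card ≤ k) : ∑ v ∈ A, gain v ≤ s := by
  have hne : (Finset.univ : Finset I.Node).Nonempty := ⟨⟨0, by omega⟩, Finset.mem_univ _⟩
  obtain ⟨τ, h0, -, h⟩ := topSum_dual I.n ((List.finRange I.n).map gain) k (by simp) hk
    (by simpa using hkn) 0 (Finset.univ.sup' hne gain)
    (by simp only [List.mem_map]; rintro z ⟨v, -, rfl⟩; exact hg v)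
    (by simp only [List.mem_map]; rintro z ⟨v, -, rfl⟩; exact Finset.le_sup' gain (Finset.mem_univ v))
    s hs
  have h2 : (((List.finRange I.n).map gain).map fun z => max (z - τ) 0).sum
      = ∑ v, max (gain v - τ) 0 := by
    rw [List.map_map, ← List.sum_toFinset _ (List.nodup_finRange _)]
    simp [List.toFinset_finRange]
  rw [h2] at h
  calc ∑ v ∈ A, gain v ≤ ∑ v ∈ A, (τ + max (gain v - τ) 0) :=
        Finset.sum_le_sum fun v _ => by have := le_max_left (gain v - τ) 0; linarith
    _ = A.card * τ + ∑ v ∈ A, max (gain v - τ) 0 := by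
        rw [Finset.sum_add_distrib, Finset.sum_const, nsmul_eq_mul]
    _ ≤ k * τ + ∑ v, max (gain v - τ) 0 := by
        exact add_le_add (mul_le_mul_of_nonneg_right (by exact_mod_cast hA) h0)
          (Finset.sum_le_univ_sum_of_nonneg fun v => le_max_right _ _)
    _ ≤ s := h

/-! ### The state of the greedy algorithm -/

/-- The total coefficient of the items that are hit by `A`. -/
def itemCover (l : List (ℝ × List I.Node)) (A : Finset I.Node) : ℝ :=
  (l.map fun it => if ∃ v ∈ A, v ∈ it.2 then it.1 else 0).sum

theorem itemCover_cons (it : ℝ × List I.Node) (l : List (ℝ × List I.Node)) (A : Finset I.Node) :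
    itemCover (it :: l) A = (if ∃ v ∈ A, v ∈ it.2 then it.1 else 0) + itemCover l A := by
  simp [itemCover]

/-- A state of the greedy algorithm is correct for the coverage function `Ω`. -/
structure Tracks (Ω : Finset I.Node → ℝ) (st : GreedyState I) : Prop where
  cover : ∀ A, Ω (A ∪ st.S) = st.cov + itemCover st.rest A
  gain : ∀ v, st.gain v = itemCover st.rest {v}
  item : ∀ it ∈ st.rest, 0 ≤ it.1 ∧ it.2.Nodup ∧ ∀ v ∈ it.2, v ∉ st.S

theorem bump_val (c : ℝ) (R : List I.Node) (hR : R.Nodup) (g : I.Node → ℝ) (v : I.Node) :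
    (bump c R g).val v = g v + if v ∈ R then c else 0 := by
  simp only [bump, Timed.val_foldlM, Timed.val_bind, Timed.val_pure]
  induction R generalizing g with
  | nil => simp
  | cons u R ih =>
    rw [List.nodup_cons] at hR
    rw [List.foldl_cons, ih hR.2]
    by_cases h : v = u
    · subst h; simp [hR.1]
    · simp [h]

/-- One round of the initialization of the state. -/
def initStep (R : GRR I) (st : GreedyState I) (x : I.Key) : Timed (GreedyState I) := do
  Timed.tick 1
  match R x with
  | none => pure { st with cov := st.cov + I.coef x }
  | some L => do
    let gain ← bump (I.coef x) L st.gain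
    pure { st with gain := gain, rest := (I.coef x, L) :: st.rest }

theorem initState_eq (S₀ : Finset I.Node) (Rs : List (GRR I)) : initState S₀ Rs = (do
    Timed.tick I.n
    Rs.foldlM (fun (st : GreedyState I) R => I.keys.foldlM (initStep R) st)
      { S := S₀, cov := 0, gain := fun _ => 0, rest := [] }) := rfl

/-- The part of `Tracks` that does not refer to the coverage function. -/
def Consistent (S₀ : Finset I.Node) (st : GreedyState I) : Prop :=
  st.S = S₀ ∧ (∀ v, st.gain v = itemCover st.rest {v}) ∧
    ∀ it ∈ st.rest, 0 ≤ it.1 ∧ it.2.Nodup ∧ ∀ v ∈ it.2, v ∉ S₀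

/-- Since a stored set avoids the start set, A ∪ S₀ hits it only through A; placeholders are covered
by everything and go directly into the coverage. -/
theorem initStep_spec {S₀ : Finset I.Node} {R : GRR I} (hR : ValidGRR S₀ R) {st : GreedyState I}
    (hst : Consistent S₀ st) (x : I.Key) :
    Consistent S₀ (initStep R st x).val ∧ ∀ A,
      (initStep R st x).val.cov + itemCover (initStep R st x).val.rest A
        = st.cov + itemCover st.rest A + if Hits (A ∪ S₀) (R x) then I.coef x else 0 := by
  obtain ⟨hS, hg, hi⟩ := hst
  unfold initStep
  rcases hx : R x with _ | L
  · simp only [Timed.val_bind, Timed.val_pure]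
    exact ⟨⟨hS, hg, hi⟩, fun A => by rw [if_pos (show Hits (A ∪ S₀) none from trivial)]; ring⟩
  · obtain ⟨hnd, hL⟩ := hR x L hx
    simp only [Timed.val_bind, Timed.val_pure, Hits]
    refine ⟨⟨hS, fun v => ?_, fun it hit => ?_⟩, fun A => ?_⟩
    · change (bump (I.coef x) L st.gain).val v = itemCover ((I.coef x, L) :: st.rest) {v}
      rw [bump_val _ _ hnd, itemCover_cons, hg]
      simp [add_comm]
    · rcases List.mem_cons.1 hit with rfl | hit
      · exact ⟨coef_nonneg x, hnd, hL⟩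
      · exact hi it hit
    · rw [itemCover_cons]
      have : (∃ v ∈ A ∪ S₀, v ∈ L) ↔ ∃ v ∈ A, v ∈ L := by
        constructor
        · rintro ⟨v, hv, hvL⟩
          rcases Finset.mem_union.1 hv with hv | hv
          · exact ⟨v, hv, hvL⟩
          · exact absurd hv (hL v hvL)
        · rintro ⟨v, hv, hvL⟩
          exact ⟨v, by simp [hv], hvL⟩
      simp only [this]
      ring

theorem initState_tracks {S₀ : Finset I.Node} {Rs : List (GRR I)}
    (hRs : ∀ R ∈ Rs, ValidGRR S₀ R) :
    Tracks (fun A => totalValue A Rs) (initState S₀ Rs).val ∧ (initState S₀ Rs).val.S = S₀ := by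
  have inner : ∀ (R : GRR I), ValidGRR S₀ R → ∀ (l : List I.Key) (st : GreedyState I),
      Consistent S₀ st → Consistent S₀ (l.foldlM (initStep R) st).val ∧ ∀ A,
      (l.foldlM (initStep R) st).val.cov + itemCover (l.foldlM (initStep R) st).val.rest A
        = st.cov + itemCover st.rest A
          + (l.map fun x => if Hits (A ∪ S₀) (R x) then I.coef x else 0).sum := by
    intro R hR l
    induction l with
    | nil => intro st hst; simpa using hst
    | cons x l ih =>
      intro st hst
      obtain ⟨h1, h2⟩ := initStep_spec hR hst x
      obtain ⟨h3, h4⟩ := ih _ h1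
      simp only [List.foldlM_cons, Timed.val_bind, List.map_cons, List.sum_cons]
      refine ⟨h3, fun A => ?_⟩
      rw [h4, h2]; ring
  have outer : ∀ (Rs : List (GRR I)), (∀ R ∈ Rs, ValidGRR S₀ R) → ∀ (st : GreedyState I),
      Consistent S₀ st →
      Consistent S₀ (Rs.foldlM (fun st R => I.keys.foldlM (initStep R) st) st).val ∧ ∀ A,
      (Rs.foldlM (fun st R => I.keys.foldlM (initStep R) st) st).val.cov
        + itemCover (Rs.foldlM (fun st R => I.keys.foldlM (initStep R) st) st).val.rest A
        = st.cov + itemCover st.rest A + totalValue (A ∪ S₀) Rs := by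
    intro Rs
    induction Rs with
    | nil => intro _ st hst; simpa [totalValue] using hst
    | cons R Rs ih =>
      intro hRs st hst
      obtain ⟨h1, h2⟩ := inner R (hRs R (by simp)) I.keys st hst
      obtain ⟨h3, h4⟩ := ih (fun R hR => hRs R (by simp [hR])) _ h1
      simp only [List.foldlM_cons, Timed.val_bind]
      refine ⟨h3, fun A => ?_⟩
      rw [h4, h2, sum_keys]
      simp only [totalValue, List.map_cons, List.sum_cons, value]
      ring
  obtain ⟨⟨h1, h2, h3⟩, h4⟩ := outer Rs hRs
    { S := S₀, cov := 0, gain := fun _ => 0, rest := [] } ⟨rfl, by simp [itemCover], by simp⟩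
  rw [initState_eq]
  simp only [Timed.val_bind]
  refine ⟨⟨fun A => ?_, h2, by rw [h1]; exact h3⟩, h1⟩
  rw [h1, h4]
  simp [itemCover]

theorem Tracks.cov_eq {Ω : Finset I.Node → ℝ} {st : GreedyState I} (h : Tracks Ω st) :
    st.cov = Ω st.S := by
  have := h.cover ∅
  simp only [Finset.empty_union, itemCover, Finset.notMem_empty, false_and, exists_false,
    if_false, List.map_const', List.sum_replicate, smul_zero, add_zero] at this
  exact this.symm

theorem Tracks.gain_nonneg {Ω : Finset I.Node → ℝ} {st : GreedyState I} (h : Tracks Ω st)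
    (v : I.Node) : 0 ≤ st.gain v := by
  rw [h.gain]
  refine List.sum_nonneg fun y hy => ?_
  obtain ⟨it, hit, rfl⟩ := List.mem_map.1 hy
  split_ifs
  exacts [(h.item it hit).1, le_rfl]

theorem Tracks.gain_eq_zero {Ω : Finset I.Node → ℝ} {st : GreedyState I} (h : Tracks Ω st)
    {v : I.Node} (hv : v ∈ st.S) : st.gain v = 0 := by
  rw [h.gain]
  refine List.sum_eq_zero fun y hy => ?_
  obtain ⟨it, hit, rfl⟩ := List.mem_map.1 hy
  simp only [Finset.mem_singleton, exists_eq_left]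
  exact if_neg fun hvit => (h.item it hit).2.2 v hvit hv

theorem itemCover_le_sum (l : List (ℝ × List I.Node)) (hl : ∀ it ∈ l, 0 ≤ it.1)
    (A : Finset I.Node) : itemCover l A ≤ ∑ v ∈ A, itemCover l {v} := by
  induction l with
  | nil => simp [itemCover]
  | cons it l ih =>
    have h0 : 0 ≤ it.1 := hl it (by simp)
    simp only [itemCover_cons, Finset.sum_add_distrib]
    refine add_le_add ?_ (ih fun it hit => hl it (by simp [hit]))
    split_ifs with h
    · obtain ⟨v, hv, hvit⟩ := h
      refine le_trans ?_ (Finset.single_le_sum (f := fun v => if ∃ u ∈ ({v} : Finset I.Node),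
        u ∈ it.2 then it.1 else 0) (fun u _ => by split_ifs; exacts [h0, le_rfl]) hv)
      simp [hvit]
    · exact Finset.sum_nonneg fun u _ => by split_ifs; exacts [h0, le_rfl]

/-- The marginal coverage of a set is at most the sum of the marginal coverages of its nodes. -/
theorem Tracks.cover_le {Ω : Finset I.Node → ℝ} {st : GreedyState I} (h : Tracks Ω st)
    (A : Finset I.Node) : Ω (A ∪ st.S) ≤ Ω st.S + ∑ v ∈ A \ st.S, st.gain v := by
  rw [h.cover, h.cov_eq]
  have h1 := itemCover_le_sum st.rest (fun it hit => (h.item it hit).1) A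
  simp only [← h.gain] at h1
  have h2 : ∑ v ∈ A \ st.S, st.gain v = ∑ v ∈ A, st.gain v :=
    Finset.sum_subset Finset.sdiff_subset fun v hv hv' => h.gain_eq_zero (by simp_all)
  rw [h2]
  linarith

/-- Items containing the new node move from the uncovered list into the coverage and are subtracted
from the gains of their nodes; all others stay. -/
theorem insertNode_tracks {Ω : Finset I.Node → ℝ} {st : GreedyState I} (h : Tracks Ω st)
    (v : I.Node) : Tracks Ω (insertNode v st).val ∧ (insertNode v st).val.S = insert v st.S := by
  set f : GreedyState I → ℝ × List I.Node → Timed (GreedyState I) := fun s item => do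
    Timed.tick 1
    if v ∈ item.2 then do
      let gain ← bump (-item.1) item.2 s.gain
      pure { s with cov := s.cov + item.1, gain := gain }
    else pure { s with rest := item :: s.rest } with hf
  -- Halfway through the list, l is the unprocessed part. For the coverage it already counts as seen
  -- by the new node, whereas the gains still contain it in full.
  have key : ∀ (l : List (ℝ × List I.Node)) (s : GreedyState I), s.S = insert v st.S →
      (∀ A, Ω (A ∪ s.S) = s.cov + itemCover s.rest A + itemCover l (insert v A)) →
      (∀ u, s.gain u = itemCover s.rest {u} + itemCover l {u}) →
      (∀ it ∈ s.rest, 0 ≤ it.1 ∧ it.2.Nodup ∧ ∀ u ∈ it.2, u ∉ s.S) →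
      (∀ it ∈ l, 0 ≤ it.1 ∧ it.2.Nodup ∧ ∀ u ∈ it.2, u ∉ st.S) →
      Tracks Ω (l.foldlM f s).val ∧ (l.foldlM f s).val.S = insert v st.S := by
    intro l
    induction l with
    | nil =>
      intro s h1 h2 h3 h4 _
      refine ⟨⟨fun A => ?_, fun u => ?_, h4⟩, h1⟩
      · simpa [itemCover] using h2 A
      · simpa [itemCover] using h3 u
    | cons it l ih =>
      intro s h1 h2 h3 h4 h5
      rw [List.foldlM_cons, Timed.val_bind]
      obtain ⟨h6, h7, h8⟩ := h5 it (by simp)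
      have h9 : ∀ it ∈ l, 0 ≤ it.1 ∧ it.2.Nodup ∧ ∀ u ∈ it.2, u ∉ st.S :=
        fun it hit => h5 it (by simp [hit])
      by_cases hv : v ∈ it.2
      · have hfv : (f s it).val = { s with
            cov := s.cov + it.1, gain := (bump (-it.1) it.2 s.gain).val } := by
          simp [hf, hv]
        rw [hfv]
        refine ih _ h1 (fun A => ?_) (fun u => ?_) h4 h9
        · rw [h2, itemCover_cons, if_pos ⟨v, by simp, hv⟩]
          simp only
          ring
        · simp only
          rw [bump_val _ _ h7, h3, itemCover_cons]
          simp only [Finset.mem_singleton, exists_eq_left]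
          split_ifs <;> ring
      · have hfv : (f s it).val = { s with rest := it :: s.rest } := by
          simp [hf, hv]
        rw [hfv]
        refine ih _ h1 (fun A => ?_) (fun u => ?_) (fun it' hit' => ?_) h9
        · rw [h2, itemCover_cons]
          simp only [itemCover_cons]
          have : (∃ u ∈ insert v A, u ∈ it.2) ↔ ∃ u ∈ A, u ∈ it.2 := by
            simp [hv]
          simp only [this]
          ring
        · simp only [h3, itemCover_cons]
          ring
        · rcases List.mem_cons.1 hit' with rfl | hit'
          · refine ⟨h6, h7, fun u hu => ?_⟩
            simp only [h1, Finset.mem_insert, not_or]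
            exact ⟨fun h => hv (h ▸ hu), h8 u hu⟩
          · exact h4 it' hit'
  unfold insertNode
  rw [Timed.val_bind]
  refine key st.rest _ rfl (fun A => ?_) (fun u => ?_) (by simp) h.item
  · have := h.cover (insert v A)
    rw [Finset.insert_union, ← Finset.union_insert] at this
    rw [this]
    simp [itemCover]
  · rw [h.gain]
    simp [itemCover]

theorem pickMax_spec (st : GreedyState I) :
    ((pickMax st).val = none → ∀ u, u ∈ st.S) ∧
    ∀ v, (pickMax st).val = some v → v ∉ st.S ∧ ∀ u, u ∉ st.S → st.gain u ≤ st.gain v := by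
  set f : Option I.Node → I.Node → Timed (Option I.Node) := fun best v => do
    Timed.tick 1
    if v ∈ st.S then pure best
    else match best with
      | none => pure (some v)
      | some u => pure (if st.gain u < st.gain v then some v else some u) with hf
  have key : ∀ (l P : List I.Node) (best : Option I.Node),
      ((best = none → ∀ u ∈ P, u ∈ st.S) ∧ ∀ v, best = some v → v ∉ st.S ∧
        ∀ u ∈ P, u ∉ st.S → st.gain u ≤ st.gain v) →
      (((l.foldlM f best).val = none → ∀ u ∈ P ++ l, u ∈ st.S) ∧
        ∀ v, (l.foldlM f best).val = some v → v ∉ st.S ∧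
        ∀ u ∈ P ++ l, u ∉ st.S → st.gain u ≤ st.gain v) := by
    intro l
    induction l with
    | nil => intro P best h; simpa using h
    | cons w l ih =>
      intro P best h
      rw [List.foldlM_cons, Timed.val_bind]
      have : P ++ w :: l = (P ++ [w]) ++ l := by simp
      rw [this]
      apply ih
      by_cases hw : w ∈ st.S
      · have : (f best w).val = best := by simp [hf, hw]
        rw [this]
        refine ⟨fun hb u hu => ?_, fun v hv => ⟨(h.2 v hv).1, fun u hu huS => ?_⟩⟩
        · rcases List.mem_append.1 hu with hu | hu
          · exact h.1 hb u hu
          · simp_all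
        · rcases List.mem_append.1 hu with hu | hu
          · exact (h.2 v hv).2 u hu huS
          · simp_all
      · rcases best with _ | v₀
        · have : (f none w).val = some w := by simp [hf, hw]
          rw [this]
          refine ⟨by simp, fun v hv => ?_⟩
          cases hv
          refine ⟨hw, fun u hu huS => ?_⟩
          rcases List.mem_append.1 hu with hu | hu
          · exact absurd (h.1 rfl u hu) huS
          · simp_all
        · have : (f (some v₀) w).val = if st.gain v₀ < st.gain w then some w else some v₀ := by
            simp [hf, hw]
          rw [this]
          obtain ⟨h1, h2⟩ := h.2 v₀ rfl
          split_ifs with hlt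
          · refine ⟨by simp, fun v hv => ?_⟩
            cases hv
            refine ⟨hw, fun u hu huS => ?_⟩
            rcases List.mem_append.1 hu with hu | hu
            · exact (h2 u hu huS).trans hlt.le
            · simp_all
          · refine ⟨by simp, fun v hv => ?_⟩
            cases hv
            refine ⟨h1, fun u hu huS => ?_⟩
            rcases List.mem_append.1 hu with hu | hu
            · exact h2 u hu huS
            · rw [List.mem_singleton] at hu
              subst hu
              exact not_lt.1 hlt
  have := key (List.finRange I.n) [] none ⟨by simp, by simp⟩
  simp only [List.nil_append, List.mem_finRange, forall_true_left] at this
  exact this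

/-- The factor by which `j` greedy steps, starting with `b` nodes, reduce the distance to the
coverage of any set of at most `k` nodes. -/
def contraction (n k : ℕ) : ℕ → ℕ → ℝ
  | _, 0 => 1
  | b, j + 1 => (1 - 1 / ((min k (n - b) : ℕ) : ℝ)) * contraction n k (b + 1) j

theorem one_sub_inv_nonneg (m : ℕ) : (0 : ℝ) ≤ 1 - 1 / (m : ℝ) := by
  rcases Nat.eq_zero_or_pos m with rfl | h
  · simp
  · have : (1 : ℝ) ≤ m := by exact_mod_cast h
    rw [sub_nonneg, div_le_one (by linarith)]
    exact this

theorem contraction_nonneg (n k b j : ℕ) : 0 ≤ contraction n k b j := by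
  induction j generalizing b with
  | zero => simp [contraction]
  | succ j ih => exact mul_nonneg (one_sub_inv_nonneg _) (ih _)

theorem contraction_le_one (n k b j : ℕ) : contraction n k b j ≤ 1 := by
  induction j generalizing b with
  | zero => simp [contraction]
  | succ j ih =>
    refine mul_le_one₀ ?_ (contraction_nonneg _ _ _ _) (ih _)
    have : (0 : ℝ) ≤ 1 / ((min k (n - b) : ℕ) : ℝ) := by positivity
    linarith

/-- The properties of the `i`-th snapshot of a greedy run that starts from `S₀`. -/
structure SnapshotSpec (k : ℕ) (Ω : Finset I.Node → ℝ) (S₀ : Finset I.Node) (i : ℕ)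
    (s : Snapshot I) : Prop where
  subset : S₀ ⊆ s.S
  card : s.S.card = S₀.card + i
  cov : s.cov = Ω s.S
  ub : ∀ A : Finset I.Node, A.card ≤ k → Ω A ≤ s.ub
  gap : ∀ A : Finset I.Node, A.card ≤ k → ∀ y ≤ Ω (A ∪ S₀),
    y - Ω s.S ≤ contraction I.n k S₀.card i * (y - Ω S₀)

theorem snapshot_spec {k : ℕ} (hk : 1 ≤ k) (hkn : k ≤ I.n) {Ω : Finset I.Node → ℝ}
    (hΩ : Monotone Ω) {st : GreedyState I} (h : Tracks Ω st) {s : Snapshot I}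
    (hs : s ∈ (snapshot k st).Supp) : SnapshotSpec k Ω st.S 0 s := by
  simp only [snapshot, Rand.mem_Supp_bind, Rand.mem_Supp_pure, Rand.mem_Supp_tick,
    true_and] at hs
  obtain ⟨_, y, hy, rfl⟩ := hs
  refine ⟨subset_rfl, by simp, h.cov_eq, fun A hA => ?_, fun A _ y _ => by simp [contraction]⟩
  have h1 := sum_le_topSum hk hkn st.gain h.gain_nonneg hy (A \ st.S)
    ((Finset.card_le_card Finset.sdiff_subset).trans hA)
  have h2 := h.cover_le A
  have h3 : Ω A ≤ Ω (A ∪ st.S) := hΩ Finset.subset_union_left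
  simp only [h.cov_eq]
  linarith

/-- The classical analysis of greedy for submodular coverage, kept in the form of a gap that shrinks
by a factor in every step, with the number of nodes still available taken into account. -/
theorem greedyLoop_spec {k : ℕ} (hk : 1 ≤ k) (hkn : k ≤ I.n) {Ω : Finset I.Node → ℝ}
    (hΩ : Monotone Ω) (j : ℕ) (st : GreedyState I) (h : Tracks Ω st) (hj : st.S.card + j ≤ I.n) :
    ∀ l ∈ (greedyLoop k j st).Supp, l.length = j + 1 ∧
      ∀ i s, l[i]? = some s → SnapshotSpec k Ω st.S i s := by
  induction j generalizing st with
  | zero =>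
    intro l hl
    simp only [greedyLoop, Rand.mem_Supp_bind, Rand.mem_Supp_pure] at hl
    obtain ⟨s, hs, rfl⟩ := hl
    refine ⟨rfl, fun i s' hi => ?_⟩
    rcases i with _ | i
    · simp at hi
      exact hi ▸ snapshot_spec hk hkn hΩ h hs
    · simp at hi
  | succ j ih =>
    intro l hl
    simp only [greedyLoop, Rand.mem_Supp_bind, Rand.mem_Supp_lift] at hl
    obtain ⟨s, hs, _, rfl, hl⟩ := hl
    obtain ⟨hp1, hp2⟩ := pickMax_spec st
    rcases hp : (pickMax st).val with _ | v
    · have : st.S = Finset.univ := Finset.eq_univ_iff_forall.2 (hp1 hp)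
      rw [this, Finset.card_univ, Fintype.card_fin] at hj
      omega
    · rw [hp] at hl
      simp only [Rand.mem_Supp_bind, Rand.mem_Supp_lift, Rand.mem_Supp_pure] at hl
      obtain ⟨_, rfl, l', hl', rfl⟩ := hl
      obtain ⟨hv, hmax⟩ := hp2 v hp
      obtain ⟨ht, hS⟩ := insertNode_tracks h v
      have hcard : (insertNode v st).val.S.card = st.S.card + 1 := by
        rw [hS, Finset.card_insert_of_notMem hv]
      obtain ⟨hlen, hspec⟩ := ih _ ht (by omega) l' hl'
      refine ⟨by simp [hlen], fun i s' hi => ?_⟩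
      rcases i with _ | i
      · simp at hi
        exact hi ▸ snapshot_spec hk hkn hΩ h hs
      · simp only [List.getElem?_cons_succ] at hi
        obtain ⟨g1, g2, g3, g4, g5⟩ := hspec i s' hi
        have hsub : st.S ⊆ (insertNode v st).val.S := by rw [hS]; exact Finset.subset_insert _ _
        refine ⟨hsub.trans g1, by omega, g3, g4, fun A hA y hy => ?_⟩
        -- The benchmark y stays fixed while the start set grows. This is why the gap is stated for
        -- every y below Ω(A ∪ S₀) and not for that value only.
        have h1 := g5 A hA y (hy.trans (hΩ (Finset.union_subset_union_right hsub)))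
        rw [hcard] at h1
        refine h1.trans ?_
        rw [contraction]
        set m := min k (I.n - st.S.card) with hm
        have hm1 : 1 ≤ m := by omega
        have hm' : (0 : ℝ) < m := by exact_mod_cast hm1
        -- At most m nodes of A are missing from the current set, as A has at most k nodes and only
        -- n minus the current size are left. The best marginal coverage is therefore at least 1/m
        -- of the gap.
        have h2 : y - Ω (insertNode v st).val.S ≤ (1 - 1 / (m : ℝ)) * (y - Ω st.S) := by
          have hcA : (A \ st.S).card ≤ m := by
            refine le_min ((Finset.card_le_card Finset.sdiff_subset).trans hA) ?_
            have : A \ st.S ⊆ Finset.univ \ st.S :=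
              Finset.sdiff_subset_sdiff (Finset.subset_univ _) subset_rfl
            refine (Finset.card_le_card this).trans ?_
            rw [Finset.card_sdiff_of_subset (Finset.subset_univ _), Finset.card_univ,
              Fintype.card_fin]
          have h3 : ∑ u ∈ A \ st.S, st.gain u ≤ m * st.gain v := by
            refine (Finset.sum_le_card_nsmul _ _ (st.gain v) fun u hu =>
              hmax u (Finset.mem_sdiff.1 hu).2).trans ?_
            rw [nsmul_eq_mul]
            have := h.gain_nonneg v
            gcongr
          have h4 := h.cover_le A
          have h5 : Ω (insertNode v st).val.S = Ω st.S + st.gain v := by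
            rw [hS, h.gain, ← h.cov_eq, ← h.cover, Finset.insert_eq]
          have h6 : (y - Ω st.S) / m ≤ st.gain v := by
            rw [div_le_iff₀ hm']
            linarith
          rw [h5, one_sub_mul, one_div_mul_eq_div]
          linarith
        calc contraction I.n k (st.S.card + 1) i * (y - Ω (insertNode v st).val.S)
            ≤ contraction I.n k (st.S.card + 1) i * ((1 - 1 / (m : ℝ)) * (y - Ω st.S)) :=
              mul_le_mul_of_nonneg_left h2 (contraction_nonneg _ _ _ _)
          _ = _ := by ring

theorem greedy_spec {k : ℕ} (hk : 1 ≤ k) (hkn : k ≤ I.n) {j : ℕ} {S₀ : Finset I.Node}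
    (hj : S₀.card + j ≤ I.n) {Rs : List (GRR I)} (hRs : ∀ R ∈ Rs, ValidGRR S₀ R)
    {l : List (Snapshot I)} (hl : l ∈ (greedy k j S₀ Rs).Supp) :
    l.length = j + 1 ∧
      ∀ i s, l[i]? = some s → SnapshotSpec k (fun A => totalValue A Rs) S₀ i s := by
  simp only [greedy, Rand.mem_Supp_bind, Rand.mem_Supp_lift] at hl
  obtain ⟨_, rfl, hl⟩ := hl
  obtain ⟨h1, h2⟩ := initState_tracks hRs
  have := greedyLoop_spec hk hkn (fun A B hAB => totalValue_mono hAB Rs) j _ h1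
    (by rw [h2]; exact hj) l hl
  rwa [h2] at this

theorem bestUb_ge {l : List (Snapshot I)} (hl : l ≠ []) {y : ℝ} (h : ∀ s ∈ l, y ≤ s.ub) :
    y ≤ (bestUb l).val := by
  cases l with
  | nil => exact absurd rfl hl
  | cons s l =>
    simp only [bestUb, Timed.val_foldlM, Timed.val_bind, Timed.val_pure]
    have : ∀ (l : List (Snapshot I)) (x : ℝ), y ≤ x → (∀ s ∈ l, y ≤ s.ub) →
        y ≤ l.foldl (fun x t => min x t.ub) x := by
      intro l
      induction l with
      | nil => intro x hx _; simpa using hx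
      | cons t l ih =>
        intro x hx hl
        exact ih _ (le_min hx (hl t (by simp))) fun s hs => hl s (by simp [hs])
    exact this l s.ub (h s (by simp)) fun t ht => h t (by simp [ht])

theorem chooseSentinel_spec {k : ℕ} {ε₁ δl fu : ℝ} {θ : ℕ} {l : List (Snapshot I)} :
    (chooseSentinel k ε₁ δl fu θ l).val = (0, ∅) ∨
    ∃ i s, l[i]? = some s ∧ (chooseSentinel k ε₁ δl fu θ l).val = (i, s.S) := by
  unfold chooseSentinel
  have : ∀ (L : List (Snapshot I × ℕ)) (best : ℕ × Finset I.Node),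
      (∀ t ∈ L, t ∈ l.zipIdx) →
      (best = (0, ∅) ∨ ∃ i s, l[i]? = some s ∧ best = (i, s.S)) →
      ((L.foldlM (fun best t => do
        Timed.tick 1
        pure (if sentinelRatio k t.2 - ε₁ ≤ lowerBound t.1.cov θ δl / fu then (t.2, t.1.S)
          else best)) best : Timed (ℕ × Finset I.Node)).val = (0, ∅) ∨
      ∃ i s, l[i]? = some s ∧ (L.foldlM (fun best t => do
        Timed.tick 1
        pure (if sentinelRatio k t.2 - ε₁ ≤ lowerBound t.1.cov θ δl / fu then (t.2, t.1.S)
          else best)) best : Timed (ℕ × Finset I.Node)).val = (i, s.S)) := by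
    intro L
    induction L with
    | nil => intro best _ hb; simpa using hb
    | cons t L ih =>
      intro best hL hb
      rw [List.foldlM_cons, Timed.val_bind]
      refine ih _ (fun t ht => hL t (by simp [ht])) ?_
      simp only [Timed.val_bind, Timed.val_pure]
      split_ifs
      · refine Or.inr ⟨t.2, t.1, ?_, rfl⟩
        have := hL t (by simp)
        rwa [List.mem_zipIdx_iff_getElem?] at this
      · exact hb
  exact this l.zipIdx (0, ∅) (fun t ht => ht) (Or.inl rfl)

end Problem

end

end CCDIM

namespace CCDIM

open scoped ENNReal

/-! ## The contraction factor of the greedy algorithm -/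

noncomputable section

namespace Problem

theorem contraction_step_le {k m : ℕ} (hm : 1 ≤ m) :
    1 - 1 / ((min k m : ℕ) : ℝ) ≤ 1 - 1 / (k : ℝ) ∨ k = 0 := by
  rcases Nat.eq_zero_or_pos k with h | h
  · exact Or.inr h
  · left
    have h1 : 0 < min k m := by omega
    have h2 : (0 : ℝ) < (min k m : ℕ) := by exact_mod_cast h1
    have h3 : ((min k m : ℕ) : ℝ) ≤ k := by exact_mod_cast min_le_left _ _
    have := one_div_le_one_div_of_le h2 h3
    linarith

theorem contraction_le_pow {n k : ℕ} (hk : 1 ≤ k) (b j : ℕ) (h : b + j ≤ n) :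
    contraction n k b j ≤ (1 - 1 / (k : ℝ)) ^ j := by
  induction j generalizing b with
  | zero => simp [contraction]
  | succ j ih =>
    rw [contraction, pow_succ']
    rcases contraction_step_le (k := k) (m := n - b) (by omega) with h1 | h1
    · exact mul_le_mul h1 (ih (b + 1) (by omega)) (contraction_nonneg _ _ _ _)
        (one_sub_inv_nonneg k)
    · omega

theorem one_sub_inv_pow_le {k : ℕ} (hk : 1 ≤ k) : (1 - 1 / (k : ℝ)) ^ k ≤ 1 / Real.exp 1 := by
  have hk' : (0 : ℝ) < k := by exact_mod_cast hk
  have h1 : 1 - 1 / (k : ℝ) ≤ Real.exp (-(1 / k)) := by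
    have := Real.add_one_le_exp (-(1 / (k : ℝ))); linarith
  calc (1 - 1 / (k : ℝ)) ^ k ≤ Real.exp (-(1 / k)) ^ k :=
        pow_le_pow_left₀ (one_sub_inv_nonneg k) h1 k
    _ = 1 / Real.exp 1 := by
        rw [← Real.exp_nat_mul, one_div (Real.exp 1), ← Real.exp_neg]
        congr 1
        field_simp

/-- The two stages together still make k greedy steps: the loss factor of the first b times that of
the remaining k - b is at most (1 - 1/k)^k. -/
theorem contraction_mul_pow_le {n k b : ℕ} (hk : 1 ≤ k) (hkn : k ≤ n) (hb : b ≤ k) :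
    contraction n k b (k - b) * (1 - 1 / (k : ℝ)) ^ b ≤ 1 / Real.exp 1 := by
  calc contraction n k b (k - b) * (1 - 1 / (k : ℝ)) ^ b
      ≤ (1 - 1 / (k : ℝ)) ^ (k - b) * (1 - 1 / (k : ℝ)) ^ b :=
        mul_le_mul_of_nonneg_right (contraction_le_pow hk b (k - b) (by omega))
          (pow_nonneg (one_sub_inv_nonneg k) b)
    _ = (1 - 1 / (k : ℝ)) ^ k := by rw [← pow_add]; congr 1; omega
    _ ≤ _ := one_sub_inv_pow_le hk

theorem log_choose_nonneg (n b : ℕ) : 0 ≤ Real.log (n.choose b) := Real.log_natCast_nonneg _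

/-- The logarithms of the binomial coefficients are concave. -/
theorem log_choose_concave {n j : ℕ} (h : j + 2 ≤ n) :
    Real.log (n.choose (j + 2)) + Real.log (n.choose j) ≤ 2 * Real.log (n.choose (j + 1)) := by
  have p0 : 0 < n.choose j := Nat.choose_pos (by omega)
  have p1 : 0 < n.choose (j + 1) := Nat.choose_pos (by omega)
  have p2 : 0 < n.choose (j + 2) := Nat.choose_pos (by omega)
  have e1 := Nat.choose_succ_right_eq n j
  have e2 := Nat.choose_succ_right_eq n (j + 1)
  have key : n.choose (j + 2) * n.choose j ≤ n.choose (j + 1) ^ 2 := by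
    obtain ⟨d, rfl⟩ : ∃ d, n = j + 2 + d := ⟨n - (j + 2), by omega⟩
    rw [show j + 2 + d - j = d + 2 by omega] at e1
    rw [show j + 2 + d - (j + 1) = d + 1 by omega] at e2
    generalize (j + 2 + d).choose j = x at *
    generalize (j + 2 + d).choose (j + 1) = y at *
    generalize (j + 2 + d).choose (j + 2) = z at *
    have h3 : (z * x) * ((j + 2) * (d + 2)) = y ^ 2 * ((d + 1) * (j + 1)) := by
      calc (z * x) * ((j + 2) * (d + 2)) = (z * (j + 1 + 1)) * (x * (d + 2)) := by ring
        _ = y ^ 2 * ((d + 1) * (j + 1)) := by rw [e2, ← e1]; ring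
    have h4 : (d + 1) * (j + 1) ≤ (j + 2) * (d + 2) := by nlinarith
    have h5 : 0 < (j + 2) * (d + 2) := by positivity
    refine Nat.le_of_mul_le_mul_right ?_ h5
    rw [h3]
    exact Nat.mul_le_mul_left _ h4
  rw [← Real.log_mul (by positivity) (by positivity)]
  calc _ ≤ Real.log ((n.choose (j + 1) : ℝ) ^ 2) := by
        apply Real.log_le_log (by positivity)
        exact_mod_cast key
    _ = _ := by rw [Real.log_pow]; norm_num

/-- For a concave sequence starting at log C(n, 0) = 0, the averages (log C(n, j))/j decrease; the
statement is this, cleared of denominators. -/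
theorem log_choose_average {n : ℕ} (j : ℕ) (h : j + 1 ≤ n) :
    j * Real.log (n.choose (j + 1)) ≤ (j + 1) * Real.log (n.choose j) := by
  induction j with
  | zero => simp
  | succ j ih =>
    have h1 := log_choose_concave (n := n) (j := j) (by omega)
    have h2 := ih (by omega)
    push_cast at h2 ⊢
    have h3 := mul_le_mul_of_nonneg_left h1 (by positivity : (0 : ℝ) ≤ j + 1)
    rw [show j + 1 + 1 = j + 2 by omega]
    linarith

/-- Each step needs (1 - 1/(n - b)) log C(n, b) ≤ log C(n, b + 1), the decrease of averages read
from the other end of the row. It makes a union bound over all b-sets affordable with only log C(n,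
k) in the sample size, even where C(n, b) is larger. -/
theorem contraction_mul_log_choose_le {n k : ℕ} (hk : 1 ≤ k) (b j : ℕ) (h : b + j ≤ n) :
    contraction n k b j * Real.log (n.choose b) ≤ Real.log (n.choose (b + j)) := by
  induction j generalizing b with
  | zero => simp [contraction]
  | succ j ih =>
    have h1 := ih (b + 1) (by omega)
    rw [show b + 1 + j = b + (j + 1) by omega] at h1
    have h2 : (1 - 1 / ((min k (n - b) : ℕ) : ℝ)) * Real.log (n.choose b)
        ≤ Real.log (n.choose (b + 1)) := by
      obtain ⟨i, hi⟩ : ∃ i, n - b = i + 1 := ⟨n - b - 1, by omega⟩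
      have h3 := log_choose_average (n := n) i (by omega)
      rw [Nat.choose_symm_of_eq_add (show n = (i + 1) + b by omega),
        Nat.choose_symm_of_eq_add (show n = i + (b + 1) by omega)] at h3
      -- Replacing the minimum by n - b = i + 1 only weakens the contraction.
      have h4 : (1 - 1 / ((min k (n - b) : ℕ) : ℝ)) ≤ i / (i + 1) := by
        have h5 : 0 < min k (n - b) := by omega
        have h6 : (0 : ℝ) < (min k (n - b) : ℕ) := by exact_mod_cast h5
        have h7 : ((min k (n - b) : ℕ) : ℝ) ≤ i + 1 := by
          have : min k (n - b) ≤ i + 1 := by omega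
          exact_mod_cast this
        have h8 := one_div_le_one_div_of_le h6 h7
        have h9 : (i : ℝ) / (i + 1) = 1 - 1 / (i + 1) := by field_simp; ring
        linarith
      refine (mul_le_mul_of_nonneg_right h4 (log_choose_nonneg _ _)).trans ?_
      rw [div_mul_eq_mul_div, div_le_iff₀ (by positivity)]
      linarith
    calc contraction n k b (j + 1) * Real.log (n.choose b)
        = contraction n k (b + 1) j
          * ((1 - 1 / ((min k (n - b) : ℕ) : ℝ)) * Real.log (n.choose b)) := by
          rw [contraction]; ring
      _ ≤ contraction n k (b + 1) j * Real.log (n.choose (b + 1)) :=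
          mul_le_mul_of_nonneg_left h2 (contraction_nonneg _ _ _ _)
      _ ≤ _ := h1

theorem succ_le_choose {n b : ℕ} (h : b < n) : n + 1 ≤ (n + 1).choose (b + 1) := by
  induction n with
  | zero => omega
  | succ n ih =>
    rcases Nat.lt_succ_iff_lt_or_eq.1 h with h | rfl
    · have h1 := ih h
      have h2 : 0 < (n + 1).choose b := Nat.choose_pos (by omega)
      rw [Nat.choose_succ_succ']
      omega
    · simp

/-- The C(n, b) sets of size b contribute 1/C(n, b) together. The two ends give 1 each, and for
positive n the n - 1 inner terms are at most 1/n each. -/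
theorem sum_inv_choose_le (n : ℕ) :
    ∑ S : Finset (Fin n), (1 / (n.choose S.card : ℝ)) ^ 2 ≤ 3 := by
  have h1 : ∑ S : Finset (Fin n), (1 / (n.choose S.card : ℝ)) ^ 2
      = ∑ b ∈ Finset.range (n + 1), 1 / (n.choose b : ℝ) := by
    rw [← Finset.powerset_univ, Finset.sum_powerset_apply_card (fun b => (1 / (n.choose b : ℝ)) ^ 2),
      Finset.card_univ, Fintype.card_fin]
    refine Finset.sum_congr rfl fun b hb => ?_
    have : 0 < n.choose b := Nat.choose_pos (by simp at hb; omega)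
    rw [nsmul_eq_mul]
    field_simp
  rw [h1]
  cases n with
  | zero => simp
  | succ n =>
    rw [Finset.sum_range_succ, Finset.sum_range_succ']
    have h2 : ∑ b ∈ Finset.range n, 1 / ((n + 1).choose (b + 1) : ℝ)
        ≤ ∑ b ∈ Finset.range n, 1 / ((n : ℝ) + 1) := by
      refine Finset.sum_le_sum fun b hb => one_div_le_one_div_of_le (by positivity) ?_
      have h5 := succ_le_choose (n := n) (b := b) (Finset.mem_range.1 hb)
      exact_mod_cast h5
    rw [Finset.sum_const, Finset.card_range, nsmul_eq_mul] at h2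
    have h3 : (n : ℝ) * (1 / ((n : ℝ) + 1)) ≤ 1 := by
      rw [mul_one_div, div_le_one (by positivity)]; linarith
    simp only [Nat.choose_zero_right, Nat.choose_self, Nat.cast_one]
    linarith

/-! ## Numerical facts -/

/-- The constant `1 - 1 / e`. -/
def greedyConst : ℝ := 1 - 1 / Real.exp 1

theorem greedyConst_gt : 0.632 < greedyConst := by
  have h1 := Real.exp_one_gt_d9
  have : 1 / Real.exp 1 < 0.368 := by
    rw [div_lt_iff₀ (Real.exp_pos 1)]; norm_num at h1 ⊢; linarith
  unfold greedyConst; linarith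

theorem greedyConst_lt : greedyConst < 0.63213 := by
  have h1 := Real.exp_one_lt_d9
  have : 0.36787 < 1 / Real.exp 1 := by
    rw [lt_div_iff₀ (Real.exp_pos 1)]; norm_num at h1 ⊢; linarith
  unfold greedyConst; linarith

/-- The choice of the variance bound in the remaining-set stage. -/
theorem exists_variance_bound {t F ε s : ℝ} (ht0 : 0 ≤ t) (ht1 : t ≤ 1) (hF0 : 0 ≤ F)
    (hε : 0 < ε) (_ : ε < 1) (hts : t * s ≤ 1 / Real.exp 1)
    (h : t ≤ 1 / Real.exp 1 ∨ 1 - s - greedyConst * ε / √t ≤ F) :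
    ∃ τ : ℝ, 0 < τ ∧ greedyConst * (1 - t) ^ 2 ≤ τ ∧
      (greedyConst - ε - F) + √(2 * τ) * ε / 6 ≤ τ ∧
      t * (1 - F) - 1 / Real.exp 1 + √(2 * τ) * ε / 2 ≤ ε := by
  have hc1 := greedyConst_gt
  have hc2 := greedyConst_lt
  have hce : 1 / Real.exp 1 = 1 - greedyConst := by unfold greedyConst; ring
  rw [hce] at hts h ⊢
  set c := greedyConst
  have hsc : √(2 * c) ≤ 1.1245 := by
    rw [Real.sqrt_le_left (by norm_num)]; norm_num; linarith
  have hsε : √(2 * c) * ε ≤ 1.1245 * ε := mul_le_mul_of_nonneg_right hsc hε.le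
  have hct : c * (1 - t) ^ 2 ≤ c :=
    mul_le_of_le_one_right (by linarith) (pow_le_one₀ (by linarith) (by linarith))
  -- If the remaining greedy steps alone contract to 1/e, nothing is required of the sentinel set
  -- and τ = c works, because √(2c) is less than 2.
  rcases le_or_gt t (1 - c) with h1 | h1
  · refine ⟨c, by linarith, hct, by linarith, ?_⟩
    have : t * (1 - F) ≤ 1 - c := (mul_le_of_le_one_right ht0 (by linarith)).trans h1
    linarith
  have hF' := h.resolve_left (not_le.2 h1)
  set r := √t with hr
  have hrt : r ^ 2 = t := Real.sq_sqrt ht0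
  have hr0 : 0 ≤ r := Real.sqrt_nonneg t
  have hr6 : 0.6 ≤ r := by
    rw [hr, Real.le_sqrt (by norm_num) ht0]; norm_num; linarith
  have hr1 : r ≤ 1 := by nlinarith
  -- The shortfall 1 - F is at most s + cε/√t, and t·s ≤ 1/e. The tolerance cε/√t of the first stage
  -- thus returns as cε√t: the contraction repairs most of it.
  have h3 : t * (1 - F) - (1 - c) ≤ c * ε * r := by
    have h4 : t * (1 - F) ≤ t * (s + c * ε / r) := by gcongr; linarith
    have h5 : t * (c * ε / r) = c * ε * r := by rw [← hrt]; field_simp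
    linarith
  -- The last requirement reduces to 2c√t + √(2τ) ≤ 2. As t grows, τ has to shrink; three values of
  -- τ with break points 0.47 and 0.6 are enough.
  have third : ∀ q : ℝ, 2 * c * r + q ≤ 2 → t * (1 - F) - (1 - c) + q * ε / 2 ≤ ε := by
    intro q hq
    have := mul_le_mul_of_nonneg_right hq hε.le
    linarith
  have second : c - ε - F ≤ s - (1 - c) - ε + c * ε / r := by linarith
  rcases le_or_gt t 0.47 with h2 | h2
  · refine ⟨c, by linarith, hct, by linarith, third _ ?_⟩
    have : r ≤ 0.6856 := by
      rw [hr, Real.sqrt_le_left (by norm_num)]; norm_num; linarith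
    have := mul_le_mul hc2.le this hr0 (by norm_num)
    norm_num at this
    linarith
  rcases le_or_gt t 0.6 with h6 | h6
  · have hq : √(2 * 0.51) ≤ 1.01 := by
      rw [Real.sqrt_le_left (by norm_num)]; norm_num
    have hra : r ≤ 0.7746 := by
      rw [hr, Real.sqrt_le_left (by norm_num)]; norm_num; linarith
    have hrb : 0.6855 ≤ r := by
      rw [hr, Real.le_sqrt (by norm_num) ht0]; norm_num; linarith
    have hcr := mul_le_mul hc2.le hra hr0 (by norm_num)
    have hqε := mul_le_mul_of_nonneg_right hq hε.le
    have ht2 : (1 - t) ^ 2 ≤ 0.53 ^ 2 := pow_le_pow_left₀ (by linarith) (by linarith) 2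
    have hct2 := mul_le_mul hc2.le ht2 (by positivity) (by norm_num)
    refine ⟨0.51, by norm_num, ?_, ?_, third _ ?_⟩
    · norm_num at hct2 ⊢; linarith
    swap
    · norm_num at hcr hq ⊢; linarith
    -- A large t forces s ≤ (1 - c)/t, so F is large and a bad superset has little marginal value
    -- left. That is what permits the smaller τ.
    have hs1 : s ≤ 0.78298 := by
      by_contra hcon
      push Not at hcon
      have := mul_le_mul h2.le hcon.le (by norm_num) ht0
      norm_num at this
      linarith
    have hd : c * ε / r ≤ 0.9223 * ε := by
      rw [div_le_iff₀ (by linarith)]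
      have := mul_le_mul_of_nonneg_right (show c ≤ 0.9223 * r by linarith) hε.le
      linarith
    norm_num at hqε hs1 hd second ⊢
    linarith
  · have hq : √(2 * 0.25) ≤ 0.7072 := by
      rw [Real.sqrt_le_left (by norm_num)]; norm_num
    have hrb : 0.7745 ≤ r := by
      rw [hr, Real.le_sqrt (by norm_num) ht0]; norm_num; linarith
    have hcr := mul_le_mul hc2.le hr1 hr0 (by norm_num)
    have hqε := mul_le_mul_of_nonneg_right hq hε.le
    have ht2 : (1 - t) ^ 2 ≤ 0.4 ^ 2 := pow_le_pow_left₀ (by linarith) (by linarith) 2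
    have hct2 := mul_le_mul hc2.le ht2 (by positivity) (by norm_num)
    refine ⟨0.25, by norm_num, ?_, ?_, third _ ?_⟩
    · norm_num at hct2 ⊢; linarith
    swap
    · norm_num at hcr hq ⊢; linarith
    have hs1 : s ≤ 0.61334 := by
      by_contra hcon
      push Not at hcon
      have := mul_le_mul h6.le hcon.le (by norm_num) ht0
      norm_num at this
      linarith
    have hd : c * ε / r ≤ 0.8162 * ε := by
      rw [div_le_iff₀ (by linarith)]
      have := mul_le_mul_of_nonneg_right (show c ≤ 0.8162 * r by linarith) hε.le
      linarith
    norm_num at hqε hs1 hd second ⊢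
    linarith

end Problem

end

end CCDIM

namespace CCDIM

open scoped ENNReal

/-! ## Failure of the largest collections -/

noncomputable section

namespace Rand

variable {α β : Type}

open Classical in
/-- The probability of an event. -/
def Pr (x : Rand α) (P : α → Prop) : ℝ≥0∞ := x.E fun a => if P a then 1 else 0

theorem Pr_mono {x : Rand α} {P Q : α → Prop} (h : ∀ a ∈ x.Supp, P a → Q a) : x.Pr P ≤ x.Pr Q := by
  refine E_mono fun a ha => ?_
  split_ifs with h1 h2
  exacts [le_rfl, absurd (h a ha h1) h2, zero_le, le_rfl]

theorem Pr_or_le (x : Rand α) (P Q : α → Prop) :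
    x.Pr (fun a => P a ∨ Q a) ≤ x.Pr P + x.Pr Q := by
  unfold Pr
  rw [← E_add]
  refine E_mono fun a _ => ?_
  by_cases h1 : P a <;> by_cases h2 : Q a <;> simp [h1, h2]

open Classical in
theorem Pr_exists_le {ι : Type} (x : Rand α) (s : Finset ι) (P : ι → α → Prop) :
    x.Pr (fun a => ∃ i ∈ s, P i a) ≤ ∑ i ∈ s, x.Pr (P i) := by
  unfold Pr
  rw [← E_finset_sum]
  refine E_mono fun a _ => ?_
  split_ifs with h
  · obtain ⟨i, hi, h⟩ := h
    refine le_trans ?_ (Finset.single_le_sum (f := fun i => if P i a then (1 : ℝ≥0∞) else 0)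
      (fun _ _ => zero_le) hi)
    simp [h]
  · exact zero_le

theorem Pr_le_one (x : Rand α) (P : α → Prop) : x.Pr P ≤ 1 :=
  E_le_const fun a _ => by split_ifs <;> simp

theorem prob_eq_Pr (x : Rand α) (P : α → Prop) : x.prob {a | P a} = x.Pr P := by
  rw [prob_eq_E]
  refine E_congr fun a _ => ?_
  by_cases h : P a <;> simp [h]

theorem Pr_add_Pr_not (x : Rand α) (P : α → Prop) : x.Pr P + x.Pr (fun a => ¬ P a) = 1 := by
  unfold Pr
  rw [← E_add, ← E_const x 1]
  exact E_congr fun a _ => by by_cases h : P a <;> simp [h]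

end Rand

namespace Problem

variable {I : Problem}

/-- A sentinel set from which the second stage can reach the approximation ratio, if `O` is the
value of the optimum. -/
def GoodSentinel (k : ℕ) (ε O : ℝ) (S : Finset I.Node) : Prop :=
  (greedyConst - ε) * O ≤ I.objective S ∨
  contraction I.n k S.card (k - S.card) ≤ 1 / Real.exp 1 ∨
  (sentinelRatio k S.card - greedyConst * ε / √(contraction I.n k S.card (k - S.card))) * O
    ≤ I.objective S

/-- The collection overestimates a sentinel set that is not good. -/
def MisleadsSentinel (k : ℕ) (ε : ℝ) (T : Finset I.Node) (Rs : List (GRR I)) : Prop :=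
  ∃ S : Finset I.Node, S.card ≤ k ∧ ¬ GoodSentinel k ε (I.objective T) S ∧
    sentinelRatio k S.card * totalValue T Rs ≤ totalValue S Rs

theorem sentinelRatio_nonneg {k : ℕ} (b : ℕ) (hk : 1 ≤ k) : 0 ≤ sentinelRatio k b := by
  unfold sentinelRatio
  have h1 := one_sub_inv_nonneg k
  have h2 : 1 - 1 / (k : ℝ) ≤ 1 := by
    have : (0 : ℝ) ≤ 1 / k := by positivity
    linarith
  have := pow_le_one₀ (n := b) h1 h2
  linarith

theorem sentinelRatio_le_one {k : ℕ} (b : ℕ) : sentinelRatio k b ≤ 1 := by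
  unfold sentinelRatio
  have := pow_nonneg (one_sub_inv_nonneg k) b
  linarith

theorem exp_neg_log_six {δ : ℝ} (hδ : 0 < δ) (c : ℝ) (hc : 0 < c) :
    Real.exp (-Real.log (c / δ)) = δ / c := by
  rw [Real.exp_neg, Real.exp_log (by positivity), inv_div]

theorem value_bounds (hn : 0 < I.n) (B A : Finset I.Node) :
    ∀ R ∈ (sampleGRR B).Supp, 0 ≤ value A R ∧ value A R ≤ 1 :=
  fun R _ => ⟨value_nonneg A R, value_le_one hn A R⟩

theorem value_sub_bounds (hn : 0 < I.n) (B A : Finset I.Node) :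
    ∀ R ∈ (sampleGRR B).Supp, 0 ≤ value (A ∪ B) R - value B R ∧ value (A ∪ B) R - value B R ≤ 1 :=
  fun R _ => ⟨sub_nonneg.2 (value_mono Finset.subset_union_right R), by
    have h1 := value_nonneg B R
    have h2 := value_le_one hn (A ∪ B) R
    linarith⟩

theorem totalValue_sub (A B : Finset I.Node) (Rs : List (GRR I)) :
    (Rs.map fun R => value A R - value B R).sum = totalValue A Rs - totalValue B Rs := by
  induction Rs with
  | nil => simp [totalValue]
  | cons R Rs ih =>
    simp only [List.map_cons, List.sum_cons, ih, totalValue]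
    ring

/-- In the last iteration of the sentinel stage, the collection is large enough. -/
theorem misleadsSentinel_le (hn : 0 < I.n) {k : ℕ} (hk : 1 ≤ k) (hkn : k ≤ I.n) {ε δ : ℝ}
    (hε : 0 < ε) (hδ : 0 < δ) (hδ2 : δ ≤ 1 / 2) {T : Finset I.Node}
    (hfm : I.fmin k ≤ greedyConst * I.objective T) {M : ℕ}
    (hM : I.thetaMaxSentinel k (ε / 2) δ / 2 ≤ M) :
    (sampleMany ∅ M).Pr (MisleadsSentinel k ε T) ≤ ENNReal.ofReal (5 / 24 * δ) := by
  have hc1 := greedyConst_gt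
  have hc2 := greedyConst_lt
  have hce : 1 / Real.exp 1 = 1 - greedyConst := by unfold greedyConst; ring
  set c := greedyConst with hc
  set O := I.objective T with hO
  have hfm0 := fmin_pos hn hk
  have hO0 : 0 < O := by
    by_contra h
    have : c * O ≤ 0 := mul_nonpos_of_nonneg_of_nonpos (by linarith) (by linarith)
    linarith
  set a := Real.log (6 / δ) with ha
  have ha0 : 0 < a := Real.log_pos (by rw [lt_div_iff₀ hδ]; linarith)
  set L := Real.log (I.n.choose k) with hL
  have hL0 : 0 ≤ L := log_choose_nonneg _ _
  have hM' : (√a + √(L + a)) ^ 2 ≤ M * ((ε / 2) ^ 2 * I.fmin k) := by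
    unfold thetaMaxSentinel at hM
    rw [div_div, div_le_iff₀ (by positivity)] at hM
    linarith
  have hA : 0 < √a := Real.sqrt_pos.2 ha0
  have hM0 : (0 : ℝ) < M := by
    have h1 : 0 < (√a + √(L + a)) ^ 2 := by positivity
    by_contra h
    have h2 : (M : ℝ) = 0 := le_antisymm (not_lt.1 h) (Nat.cast_nonneg _)
    rw [h2, zero_mul] at hM'
    linarith
  have hMN : 0 < M := by exact_mod_cast hM0
  set D := √(M * O) with hD
  have hD2 : D ^ 2 = M * O := Real.sq_sqrt (by positivity)
  have hD0 : 0 < D := Real.sqrt_pos.2 (by positivity)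
  have hsc : √c ^ 2 = c := Real.sq_sqrt (by linarith)
  have hsc0 : 0 < √c := Real.sqrt_pos.2 (by linarith)
  -- Here `fmin` ≤ cO is used: it turns the sample size into a statement about D² = MO, the expected
  -- coverage of the optimum.
  have hAB : √a + √(L + a) ≤ √c * (ε / 2) * D := by
    refine le_of_sq_le_sq (hM'.trans ?_) (by positivity)
    rw [mul_pow, mul_pow, hsc, hD2]
    have : (M : ℝ) * ((ε / 2) ^ 2 * I.fmin k) ≤ M * ((ε / 2) ^ 2 * (c * O)) := by gcongr
    linarith
  have hs2 : √2 ^ 2 = 2 := Real.sq_sqrt (by norm_num)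
  have hs20 : 0 < √2 := Real.sqrt_pos.2 (by norm_num)
  have hs2c : √2 ≤ 2 * √c := by
    refine le_of_sq_le_sq ?_ (by positivity)
    rw [mul_pow, hs2, hsc]
    linarith
  -- In units of O, u is the tolerated lower deviation for T and v S the tolerated upper deviation
  -- for S. The lower-tail exponent becomes a. The upper one is at least 2(log C(n, |S|) + a), so
  -- that the failure probability is squared and summable over all subsets.
  set u := √2 * √a / D with hu
  set G : Finset I.Node → ℝ := fun S => √(Real.log (I.n.choose S.card) + a) with hG
  set v : Finset I.Node → ℝ := fun S => 2 * √c * G S / D with hv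
  have hG0 : ∀ S, 0 < G S := fun S => Real.sqrt_pos.2 (by
    have := log_choose_nonneg I.n S.card; linarith)
  have hG2 : ∀ S, G S ^ 2 = Real.log (I.n.choose S.card) + a := fun S => Real.sq_sqrt (by
    have := log_choose_nonneg I.n S.card; linarith)
  have hv0 : ∀ S, 0 < v S := fun S => by have := hG0 S; positivity
  classical
  set bad := (Finset.univ : Finset (Finset I.Node)).filter
    fun S => S.card ≤ k ∧ ¬ GoodSentinel k ε O S with hbad
  have huv : ∀ S ∈ bad, u + v S ≤ c * ε / √(contraction I.n k S.card (k - S.card)) ∧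
      v S / 3 ≤ ε ∧ I.objective S < (c - ε) * O ∧
      I.objective S < (sentinelRatio k S.card
        - c * ε / √(contraction I.n k S.card (k - S.card))) * O := by
    intro S hS
    obtain ⟨hSk, hgood⟩ := (Finset.mem_filter.1 hS).2
    simp only [GoodSentinel, not_or, not_le] at hgood
    obtain ⟨g1, g2, g3⟩ := hgood
    set t := contraction I.n k S.card (k - S.card) with ht
    have ht0 : 0 ≤ t := contraction_nonneg _ _ _ _
    have ht1 : t ≤ 1 := contraction_le_one _ _ _ _
    set r := √t
    have hr2 : r ^ 2 = t := Real.sq_sqrt ht0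
    have hr6 : 0.6 ≤ r := by
      rw [Real.le_sqrt (by norm_num) ht0]
      rw [hce] at g2
      norm_num; linarith
    have hr1 : r ≤ 1 := Real.sqrt_le_one.2 ht1
    have hlog := contraction_mul_log_choose_le (n := I.n) hk S.card (k - S.card) (by omega)
    rw [show S.card + (k - S.card) = k by omega, ← ht, ← hL] at hlog
    -- The place where t · log C(n, b) ≤ log C(n, k) pays: after multiplication by √t, the entropy
    -- of all b-sets fits into that of the k-sets.
    have hrG : r * G S ≤ √(L + a) := by
      refine Real.le_sqrt_of_sq_le ?_
      rw [mul_pow, hr2, hG2]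
      have : t * a ≤ a := mul_le_of_le_one_left ha0.le ht1
      linarith
    have h1 : u + v S ≤ c * ε / r := by
      rw [le_div_iff₀ (by linarith), hu, hv, ← add_div, div_mul_eq_mul_div, div_le_iff₀ hD0]
      calc (√2 * √a + 2 * √c * G S) * r = √2 * (√a * r) + 2 * √c * (r * G S) := by ring
        _ ≤ 2 * √c * (√a * 1) + 2 * √c * √(L + a) := by gcongr
        _ = 2 * √c * (√a + √(L + a)) := by ring
        _ ≤ 2 * √c * (√c * (ε / 2) * D) := by gcongr
        _ = c * ε * D := by linear_combination (ε * D) * hsc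
    refine ⟨h1, ?_, g1, g3⟩
    have h2 : c * ε / r ≤ 3 * ε := by
      rw [div_le_iff₀ (by linarith)]
      have := mul_le_mul_of_nonneg_right (show c ≤ 3 * r by linarith) hε.le
      linarith
    have h3 : 0 ≤ u := by positivity
    linarith
  -- If neither deviation occurs, the greedy inequality forces f(S) to exceed (ratio·(1 - u) - v)O,
  -- which is at least the threshold (ratio - cε/√t)O that a bad set misses.
  have hsub : (sampleMany ∅ M).Pr (MisleadsSentinel k ε T) ≤ (sampleMany ∅ M).Pr (fun Rs =>
      totalValue T Rs ≤ M * O - M * u * O ∨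
        ∃ S ∈ bad, M * I.objective S + M * v S * O ≤ totalValue S Rs) := by
    refine Rand.Pr_mono fun Rs _ hm => ?_
    obtain ⟨S, hSk, hgood, hS⟩ := hm
    have hSbad : S ∈ bad := Finset.mem_filter.2 ⟨Finset.mem_univ _, hSk, hgood⟩
    obtain ⟨h1, -, -, h4⟩ := huv S hSbad
    by_contra hcon
    push Not at hcon
    obtain ⟨c1, c2⟩ := hcon
    have c3 := c2 S hSbad
    have hr0 := sentinelRatio_nonneg S.card hk
    have hr1 := sentinelRatio_le_one (k := k) S.card
    set q := sentinelRatio k S.card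
    have hu0 : 0 ≤ u := by positivity
    have c4 : q * (M * O - M * u * O) ≤ q * totalValue T Rs :=
      mul_le_mul_of_nonneg_left c1.le hr0
    have c5 : q * u ≤ u := mul_le_of_le_one_left hu0 hr1
    have c6 : (q - (u + v S)) * O ≤ (q * (1 - u) - v S) * O :=
      mul_le_mul_of_nonneg_right (by linarith) hO0.le
    have c7 : (q - c * ε / √(contraction I.n k S.card (k - S.card))) * O
        ≤ (q - (u + v S)) * O := by gcongr
    have c8 := mul_lt_mul_of_pos_left (h4.trans_le (c7.trans c6)) hM0
    linarith
  refine hsub.trans ((Rand.Pr_or_le _ _ _).trans ?_)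
  have hO' := E_value (I := I) T ∅
  rw [Finset.union_empty] at hO'
  have p1 : (sampleMany ∅ M).Pr (fun Rs => totalValue T Rs ≤ M * O - M * u * O)
      ≤ ENNReal.ofReal (δ / 6) := by
    refine (lower_tail ∅ (value T) (value_bounds hn ∅ T) hO0 hO'.ge hMN
      (l := M * u * O) (by positivity) _ fun Rs h => h).trans ?_
    refine ENNReal.ofReal_le_ofReal ?_
    rw [← exp_neg_log_six hδ 6 (by norm_num), ← ha]
    refine Real.exp_le_exp.2 (neg_le_neg (le_of_eq ?_))
    rw [eq_div_iff (by positivity)]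
    have : u * D = √2 * √a := by rw [hu]; field_simp
    have h3 : u ^ 2 * (M * O) = 2 * a := by
      rw [← hD2, ← mul_pow, this, mul_pow, hs2, Real.sq_sqrt ha0.le]
    linear_combination (-(M * O)) * h3
  have p2 : ∀ S ∈ bad, (sampleMany ∅ M).Pr
      (fun Rs => M * I.objective S + M * v S * O ≤ totalValue S Rs)
      ≤ ENNReal.ofReal ((δ / 6) ^ 2 * (1 / (I.n.choose S.card : ℝ)) ^ 2) := by
    intro S hS
    obtain ⟨-, h2, h3, -⟩ := huv S hS
    have hvS := hv0 S
    have hfS := objective_nonneg S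
    have hS' := E_value (I := I) S ∅
    rw [Finset.union_empty] at hS'
    refine (upper_tail ∅ (value S) (value_bounds hn ∅ S) hfS hS'.le M
      (l := M * v S * O) (by positivity) _ fun Rs h => h).trans ?_
    refine ENNReal.ofReal_le_ofReal ?_
    have hexp : (δ / 6) ^ 2 * (1 / (I.n.choose S.card : ℝ)) ^ 2
        = Real.exp (-(2 * G S ^ 2)) := by
      have hch : 0 < I.n.choose S.card := Nat.choose_pos (by simpa using S.card_le_univ)
      have hch' : (0 : ℝ) < I.n.choose S.card := by exact_mod_cast hch
      have : Real.exp (-G S ^ 2) = (δ / 6) * (1 / (I.n.choose S.card : ℝ)) := by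
        rw [hG2, neg_add, Real.exp_add, ha, exp_neg_log_six hδ 6 (by norm_num), Real.exp_neg,
          Real.exp_log hch']
        ring
      rw [← mul_pow, ← this, ← Real.exp_nat_mul]
      congr 1; push_cast; ring
    rw [hexp]
    refine Real.exp_le_exp.2 (neg_le_neg ?_)
    rw [le_div_iff₀ (by positivity)]
    have h4 : v S * D = 2 * √c * G S := by rw [hv]; field_simp
    have h5 : v S ^ 2 * (M * O) = 4 * c * G S ^ 2 := by
      rw [← hD2, ← mul_pow, h4, mul_pow, mul_pow, hsc]; ring
    -- A bad set has f(S) < (c - ε)O and v/3 ≤ ε, so Bernstein's denominator is at most 2McO. The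
    -- factor c gained here is the one built into v.
    have h6 : I.objective S + v S * O / 3 ≤ c * O := by
      have := mul_le_mul_of_nonneg_right h2 hO0.le
      linarith
    have h7 : 2 * (M * I.objective S) + 2 * (M * v S * O) / 3 ≤ 2 * M * (c * O) := by
      have := mul_le_mul_of_nonneg_left h6 hM0.le
      linarith
    calc 2 * G S ^ 2 * (2 * (M * I.objective S) + 2 * (M * v S * O) / 3)
        ≤ 2 * G S ^ 2 * (2 * M * (c * O)) := by gcongr
      _ = (M * v S * O) ^ 2 := by linear_combination (-(M * O)) * h5
  have p3 : ∑ S ∈ bad, (sampleMany ∅ M).Pr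
      (fun Rs => M * I.objective S + M * v S * O ≤ totalValue S Rs)
      ≤ ENNReal.ofReal ((δ / 6) ^ 2 * 3) := by
    refine (Finset.sum_le_sum p2).trans ?_
    rw [← ENNReal.ofReal_sum_of_nonneg fun S _ => by positivity, ← Finset.mul_sum]
    refine ENNReal.ofReal_le_ofReal (mul_le_mul_of_nonneg_left ?_ (by positivity))
    refine le_trans (Finset.sum_le_sum_of_subset_of_nonneg (Finset.subset_univ _)
      fun S _ _ => by positivity) (sum_inv_choose_le I.n)
  refine (add_le_add p1 ((Rand.Pr_exists_le _ _ _).trans p3)).trans ?_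
  rw [← ENNReal.ofReal_add (by positivity) (by positivity)]
  refine ENNReal.ofReal_le_ofReal ?_
  -- δ/6 + 3(δ/6)² ≤ 5δ/24, using δ ≤ 1/2.
  nlinarith

/-- The collection leads the greedy algorithm from `S` to a set that is not good enough. -/
def MisleadsRemaining (k : ℕ) (ε : ℝ) (T S : Finset I.Node) (Rs : List (GRR I)) : Prop :=
  ∃ S' : Finset I.Node, S ⊆ S' ∧ S'.card = k ∧
    I.objective S' < (greedyConst - ε) * I.objective T ∧
    totalValue (T ∪ S) Rs - totalValue S' Rs
      ≤ contraction I.n k S.card (k - S.card) * (totalValue (T ∪ S) Rs - totalValue S Rs)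

theorem card_supersets_le (S : Finset I.Node) (k : ℕ) :
    ((Finset.univ : Finset (Finset I.Node)).filter fun S' => S ⊆ S' ∧ S'.card = k).card
      ≤ (I.n - S.card).choose (k - S.card) := by
  have h1 : (Finset.powersetCard (k - S.card) (Finset.univ \ S)).card
      = (I.n - S.card).choose (k - S.card) := by
    rw [Finset.card_powersetCard, Finset.card_sdiff_of_subset (Finset.subset_univ _),
      Finset.card_univ, Fintype.card_fin]
  rw [← h1]
  refine Finset.card_le_card_of_injOn (fun S' => S' \ S) (fun S' hS' => ?_) ?_
  · obtain ⟨-, h2, h3⟩ := Finset.mem_filter.1 hS'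
    exact Finset.mem_coe.2 (Finset.mem_powersetCard.2
      ⟨Finset.sdiff_subset_sdiff (Finset.subset_univ _) subset_rfl, by
        rw [Finset.card_sdiff_of_subset h2, h3]⟩)
  · intro A hA B hB hAB
    obtain ⟨-, h2, -⟩ := Finset.mem_filter.1 hA
    obtain ⟨-, h3, -⟩ := Finset.mem_filter.1 hB
    rw [← Finset.sdiff_union_of_subset h2, ← Finset.sdiff_union_of_subset h3]
    exact congrArg (· ∪ S) hAB

/-- In the last iteration of the remaining-set stage, the collection is large enough. -/
theorem misleadsRemaining_le (hn : 0 < I.n) {k : ℕ} (hk : 1 ≤ k) (hkn : k ≤ I.n) {ε δ : ℝ}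
    (hε : 0 < ε) (hε1 : ε < 1) (hδ : 0 < δ) (hδ2 : δ ≤ 1 / 2) {T : Finset I.Node}
    (hfm : I.fmin k ≤ greedyConst * I.objective T) {S : Finset I.Node} (hSk : S.card ≤ k)
    (hgood : GoodSentinel k ε (I.objective T) S) {M : ℕ}
    (hM : I.thetaMaxRemaining k S.card (ε / 2) δ / 2 ≤ M) :
    (sampleMany S M).Pr (MisleadsRemaining k ε T S) ≤ ENNReal.ofReal (2 / 9 * δ) := by
  have hc1 := greedyConst_gt
  have hc2 := greedyConst_lt
  have hce : 1 / Real.exp 1 = 1 - greedyConst := by unfold greedyConst; ring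
  -- If the sentinel set is already good enough, monotonicity passes this on to every superset.
  by_cases hS0 : (greedyConst - ε) * I.objective T ≤ I.objective S
  · refine le_trans (le_of_eq ?_) (zero_le)
    rw [← Rand.E_const (sampleMany S M) 0]
    refine Rand.E_congr fun Rs _ => if_neg ?_
    rintro ⟨S', h1, -, h3, -⟩
    have := objective_mono h1
    linarith
  push Not at hS0
  set c := greedyConst with hc
  set O := I.objective T with hO
  have hfm0 := fmin_pos hn hk
  have hO0 : 0 < O := by
    by_contra h
    have : c * O ≤ 0 := mul_nonpos_of_nonneg_of_nonpos (by linarith) (by linarith)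
    linarith
  set F := I.objective S / O with hF
  have hFO : F * O = I.objective S := by rw [hF]; field_simp
  have hF0 : 0 ≤ F := div_nonneg (objective_nonneg S) hO0.le
  have hF1 : F < c - ε := by rw [hF, div_lt_iff₀ hO0]; exact hS0
  set t := contraction I.n k S.card (k - S.card) with ht
  have ht0 : 0 ≤ t := contraction_nonneg _ _ _ _
  have ht1 : t ≤ 1 := contraction_le_one _ _ _ _
  obtain ⟨τ, hτ0, hτ1, hτ2, hτ3⟩ := exists_variance_bound (s := (1 - 1 / (k : ℝ)) ^ S.card)
    ht0 ht1 hF0 hε hε1 (contraction_mul_pow_le hk hkn hSk) (by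
      rcases hgood with h | h | h
      · exact absurd h (not_le.2 hS0)
      · exact Or.inl h
      · right
        rw [← hFO] at h
        exact le_of_mul_le_mul_right h hO0)
  rw [← hc] at hτ1 hτ2
  set a := Real.log (9 / δ) with ha
  have ha0 : 0 < a := Real.log_pos (by rw [lt_div_iff₀ hδ]; linarith)
  set L := Real.log ((I.n - S.card).choose (k - S.card)) with hL
  have hL0 : 0 ≤ L := log_choose_nonneg _ _
  have hsc : √c ^ 2 = c := Real.sq_sqrt (by linarith)
  have hsc0 : 0 < √c := Real.sqrt_pos.2 (by linarith)
  have hM' : (√a + √c * √(L + a)) ^ 2 ≤ M * ((ε / 2) ^ 2 * I.fmin k) := by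
    unfold thetaMaxRemaining at hM
    rw [div_div, div_le_iff₀ (by positivity), ← ha, ← hL] at hM
    change 2 * (√a + √(c * (L + a))) ^ 2 ≤ _ at hM
    rw [Real.sqrt_mul (by linarith)] at hM
    linarith
  have hA : 0 < √a := Real.sqrt_pos.2 ha0
  have hB : 0 < √(L + a) := Real.sqrt_pos.2 (by linarith)
  have hB2 : √(L + a) ^ 2 = L + a := Real.sq_sqrt (by linarith)
  have hM0 : (0 : ℝ) < M := by
    have h1 : 0 < (√a + √c * √(L + a)) ^ 2 := by positivity
    by_contra h
    have h2 : (M : ℝ) = 0 := le_antisymm (not_lt.1 h) (Nat.cast_nonneg _)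
    rw [h2, zero_mul] at hM'
    linarith
  have hMN : 0 < M := by exact_mod_cast hM0
  set D := √(M * O) with hD
  have hD2 : D ^ 2 = M * O := Real.sq_sqrt (by positivity)
  have hD0 : 0 < D := Real.sqrt_pos.2 (by positivity)
  have hAB : √a + √c * √(L + a) ≤ √c * (ε / 2) * D := by
    refine le_of_sq_le_sq (hM'.trans ?_) (by positivity)
    rw [mul_pow, mul_pow, hsc, hD2]
    have : (M : ℝ) * ((ε / 2) ^ 2 * I.fmin k) ≤ M * ((ε / 2) ^ 2 * (c * O)) := by gcongr
    linarith
  have hs2 : √2 ^ 2 = 2 := Real.sq_sqrt (by norm_num)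
  have hs20 : 0 < √2 := Real.sqrt_pos.2 (by norm_num)
  set w := √(2 * τ) with hw
  have hw2 : w ^ 2 = 2 * τ := Real.sq_sqrt (by positivity)
  have hw0 : 0 < w := Real.sqrt_pos.2 (by positivity)
  -- Deviations, in units of O, of the marginal coverages over S: u below for T, v above for a bad
  -- superset. The number τ bounds the variance term of the latter.
  set u := √2 * √a / D with hu
  set v := w * √(L + a) / D with hv
  have hu0 : 0 ≤ u := by positivity
  have hv0 : 0 < v := by positivity
  -- Only 1 - t of T's deviation is felt, and c(1 - t)² ≤ τ lets both deviations be paid from the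
  -- same sample size.
  have huv : (1 - t) * u + v ≤ w * ε / 2 := by
    have h1 : √c * (√2 * (1 - t)) ≤ w := by
      refine le_of_sq_le_sq ?_ hw0.le
      rw [mul_pow, mul_pow, hsc, hs2, hw2]
      linarith
    have h2 : √c * ((1 - t) * u + v) * D ≤ √c * (w * ε / 2) * D := by
      calc √c * ((1 - t) * u + v) * D = √c * (√2 * (1 - t)) * √a + w * (√c * √(L + a)) := by
            rw [hu, hv]; field_simp
        _ ≤ w * √a + w * (√c * √(L + a)) := by gcongr
        _ = w * (√a + √c * √(L + a)) := by ring
        _ ≤ w * (√c * (ε / 2) * D) := by gcongr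
        _ = √c * (w * ε / 2) * D := by ring
    exact le_of_mul_le_mul_left (le_of_mul_le_mul_right h2 hD0) hsc0
  have hv3 : v / 3 ≤ w * ε / 6 := by
    have : 0 ≤ (1 - t) * u := mul_nonneg (by linarith) hu0
    linarith
  classical
  set bad := ((Finset.univ : Finset (Finset I.Node)).filter
    fun S' => S ⊆ S' ∧ S'.card = k).filter fun S' => I.objective S' < (c - ε) * O with hbad
  -- Greedy gains at least 1 - t of what T gains over S. Without a deviation, (1 - t)(1 - F - u) < c
  -- - ε - F + v for a bad superset, contrary to the choice of τ.
  have hsub : (sampleMany S M).Pr (MisleadsRemaining k ε T S) ≤ (sampleMany S M).Pr (fun Rs =>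
      totalValue (T ∪ S) Rs - totalValue S Rs ≤ M * (O - I.objective S) - M * u * O ∨
        ∃ S' ∈ bad, M * (I.objective S' - I.objective S) + M * v * O
          ≤ totalValue (S' ∪ S) Rs - totalValue S Rs) := by
    refine Rand.Pr_mono fun Rs _ hm => ?_
    obtain ⟨S', hSS, hS'k, hS'O, hS'⟩ := hm
    have hSbad : S' ∈ bad := Finset.mem_filter.2
      ⟨Finset.mem_filter.2 ⟨Finset.mem_univ _, hSS, hS'k⟩, hS'O⟩
    by_contra hcon
    push Not at hcon
    obtain ⟨c1, c2⟩ := hcon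
    have c3 := c2 S' hSbad
    rw [Finset.union_eq_left.2 hSS] at c3
    have c4 := mul_le_mul_of_nonneg_left c1.le (show 0 ≤ 1 - t by linarith)
    have c5 : (1 - t) * (M * (O - I.objective S) - M * u * O)
        < M * (I.objective S' - I.objective S) + M * v * O := by
      have : (1 - t) * (totalValue (T ∪ S) Rs - totalValue S Rs)
        ≤ totalValue S' Rs - totalValue S Rs := by linarith
      linarith
    rw [← hFO] at c5
    have c6 : I.objective S' - F * O < (c - ε - F) * O := by linarith
    have c7 := mul_lt_mul_of_pos_left c6 hM0
    have c8 : ((1 - t) * (1 - F - u)) * (M * O) < (c - ε - F + v) * (M * O) := by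
      linarith
    have c9 := lt_of_mul_lt_mul_right c8 (by positivity)
    rw [hce] at hτ3
    linarith
  refine hsub.trans ((Rand.Pr_or_le _ _ _).trans ?_)
  have p1 : (sampleMany S M).Pr (fun Rs =>
      totalValue (T ∪ S) Rs - totalValue S Rs ≤ M * (O - I.objective S) - M * u * O)
      ≤ ENNReal.ofReal (δ / 9) := by
    have hμ : 0 < O - I.objective S := by
      have : (c - ε) * O ≤ 1 * O := by gcongr; linarith
      linarith
    refine (lower_tail S (fun R => value (T ∪ S) R - value S R) (value_sub_bounds hn S T) hμ
      ?_ hMN (l := M * u * O) (by positivity) _ fun Rs h => ?_).trans ?_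
    · rw [E_value_sub]
      refine ENNReal.ofReal_le_ofReal ?_
      have : O ≤ I.objective (T ∪ S) := objective_mono Finset.subset_union_left
      linarith
    · rw [totalValue_sub]; exact h
    · refine ENNReal.ofReal_le_ofReal ?_
      rw [← exp_neg_log_six hδ 9 (by norm_num), ← ha]
      refine Real.exp_le_exp.2 (neg_le_neg ?_)
      rw [le_div_iff₀ (by positivity)]
      have h2 : u * D = √2 * √a := by rw [hu]; field_simp
      have h3 : u ^ 2 * (M * O) = 2 * a := by
        rw [← hD2, ← mul_pow, h2, mul_pow, hs2, Real.sq_sqrt ha0.le]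
      have hfS := objective_nonneg S
      calc a * (2 * (M * (O - I.objective S))) ≤ a * (2 * (M * O)) := by
            gcongr; linarith
        _ = (M * u * O) ^ 2 := by linear_combination (-(M * O)) * h3
  set N := (I.n - S.card).choose (k - S.card) with hN
  have hN0 : (0 : ℝ) < N := by
    have : 0 < N := Nat.choose_pos (by omega)
    exact_mod_cast this
  have p2 : ∀ S' ∈ bad, (sampleMany S M).Pr (fun Rs =>
      M * (I.objective S' - I.objective S) + M * v * O
          ≤ totalValue (S' ∪ S) Rs - totalValue S Rs)
      ≤ ENNReal.ofReal (δ / 9 * (1 / N)) := by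
    intro S' hS'
    obtain ⟨h1, h2⟩ := Finset.mem_filter.1 hS'
    obtain ⟨-, hSS, -⟩ := Finset.mem_filter.1 h1
    have hμ : 0 ≤ I.objective S' - I.objective S := sub_nonneg.2 (objective_mono hSS)
    refine (upper_tail S (fun R => value (S' ∪ S) R - value S R) (value_sub_bounds hn S S') hμ
      ?_ M (l := M * v * O) (by positivity) _ fun Rs h => ?_).trans ?_
    · rw [E_value_sub, Finset.union_eq_left.2 hSS]
    · rw [totalValue_sub]; exact h
    · refine ENNReal.ofReal_le_ofReal ?_
      have hexp : δ / 9 * (1 / N) = Real.exp (-(L + a)) := by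
        rw [neg_add, Real.exp_add, ha, exp_neg_log_six hδ 9 (by norm_num), Real.exp_neg, hL,
          Real.exp_log hN0]
        ring
      rw [hexp]
      refine Real.exp_le_exp.2 (neg_le_neg ?_)
      rw [le_div_iff₀ (by positivity)]
      have h4 : v * D = w * √(L + a) := by rw [hv]; field_simp
      have h5 : v ^ 2 * (M * O) = 2 * τ * (L + a) := by
        rw [← hD2, ← mul_pow, h4, mul_pow, hw2, hB2]
      -- The second requirement on τ: the marginal value of a bad superset plus the Bernstein
      -- correction stays below τO. Working with marginals instead of full coverages is what keeps
      -- this small.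
      have h6 : I.objective S' - I.objective S + v * O / 3 ≤ τ * O := by
        have h7 : (c - ε - F + v / 3) * O ≤ τ * O := by gcongr; linarith
        rw [← hFO]
        linarith
      have h7 : 2 * (M * (I.objective S' - I.objective S)) + 2 * (M * v * O) / 3
          ≤ 2 * M * (τ * O) := by
        have := mul_le_mul_of_nonneg_left h6 hM0.le
        linarith
      calc (L + a) * (2 * (M * (I.objective S' - I.objective S)) + 2 * (M * v * O) / 3)
          ≤ (L + a) * (2 * M * (τ * O)) := by gcongr
        _ = (M * v * O) ^ 2 := by linear_combination (-(M * O)) * h5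
  have p3 : ∑ S' ∈ bad, (sampleMany S M).Pr (fun Rs =>
      M * (I.objective S' - I.objective S) + M * v * O
          ≤ totalValue (S' ∪ S) Rs - totalValue S Rs)
      ≤ ENNReal.ofReal (δ / 9) := by
    refine (Finset.sum_le_sum p2).trans ?_
    rw [Finset.sum_const, nsmul_eq_mul, ← ENNReal.ofReal_natCast,
      ← ENNReal.ofReal_mul (by positivity)]
    refine ENNReal.ofReal_le_ofReal ?_
    have h1 : bad.card ≤ N :=
      (Finset.card_le_card (Finset.filter_subset _ _)).trans (card_supersets_le S k)
    have h2 : (bad.card : ℝ) ≤ N := by exact_mod_cast h1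
    calc (bad.card : ℝ) * (δ / 9 * (1 / N)) ≤ N * (δ / 9 * (1 / N)) := by gcongr
      _ = δ / 9 := by field_simp
  refine (add_le_add p1 ((Rand.Pr_exists_le _ _ _).trans p3)).trans ?_
  rw [← ENNReal.ofReal_add (by positivity) (by positivity)]
  exact ENNReal.ofReal_le_ofReal (by linarith)

end Problem

end

end CCDIM

namespace CCDIM

open scoped ENNReal

/-! ## Correctness of the two stages -/

noncomputable section

namespace Problem

variable {I : Problem}

theorem upperBound_mono {Ω Ω' : ℝ} (h : Ω ≤ Ω') (θ : ℕ) (δ : ℝ) :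
    upperBound Ω θ δ ≤ upperBound Ω' θ δ := by
  unfold upperBound
  gcongr

theorem upperBound_pos (Ω : ℝ) {θ : ℕ} (hθ : 0 < θ) {δ : ℝ} (hδ : 0 < δ) (hδ1 : δ < 1) :
    0 < upperBound Ω θ δ := by
  have h1 : 0 < Real.log (1 / δ) := Real.log_pos (by rw [lt_div_iff₀ hδ]; linarith)
  have h2 : (0 : ℝ) < θ := by exact_mod_cast hθ
  have h3 : 0 < √(Real.log (1 / δ) / 2) := Real.sqrt_pos.2 (by positivity)
  unfold upperBound
  positivity

/-- The collection underestimates the optimum. -/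
def Underestimates (T : Finset I.Node) (δu : ℝ) (Rs : List (GRR I)) : Prop :=
  upperBound (totalValue T Rs) Rs.length δu < I.objective T

/-- Samples with sentinel set B estimate f(T ∪ B), which is at least f(T): the error has the
harmless direction, so one statement serves both stages. -/
theorem underestimates_le (hn : 0 < I.n) (B T : Finset I.Node) {N : ℕ} (hN : 0 < N) {δ : ℝ}
    (hδ : 0 < δ) (hδ1 : δ ≤ 1) :
    (sampleMany B N).Pr (Underestimates T δ) ≤ ENNReal.ofReal δ := by
  classical
  refine le_trans (Rand.Pr_mono (Q := fun Rs => upperBound (totalValue T Rs) N δ < I.objective T)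
    fun Rs hRs h => ?_) (upperBound_tail B (value T) (value_bounds hn B T) (objective_nonneg T)
      ?_ hN hδ hδ1 _ fun Rs h => ⟨totalValue_nonneg T Rs, h⟩)
  · have := sampleMany_length hRs
    unfold Underestimates at h
    rwa [this] at h
  · rw [E_value]
    exact ENNReal.ofReal_le_ofReal (objective_mono Finset.subset_union_left)

/-- Since √t ≤ 1 and c > 1/2, the tolerance cε/√t is at least ε/2. A set that is not good is
therefore below the threshold of the acceptance test as well, and can pass only if a lower
confidence bound fails. -/
theorem not_good_lt {k : ℕ} {ε O : ℝ} (hε : 0 < ε) (hO : 0 ≤ O)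
    {S : Finset I.Node} (h : ¬ GoodSentinel k ε O S) :
    I.objective S < (sentinelRatio k S.card - ε / 2) * O := by
  simp only [GoodSentinel, not_or, not_le] at h
  obtain ⟨-, h2, h3⟩ := h
  refine h3.trans_le (mul_le_mul_of_nonneg_right ?_ hO)
  have hc := greedyConst_gt
  set t := contraction I.n k S.card (k - S.card)
  have ht0 : 0 < √t := Real.sqrt_pos.2 (lt_trans (by positivity) h2)
  have ht1 : √t ≤ 1 := Real.sqrt_le_one.2 (contraction_le_one _ _ _ _)
  have : ε / 2 ≤ greedyConst * ε / √t := by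
    rw [le_div_iff₀ ht0]
    calc ε / 2 * √t ≤ ε / 2 * 1 := by gcongr
      _ ≤ greedyConst * ε := by
        have := mul_le_mul_of_nonneg_right hc.le hε.le
        norm_num at this
        linarith
  linarith

/-- The set chosen in one iteration of the sentinel stage. -/
theorem chooseSentinel_greedy {k : ℕ} (hk : 1 ≤ k) (hkn : k ≤ I.n) {Rs : List (GRR I)}
    (hRs : ∀ R ∈ Rs, ValidGRR ∅ R) {l : List (Snapshot I)} (hl : l ∈ (greedy k k ∅ Rs).Supp)
    {ε₁ δl fu : ℝ} {θ b : ℕ} {S : Finset I.Node}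
    (h : (chooseSentinel k ε₁ δl fu θ l).val = (b, S)) :
    b = S.card ∧ S.card ≤ k ∧ ∀ T : Finset I.Node, T.card ≤ k →
      sentinelRatio k S.card * totalValue T Rs ≤ totalValue S Rs := by
  obtain ⟨hlen, hspec⟩ := greedy_spec hk hkn (S₀ := ∅) (by simpa using hkn) hRs hl
  rcases chooseSentinel_spec (k := k) (ε₁ := ε₁) (δl := δl) (fu := fu) (θ := θ) (l := l) with
    h1 | ⟨i, s, hi, h1⟩
  · rw [h1, Prod.mk.injEq] at h
    obtain ⟨rfl, rfl⟩ := h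
    refine ⟨rfl, by simp, fun T _ => ?_⟩
    have := totalValue_nonneg (I := I) ∅ Rs
    simpa [sentinelRatio] using this
  · rw [h1, Prod.mk.injEq] at h
    obtain ⟨rfl, rfl⟩ := h
    obtain ⟨-, g2, -, -, g5⟩ := hspec i s hi
    rw [Finset.card_empty, zero_add] at g2
    have hik : i ≤ k := by
      have := (List.getElem?_eq_some_iff.1 hi).1
      omega
    refine ⟨g2.symm, by omega, fun T hT => ?_⟩
    have h2 := g5 T hT (totalValue T Rs) (by rw [Finset.union_empty])
    rw [Finset.card_empty] at h2
    have h3 := contraction_le_pow (n := I.n) hk 0 i (by omega)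
    have h4 := totalValue_nonneg T Rs
    have h5 := totalValue_nonneg ∅ Rs
    have h6 : contraction I.n k 0 i * (totalValue T Rs - totalValue ∅ Rs)
        ≤ (1 - 1 / (k : ℝ)) ^ i * totalValue T Rs := by
      calc _ ≤ contraction I.n k 0 i * totalValue T Rs :=
            mul_le_mul_of_nonneg_left (by linarith) (contraction_nonneg _ _ _ _)
        _ ≤ _ := mul_le_mul_of_nonneg_right h3 h4
    rw [g2, sentinelRatio]
    linarith

/-- Each snapshot bounds the coverage of T, hence so does their minimum, and the confidence bound is
monotone in it. The denominator of every test is thus an upper bound for the optimum. -/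
theorem le_upperBound_greedy {k j : ℕ} (hk : 1 ≤ k) (hkn : k ≤ I.n) {S₀ : Finset I.Node}
    (hj : S₀.card + j ≤ I.n) {Rs : List (GRR I)} (hRs : ∀ R ∈ Rs, ValidGRR S₀ R)
    {l : List (Snapshot I)} (hl : l ∈ (greedy k j S₀ Rs).Supp) {T : Finset I.Node}
    (hT : T.card ≤ k) {δu : ℝ} (hu : ¬ Underestimates T δu Rs) :
    I.objective T ≤ upperBound (bestUb l).val Rs.length δu := by
  obtain ⟨hlen, hspec⟩ := greedy_spec hk hkn hj hRs hl
  refine (not_lt.1 hu).trans (upperBound_mono (bestUb_ge ?_ fun s hs => ?_) _ _)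
  · rintro rfl
    simp at hlen
  · obtain ⟨i, hi⟩ := List.mem_iff_getElem?.1 hs
    exact (hspec i s hi).ub T hT

open Classical in
/-- A set that passes the test, but whose value is too small, is unlikely. -/
theorem pass_le (hn : 0 < I.n) {A S : Finset I.Node} (hSA : S ⊆ A) {N : ℕ} (hN : 0 < N)
    {q fu O δl : ℝ} (hfu : 0 < fu) (hO0 : 0 ≤ O) (hO : O ≤ fu) (hδ : 0 < δl) (hδ1 : δl < 1)
    (hq : I.objective A < q * O) :
    (sampleMany S N).E (fun Rs => if q ≤ lowerBound (totalValue A Rs) N δl / fu then 1 else 0)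
      ≤ ENNReal.ofReal δl := by
  refine lowerBound_tail S (value A) (value_bounds hn S A) (objective_nonneg A) ?_ hN hδ hδ1 _
    fun Rs h => ⟨totalValue_nonneg A Rs, ?_⟩
  · rw [E_value, Finset.union_eq_left.2 hSA]
  · rw [le_div_iff₀ hfu] at h
    have h1 := objective_nonneg A
    have hq0 : 0 ≤ q := by
      by_contra hcon
      have := mul_nonpos_of_nonpos_of_nonneg (not_le.1 hcon).le hO0
      linarith
    exact hq.trans_le ((mul_le_mul_of_nonneg_left hO hq0).trans h)

theorem sampleMany_valid {B : Finset I.Node} {N : ℕ} {Rs : List (GRR I)}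
    (h : Rs ∈ (sampleMany B N).Supp) : ∀ R ∈ Rs, ValidGRR B R :=
  fun R hR => sampleGRR_valid (sampleMany_supp h R hR)

/-- One iteration of the sentinel stage. -/
theorem sentinelLoop_step (hn : 0 < I.n) {k : ℕ} (hk : 1 ≤ k) (hkn : k ≤ I.n) {ε δ : ℝ}
    (hε : 0 < ε) (hδ : 0 < δ) (hδ1 : δ < 1) {imax : ℕ} (hi : 1 ≤ imax) {T : Finset I.Node}
    (hT : T.card ≤ k) {t N : ℕ} (hN : 0 < N) {Rs : List (GRR I)}
    (hRs : Rs ∈ (sampleMany ∅ N).Supp) (S₀ : Finset I.Node) (Z : ℝ≥0∞)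
    (hZ : ∀ S : Finset I.Node, S.card ≤ k →
      sentinelRatio k S.card * totalValue T Rs ≤ totalValue S Rs →
      ((sampleMany ∅ N).E fun Rs' => (sentinelLoop k (ε / 2) δ imax t (Rs ++ Rs') S).Pr
        fun S => ¬ GoodSentinel k ε (I.objective T) S) ≤ Z)
    (hu : ¬ Underestimates T (δ / (3 * imax)) Rs) :
    (sentinelLoop k (ε / 2) δ imax (t + 1) Rs S₀).Pr
      (fun S => ¬ GoodSentinel k ε (I.objective T) S)
      ≤ ENNReal.ofReal (δ / (6 * imax)) + (ENNReal.ofReal (δ / (6 * imax)) + Z) := by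
  classical
  have hlen := sampleMany_length hRs
  have hvalid := sampleMany_valid hRs
  have hi' : (1 : ℝ) ≤ imax := by exact_mod_cast hi
  have hl0 : 0 < δ / (6 * imax) := by positivity
  have hl1 : δ / (6 * imax) < 1 := by rw [div_lt_one (by positivity)]; linarith
  have hu0 : 0 < δ / (3 * imax) := by positivity
  have hu1 : δ / (3 * imax) < 1 := by rw [div_lt_one (by positivity)]; linarith
  have hO0 := objective_nonneg T
  simp only [Rand.Pr, sentinelLoop, Rand.E_bind, Rand.E_tick, Rand.E_lift, hlen]
  refine Rand.E_le_const fun l hl => ?_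
  have hfu := le_upperBound_greedy hk hkn (by simpa using hkn) hvalid hl hT hu
  rw [hlen] at hfu
  set fu := upperBound (bestUb l).val N (δ / (3 * imax)) with hfu_def
  have hfu0 : 0 < fu := upperBound_pos _ hN hu0 hu1
  rcases hch : (chooseSentinel k (ε / 2) (δ / (6 * imax)) fu N l).val with ⟨b, S⟩
  obtain ⟨rfl, hSk, hSΩ⟩ := chooseSentinel_greedy hk hkn hvalid hl hch
  have hZS := hZ S hSk (hSΩ T hT)
  simp only [coverage_val]
  -- The set S depends on the first collection only, so it is fixed when the fresh test samples are
  -- drawn.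
  have hpass : ∀ M : ℕ, 0 < M → (sampleMany S M).E (fun R₂ =>
      if sentinelRatio k S.card - ε / 2 ≤ lowerBound (totalValue S R₂) M (δ / (6 * imax)) / fu
      then (if ¬ GoodSentinel k ε (I.objective T) S then 1 else 0) else 0)
      ≤ ENNReal.ofReal (δ / (6 * imax)) := by
    intro M hM
    by_cases hg : GoodSentinel k ε (I.objective T) S
    · simp [hg]
    · simp only [hg, not_false_eq_true, if_true]
      exact pass_le hn subset_rfl hM hfu0 hO0 hfu hl0 hl1 (not_good_lt hε hO0 hg)
  -- A union bound in place of conditioning: the second test is charged on its whole collection of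
  -- 4N fresh samples, regardless of the outcome of the first test.
  calc _ ≤ (sampleMany S N).E (fun R₂ =>
      (if sentinelRatio k S.card - ε / 2 ≤ lowerBound (totalValue S R₂) N (δ / (6 * imax)) / fu
        then (if ¬ GoodSentinel k ε (I.objective T) S then 1 else 0) else 0) +
      (sampleMany S (3 * N)).E (fun R₂' =>
      (if sentinelRatio k S.card - ε / 2
          ≤ lowerBound (totalValue S (R₂ ++ R₂')) (4 * N) (δ / (6 * imax)) / fu
        then (if ¬ GoodSentinel k ε (I.objective T) S then 1 else 0) else 0) + Z)) := by
        refine Rand.E_mono fun R₂ _ => ?_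
        by_cases h1 : sentinelRatio k S.card - ε / 2
            ≤ lowerBound (totalValue S R₂) N (δ / (6 * imax)) / fu
        · rw [if_pos h1, if_pos h1]
          rw [Rand.E_pure]
          refine le_trans (le_of_eq ?_) le_self_add
          congr
        · rw [if_neg h1, if_neg h1, zero_add]
          simp only [Rand.E_bind, Rand.E_lift, coverage_val]
          refine Rand.E_mono fun R₂' _ => ?_
          by_cases h2 : sentinelRatio k S.card - ε / 2
              ≤ lowerBound (totalValue S (R₂ ++ R₂')) (4 * N) (δ / (6 * imax)) / fu
          · rw [if_pos h2, if_pos h2]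
            rw [Rand.E_pure]
            refine le_trans (le_of_eq ?_) le_self_add
            congr
          · rw [if_neg h2, if_neg h2, zero_add]
            simp only [Rand.E_bind]
            exact hZS
    _ ≤ _ := by
      rw [Rand.E_add]
      refine add_le_add (hpass N hN) ?_
      simp only [Rand.E_add, Rand.E_const]
      refine add_le_add ?_ le_rfl
      rw [E_sampleMany_append S N (3 * N) (fun R => if sentinelRatio k S.card - ε / 2
          ≤ lowerBound (totalValue S R) (4 * N) (δ / (6 * imax)) / fu
        then (if ¬ GoodSentinel k ε (I.objective T) S then 1 else 0) else 0),
        show N + 3 * N = 4 * N by ring]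
      exact hpass (4 * N) (by omega)

/-- The failure probability of the sentinel stage. -/
theorem sentinelLoop_fail (hn : 0 < I.n) {k : ℕ} (hk : 1 ≤ k) (hkn : k ≤ I.n) {ε δ : ℝ}
    (hε : 0 < ε) (hδ : 0 < δ) (hδ1 : δ < 1) {imax : ℕ} (hi : 1 ≤ imax) {T : Finset I.Node}
    (hT : T.card ≤ k) (t : ℕ) {N : ℕ} (hN : 0 < N) (S₀ : Finset I.Node) :
    ((sampleMany ∅ N).E fun Rs => (sentinelLoop k (ε / 2) δ imax (t + 1) Rs S₀).Pr
        fun S => ¬ GoodSentinel k ε (I.objective T) S)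
      ≤ (t + 1 : ℕ) * ENNReal.ofReal (2 * δ / (3 * imax))
        + (sampleMany ∅ (N * 2 ^ t)).Pr (MisleadsSentinel k ε T) := by
  classical
  have hi' : (1 : ℝ) ≤ imax := by exact_mod_cast hi
  have hu0 : 0 < δ / (3 * imax) := by positivity
  have hu1 : δ / (3 * imax) ≤ 1 := by rw [div_le_one (by positivity)]; linarith
  -- Per iteration: one upper bound at level δ/(3·`imax`) and two tests at level δ/(6·`imax`).
  have hβ : ENNReal.ofReal (2 * δ / (3 * imax)) = ENNReal.ofReal (δ / (3 * imax))
      + (ENNReal.ofReal (δ / (6 * imax)) + ENNReal.ofReal (δ / (6 * imax))) := by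
    rw [← ENNReal.ofReal_add (by positivity) (by positivity),
      ← ENNReal.ofReal_add (by positivity) (by positivity)]
    congr 1
    field_simp
    ring
  have step : ∀ (t N : ℕ), 0 < N → ∀ (S₀ : Finset I.Node) (Z : List (GRR I) → ℝ≥0∞),
      (∀ Rs ∈ (sampleMany (I := I) ∅ N).Supp, ∀ S : Finset I.Node, S.card ≤ k →
        sentinelRatio k S.card * totalValue T Rs ≤ totalValue S Rs →
        ((sampleMany ∅ N).E fun Rs' => (sentinelLoop k (ε / 2) δ imax t (Rs ++ Rs') S).Pr
          fun S => ¬ GoodSentinel k ε (I.objective T) S) ≤ Z Rs) →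
      ((sampleMany ∅ N).E fun Rs => (sentinelLoop k (ε / 2) δ imax (t + 1) Rs S₀).Pr
        fun S => ¬ GoodSentinel k ε (I.objective T) S)
      ≤ ENNReal.ofReal (2 * δ / (3 * imax)) + (sampleMany ∅ N).E Z := by
    intro t N hN S₀ Z hZ
    calc _ ≤ (sampleMany ∅ N).E (fun Rs =>
          (if Underestimates T (δ / (3 * imax)) Rs then 1 else 0) +
          ((ENNReal.ofReal (δ / (6 * imax)) + ENNReal.ofReal (δ / (6 * imax))) + Z Rs)) := by
          refine Rand.E_mono fun Rs hRs => ?_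
          split_ifs with hu
          · exact (Rand.Pr_le_one _ _).trans le_self_add
          · rw [zero_add, add_assoc]
            exact sentinelLoop_step hn hk hkn hε hδ hδ1 hi hT hN hRs S₀ (Z Rs) (hZ Rs hRs) hu
      _ ≤ _ := by
        simp only [Rand.E_add, Rand.E_const]
        rw [hβ, ← add_assoc]
        gcongr
        exact underestimates_le hn ∅ T hN hu0 hu1
  induction t generalizing N S₀ with
  | zero =>
    refine (step 0 N hN S₀ (fun Rs => if MisleadsSentinel k ε T Rs then 1 else 0) ?_).trans ?_
    · intro Rs _ S hSk hSΩ
      simp only [sentinelLoop, Rand.Pr, Rand.E_pure, Rand.E_const]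
      by_cases h1 : GoodSentinel k ε (I.objective T) S
      · simp [h1]
      · rw [if_pos (show MisleadsSentinel k ε T Rs from ⟨S, hSk, h1, hSΩ⟩), if_pos h1]
    · simp [Rand.Pr]
  | succ t ih =>
    -- With rounds left, the loop discards the set carried over from the previous iteration, so this
    -- set may be replaced by ∅ definitionally. The two collections then merge into one of size 2N.
    refine (step (t + 1) N hN S₀ (fun Rs => (sampleMany ∅ N).E fun Rs' =>
      (sentinelLoop k (ε / 2) δ imax (t + 1) (Rs ++ Rs') ∅).Pr
        fun S => ¬ GoodSentinel k ε (I.objective T) S) fun Rs _ S _ _ => le_rfl).trans ?_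
    rw [E_sampleMany_append ∅ N N (fun Rs => (sentinelLoop k (ε / 2) δ imax (t + 1) Rs ∅).Pr
        fun S => ¬ GoodSentinel k ε (I.objective T) S)]
    refine (add_le_add le_rfl (ih (N := N + N) (by omega) ∅)).trans (le_of_eq ?_)
    rw [show (N + N) * 2 ^ t = N * 2 ^ (t + 1) by ring]
    push_cast
    ring

theorem sentinelLoop_card {k : ℕ} (hk : 1 ≤ k) (hkn : k ≤ I.n) {ε₁ δ : ℝ} {imax : ℕ} (t : ℕ)
    (Rs : List (GRR I)) (hRs : ∀ R ∈ Rs, ValidGRR ∅ R) (S₀ : Finset I.Node) (hS₀ : S₀.card ≤ k) :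
    ∀ S ∈ (sentinelLoop k ε₁ δ imax t Rs S₀).Supp, S.card ≤ k := by
  induction t generalizing Rs S₀ with
  | zero =>
    intro S hS
    rw [sentinelLoop, Rand.mem_Supp_pure] at hS
    rwa [hS]
  | succ t ih =>
    intro S hS
    simp only [sentinelLoop, Rand.mem_Supp_bind, Rand.mem_Supp_tick, Rand.mem_Supp_lift] at hS
    obtain ⟨_, _, l, hl, _, rfl, _, rfl, hS⟩ := hS
    rcases hch : (chooseSentinel k ε₁ (δ / (6 * imax))
      (upperBound (bestUb l).val Rs.length (δ / (3 * imax))) Rs.length l).val with ⟨b, S'⟩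
    rw [hch] at hS
    obtain ⟨-, hSk, -⟩ := chooseSentinel_greedy hk hkn hRs hl hch
    obtain ⟨R₂, _, _, rfl, hS⟩ := hS
    split_ifs at hS with h1
    · rw [Rand.mem_Supp_pure] at hS
      rwa [hS]
    · simp only [Rand.mem_Supp_bind, Rand.mem_Supp_lift] at hS
      obtain ⟨R₂', _, _, rfl, hS⟩ := hS
      split_ifs at hS with h2
      · rw [Rand.mem_Supp_pure] at hS
        rwa [hS]
      · simp only [Rand.mem_Supp_bind] at hS
        obtain ⟨R₁', hR₁', hS⟩ := hS
        refine ih (Rs ++ R₁') (fun R hR => ?_) S' hSk S hS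
        rcases List.mem_append.1 hR with hR | hR
        exacts [hRs R hR, sampleMany_valid hR₁' R hR]

/-! ### The remaining-set stage -/

/-- The set selected in one iteration of the remaining-set stage. -/
theorem greedy_last {k : ℕ} (hk : 1 ≤ k) (hkn : k ≤ I.n) {S : Finset I.Node} (hS : S.card ≤ k)
    {Rs : List (GRR I)} (hRs : ∀ R ∈ Rs, ValidGRR S R) {l : List (Snapshot I)}
    (hl : l ∈ (greedy k (k - S.card) S Rs).Supp) :
    ∃ Sk, (l.getLast?.map Snapshot.S).getD S = Sk ∧ S ⊆ Sk ∧ Sk.card = k ∧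
      ∀ T : Finset I.Node, T.card ≤ k → totalValue (T ∪ S) Rs - totalValue Sk Rs
        ≤ contraction I.n k S.card (k - S.card) * (totalValue (T ∪ S) Rs - totalValue S Rs) := by
  obtain ⟨hlen, hspec⟩ := greedy_spec hk hkn (by omega) hRs hl
  have hlt : k - S.card < l.length := by omega
  have hget : l[k - S.card]? = some l[k - S.card] := List.getElem?_eq_getElem hlt
  obtain ⟨g1, g2, -, -, g5⟩ := hspec _ _ hget
  refine ⟨l[k - S.card].S, ?_, g1, by omega, fun T hT => g5 T hT _ le_rfl⟩
  rw [List.getLast?_eq_getElem?, show l.length - 1 = k - S.card by omega, hget]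
  rfl

/-- The carried set is returned only when no round is left, hence the conditional hypothesis; it
lets the loop start from ∅. -/
theorem remainingLoop_card {k : ℕ} (hk : 1 ≤ k) (hkn : k ≤ I.n) {S : Finset I.Node}
    (hS : S.card ≤ k) {ε δ : ℝ} {imax : ℕ} (t : ℕ) (Rs Rs₂ : List (GRR I))
    (hRs : ∀ R ∈ Rs, ValidGRR S R) (T₀ : Finset I.Node) (hT₀ : t = 0 → (S ∪ T₀).card = k) :
    ∀ T ∈ (remainingLoop k S ε δ imax t Rs Rs₂ T₀).Supp, (S ∪ T).card = k := by
  induction t generalizing Rs Rs₂ T₀ with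
  | zero =>
    intro T hT
    rw [remainingLoop, Rand.mem_Supp_pure] at hT
    rw [hT]
    exact hT₀ rfl
  | succ t ih =>
    intro T hT
    simp only [remainingLoop, Rand.mem_Supp_bind, Rand.mem_Supp_tick, Rand.mem_Supp_lift] at hT
    obtain ⟨_, _, l, hl, _, rfl, _, rfl, hT⟩ := hT
    obtain ⟨Sk, hSk, h1, h2, -⟩ := greedy_last hk hkn hS hRs hl
    rw [hSk] at hT
    have hcard : (S ∪ Sk \ S).card = k := by rw [Finset.union_sdiff_of_subset h1, h2]
    split_ifs at hT
    · rw [Rand.mem_Supp_pure] at hT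
      rw [hT, hcard]
    · simp only [Rand.mem_Supp_bind] at hT
      obtain ⟨R₁', hR₁', R₂', hR₂', hT⟩ := hT
      refine ih (Rs ++ R₁') (Rs₂ ++ R₂') (fun R hR => ?_) (Sk \ S) (fun _ => hcard) T hT
      rcases List.mem_append.1 hR with hR | hR
      exacts [hRs R hR, sampleMany_valid hR₁' R hR]

/-- One iteration of the remaining-set stage. -/
theorem remainingLoop_step (hn : 0 < I.n) {k : ℕ} (hk : 1 ≤ k) (hkn : k ≤ I.n)
    {S : Finset I.Node} (hS : S.card ≤ k) {ε δ : ℝ} (hδ : 0 < δ) (hδ1 : δ < 1) {imax : ℕ}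
    (hi : 1 ≤ imax) {T : Finset I.Node} (hT : T.card ≤ k) {t N : ℕ} (hN : 0 < N)
    {Rs : List (GRR I)} (hRs : Rs ∈ (sampleMany S N).Supp) (T₀ : Finset I.Node) (Z : ℝ≥0∞)
    (hZ : ∀ Sk : Finset I.Node, S ⊆ Sk → Sk.card = k →
      totalValue (T ∪ S) Rs - totalValue Sk Rs
        ≤ contraction I.n k S.card (k - S.card) * (totalValue (T ∪ S) Rs - totalValue S Rs) →
      ((sampleMany S N).E fun Rs₂ => (sampleMany S N).E fun Rs' => (sampleMany S N).E fun Rs₂' =>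
        (remainingLoop k S ε δ imax t (Rs ++ Rs') (Rs₂ ++ Rs₂') (Sk \ S)).Pr
        fun A => I.objective (S ∪ A) < (greedyConst - ε) * I.objective T) ≤ Z)
    (hu : ¬ Underestimates T (δ / (3 * imax)) Rs) :
    ((sampleMany S N).E fun Rs₂ => (remainingLoop k S ε δ imax (t + 1) Rs Rs₂ T₀).Pr
      fun A => I.objective (S ∪ A) < (greedyConst - ε) * I.objective T)
      ≤ ENNReal.ofReal (δ / (3 * imax)) + Z := by
  classical
  have hlen := sampleMany_length hRs
  have hvalid := sampleMany_valid hRs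
  have hi' : (1 : ℝ) ≤ imax := by exact_mod_cast hi
  have hu0 : 0 < δ / (3 * imax) := by positivity
  have hu1 : δ / (3 * imax) < 1 := by rw [div_lt_one (by positivity)]; linarith
  have hO0 := objective_nonneg T
  simp only [Rand.Pr, remainingLoop, Rand.E_bind, Rand.E_tick, Rand.E_lift, coverage_val]
  -- Greedy runs on the first collection alone. Exchanging the order fixes its output before the
  -- validation collection is drawn.
  rw [Rand.E_comm]
  refine Rand.E_le_const fun l hl => ?_
  have hfu := le_upperBound_greedy hk hkn (by omega) hvalid hl hT hu
  rw [hlen] at hfu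
  obtain ⟨Sk, hSk, h1, h2, h3⟩ := greedy_last hk hkn hS hvalid hl
  simp only [hSk, hlen]
  set fu := upperBound (bestUb l).val N (δ / (3 * imax)) with hfu_def
  have hfu0 : 0 < fu := upperBound_pos _ hN hu0 hu1
  have hZS := hZ Sk h1 h2 (h3 T hT)
  have hunion : S ∪ Sk \ S = Sk := Finset.union_sdiff_of_subset h1
  calc _ ≤ (sampleMany S N).E (fun Rs₂ =>
      (if 1 - 1 / Real.exp 1 - ε ≤ lowerBound (totalValue Sk Rs₂) N (δ / (3 * imax)) / fu
        then (if I.objective Sk < (greedyConst - ε) * I.objective T then 1 else 0) else 0) +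
      (sampleMany S N).E fun Rs' => (sampleMany S N).E fun Rs₂' =>
        (remainingLoop k S ε δ imax t (Rs ++ Rs') (Rs₂ ++ Rs₂') (Sk \ S)).Pr
        fun A => I.objective (S ∪ A) < (greedyConst - ε) * I.objective T) := by
        refine Rand.E_mono fun Rs₂ hRs₂ => ?_
        rw [sampleMany_length hRs₂]
        split_ifs with h4 h5
        · simp only [Rand.E_pure, hunion, if_pos h5]
          exact le_self_add
        · simp only [Rand.E_pure, hunion, if_neg h5]
          exact zero_le
        · rw [zero_add]
          simp only [Rand.E_bind]
          exact le_rfl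
    _ ≤ _ := by
      rw [Rand.E_add]
      refine add_le_add ?_ hZS
      by_cases hg : I.objective Sk < (greedyConst - ε) * I.objective T
      · simp only [hg, if_true]
        exact pass_le hn h1 hN hfu0 hO0 hfu hu0 hu1 hg
      · simp [hg]

/-- The failure probability of the remaining-set stage. -/
theorem remainingLoop_fail (hn : 0 < I.n) {k : ℕ} (hk : 1 ≤ k) (hkn : k ≤ I.n)
    {S : Finset I.Node} (hS : S.card ≤ k) {ε δ : ℝ} (hδ : 0 < δ) (hδ1 : δ < 1) {imax : ℕ}
    (hi : 1 ≤ imax) {T : Finset I.Node} (hT : T.card ≤ k) (t : ℕ) {N : ℕ} (hN : 0 < N)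
    (T₀ : Finset I.Node) :
    ((sampleMany S N).E fun Rs => (sampleMany S N).E fun Rs₂ =>
      (remainingLoop k S ε δ imax (t + 1) Rs Rs₂ T₀).Pr
        fun A => I.objective (S ∪ A) < (greedyConst - ε) * I.objective T)
      ≤ (t + 1 : ℕ) * ENNReal.ofReal (2 * δ / (3 * imax))
        + (sampleMany S (N * 2 ^ t)).Pr (MisleadsRemaining k ε T S) := by
  classical
  have hi' : (1 : ℝ) ≤ imax := by exact_mod_cast hi
  have hu0 : 0 < δ / (3 * imax) := by positivity
  have hu1 : δ / (3 * imax) ≤ 1 := by rw [div_le_one (by positivity)]; linarith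
  have hβ : ENNReal.ofReal (2 * δ / (3 * imax)) = ENNReal.ofReal (δ / (3 * imax))
      + ENNReal.ofReal (δ / (3 * imax)) := by
    rw [← ENNReal.ofReal_add (by positivity) (by positivity)]
    congr 1
    ring
  have step : ∀ (t N : ℕ), 0 < N → ∀ (T₀ : Finset I.Node) (Z : List (GRR I) → ℝ≥0∞),
      (∀ Rs ∈ (sampleMany S N).Supp, ∀ Sk : Finset I.Node, S ⊆ Sk → Sk.card = k →
        totalValue (T ∪ S) Rs - totalValue Sk Rs
          ≤ contraction I.n k S.card (k - S.card) * (totalValue (T ∪ S) Rs - totalValue S Rs) →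
        ((sampleMany S N).E fun Rs₂ => (sampleMany S N).E fun Rs' =>
          (sampleMany S N).E fun Rs₂' =>
          (remainingLoop k S ε δ imax t (Rs ++ Rs') (Rs₂ ++ Rs₂') (Sk \ S)).Pr
          fun A => I.objective (S ∪ A) < (greedyConst - ε) * I.objective T) ≤ Z Rs) →
      ((sampleMany S N).E fun Rs => (sampleMany S N).E fun Rs₂ =>
        (remainingLoop k S ε δ imax (t + 1) Rs Rs₂ T₀).Pr
        fun A => I.objective (S ∪ A) < (greedyConst - ε) * I.objective T)
      ≤ ENNReal.ofReal (2 * δ / (3 * imax)) + (sampleMany S N).E Z := by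
    intro t N hN T₀ Z hZ
    calc _ ≤ (sampleMany S N).E (fun Rs =>
          (if Underestimates T (δ / (3 * imax)) Rs then 1 else 0) +
          (ENNReal.ofReal (δ / (3 * imax)) + Z Rs)) := by
          refine Rand.E_mono fun Rs hRs => ?_
          split_ifs with hu
          · exact (Rand.E_le_const fun _ _ => Rand.Pr_le_one _ _).trans le_self_add
          · rw [zero_add]
            exact remainingLoop_step hn hk hkn hS hδ hδ1 hi hT hN hRs T₀ (Z Rs) (hZ Rs hRs) hu
      _ ≤ _ := by
        simp only [Rand.E_add, Rand.E_const]
        rw [hβ, ← add_assoc]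
        gcongr
        exact underestimates_le hn S T hN hu0 hu1
  induction t generalizing N T₀ with
  | zero =>
    refine (step 0 N hN T₀ (fun Rs => if MisleadsRemaining k ε T S Rs then 1 else 0) ?_).trans ?_
    · intro Rs _ Sk h1 h2 h3
      simp only [remainingLoop, Rand.Pr, Rand.E_pure, Rand.E_const,
        Finset.union_sdiff_of_subset h1]
      split_ifs with h4 h5 h5
      · exact le_rfl
      · exact absurd ⟨Sk, h1, h2, h4, h3⟩ h5
      · exact zero_le
      · exact le_rfl
    · simp [Rand.Pr]
  | succ t ih =>
    set ψ : List (GRR I) → List (GRR I) → ℝ≥0∞ := fun Rs Rs₂ =>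
      (remainingLoop k S ε δ imax (t + 1) Rs Rs₂ ∅).Pr
        fun A => I.objective (S ∪ A) < (greedyConst - ε) * I.objective T with hψ
    refine (step (t + 1) N hN T₀ (fun Rs => (sampleMany S N).E fun Rs' =>
      (sampleMany S (N + N)).E fun Rs₂ => ψ (Rs ++ Rs') Rs₂) fun Rs _ Sk _ _ _ => ?_).trans ?_
    -- Brings the old and the new half of the validation collection next to each other, so that they
    -- merge into one collection of size 2N, independent of the first.
    · rw [Rand.E_comm]
      refine Rand.E_mono fun Rs' _ => ?_
      rw [← E_sampleMany_append]
      exact le_rfl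
    · rw [E_sampleMany_append S N N (fun Rs => (sampleMany S (N + N)).E fun Rs₂ => ψ Rs Rs₂)]
      refine (add_le_add le_rfl (ih (N := N + N) (by omega) ∅)).trans (le_of_eq ?_)
      rw [show (N + N) * 2 ^ t = N * 2 ^ (t + 1) by ring]
      push_cast
      ring

end Problem

end

end CCDIM

namespace CCDIM

open scoped ENNReal

/-! ## The approximation guarantee -/

noncomputable section

namespace Problem

variable {I : Problem}

/-- Rounding up the logarithm overshoots by less than a factor 2. The last collection, of half the
size θ·2^imax, therefore has at least θ_max/2 samples, while the total work stays proportional to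
θ_max. -/
theorem iMax_spec {θmax : ℝ} {θ : ℕ} (h0 : 0 < θ) (h : (θ : ℝ) < θmax) :
    1 ≤ iMax θmax θ ∧ θmax ≤ θ * 2 ^ iMax θmax θ ∧ θ * 2 ^ iMax θmax θ ≤ 2 * θmax := by
  have hθ : (0 : ℝ) < θ := by exact_mod_cast h0
  have hx : 1 < θmax / θ := by rwa [one_lt_div hθ]
  have hx0 : 0 < θmax / θ := by linarith
  have hlog : 0 < Real.logb 2 (θmax / θ) := Real.logb_pos (by norm_num) hx
  refine ⟨Nat.one_le_iff_ne_zero.2 (Nat.ceil_pos.2 hlog).ne', ?_, ?_⟩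
  · have h1 : Real.logb 2 (θmax / θ) ≤ (iMax θmax θ : ℕ) := Nat.le_ceil _
    rw [Real.logb_le_iff_le_rpow (by norm_num) hx0, Real.rpow_natCast, div_le_iff₀ hθ] at h1
    linarith
  · have h1 : (iMax θmax θ : ℝ) < Real.logb 2 (θmax / θ) + 1 := Nat.ceil_lt_add_one hlog.le
    have h2 : (2 : ℝ) ^ iMax θmax θ ≤ 2 * (θmax / θ) := by
      rw [← Real.rpow_natCast]
      calc (2 : ℝ) ^ (iMax θmax θ : ℝ) ≤ 2 ^ (Real.logb 2 (θmax / θ) + 1) :=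
            Real.rpow_le_rpow_of_exponent_le (by norm_num) h1.le
        _ = 2 * (θmax / θ) := by
          rw [Real.rpow_add (by norm_num), Real.rpow_logb (by norm_num) (by norm_num) hx0]
          ring
    calc (θ : ℝ) * 2 ^ iMax θmax θ ≤ θ * (2 * (θmax / θ)) := by gcongr
      _ = 2 * θmax := by field_simp

theorem thetaInit_pos {δ : ℝ} (hδ : 0 < δ) (hδ1 : δ < 1) : 0 < thetaInit δ := by
  have : 0 < Real.log (1 / δ) := Real.log_pos (by rw [lt_div_iff₀ hδ]; linarith)
  exact Nat.ceil_pos.2 (by positivity)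

/-- Together with `eight_mul_le` this keeps the initial sample size below the maximum, so that both
loops run at least once. -/
theorem thetaInit_lt {δ c : ℝ} (hδ : 0 < δ) (hδ1 : δ < 1) (hc : 6 ≤ c) :
    (thetaInit δ : ℝ) < 8 * Real.log (c / δ) := by
  have h0 : 0 < Real.log (1 / δ) := Real.log_pos (by rw [lt_div_iff₀ hδ]; linarith)
  have h1 : (thetaInit δ : ℝ) < 3 * Real.log (1 / δ) + 1 := Nat.ceil_lt_add_one (by positivity)
  have h2 : Real.log (c / δ) = Real.log c + Real.log (1 / δ) := by
    rw [← Real.log_mul (by positivity) (by positivity)]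
    congr 1
    ring
  have h3 : 1 ≤ Real.log c := by
    rw [Real.le_log_iff_exp_le (by linarith)]
    linarith [Real.exp_one_lt_d9]
  linarith

theorem eight_mul_le {a b ε f : ℝ} (ha : 0 ≤ a) (hε : 0 < ε) (hε1 : ε < 1) (hf : 0 < f)
    (hf1 : f ≤ 1) : 8 * a ≤ 2 * (√a + √b) ^ 2 / ((ε / 2) ^ 2 * f) := by
  rw [le_div_iff₀ (by positivity)]
  have h1 : a ≤ (√a + √b) ^ 2 := by
    nlinarith [Real.sq_sqrt ha, Real.sqrt_nonneg a, Real.sqrt_nonneg b,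
      mul_nonneg (Real.sqrt_nonneg a) (Real.sqrt_nonneg b)]
  have h2 : (ε / 2) ^ 2 * f ≤ 1 / 4 := by
    calc (ε / 2) ^ 2 * f ≤ (1 / 2) ^ 2 * 1 := by gcongr
      _ = 1 / 4 := by norm_num
  calc 8 * a * ((ε / 2) ^ 2 * f) ≤ 8 * a * (1 / 4) := by gcongr
    _ ≤ 2 * (√a + √b) ^ 2 := by linarith

theorem thetaInit_lt_thetaMaxSentinel (hn : 0 < I.n) {k : ℕ} (hk : 1 ≤ k) (hkn : k ≤ I.n)
    {ε δ : ℝ} (hε : 0 < ε) (hε1 : ε < 1) (hδ : 0 < δ) (hδ1 : δ < 1) :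
    (thetaInit δ : ℝ) < I.thetaMaxSentinel k (ε / 2) δ := by
  refine (thetaInit_lt hδ hδ1 le_rfl).trans_le ?_
  exact eight_mul_le (Real.log_nonneg (by rw [le_div_iff₀ hδ]; linarith)) hε hε1
    (fmin_pos hn hk) (fmin_le_one hn hkn)

theorem thetaInit_lt_thetaMaxRemaining (hn : 0 < I.n) {k : ℕ} (hk : 1 ≤ k) (hkn : k ≤ I.n)
    (b : ℕ) {ε δ : ℝ} (hε : 0 < ε) (hε1 : ε < 1) (hδ : 0 < δ) (hδ1 : δ < 1) :
    (thetaInit δ : ℝ) < I.thetaMaxRemaining k b (ε / 2) δ := by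
  refine (thetaInit_lt hδ hδ1 (c := 9) (by norm_num)).trans_le ?_
  exact eight_mul_le (Real.log_nonneg (by rw [le_div_iff₀ hδ]; linarith)) hε hε1
    (fmin_pos hn hk) (fmin_le_one hn hkn)

theorem ofReal_two_thirds {δ : ℝ} (hδ : 0 < δ) {i : ℕ} (hi : 1 ≤ i) :
    (i : ℝ≥0∞) * ENNReal.ofReal (2 * δ / (3 * i)) = ENNReal.ofReal (2 / 3 * δ) := by
  have hi' : (1 : ℝ) ≤ i := by exact_mod_cast hi
  rw [← ENNReal.ofReal_natCast, ← ENNReal.ofReal_mul (by positivity)]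
  congr 1
  field_simp

/-- The constant 7/8 is 2/3 for failing confidence bounds plus 5/24 for a misleading last
collection. -/
theorem sentinelSet_fail (hn : 0 < I.n) {k : ℕ} (hk : 1 ≤ k) (hkn : k ≤ I.n) {ε δ : ℝ}
    (hε : 0 < ε) (hε1 : ε < 1) (hδ : 0 < δ) (hδ2 : δ ≤ 1 / 2) {T : Finset I.Node}
    (hT : T.card ≤ k) (hfm : I.fmin k ≤ greedyConst * I.objective T) :
    (I.sentinelSet k (ε / 2) δ).Pr (fun S => ¬ GoodSentinel k ε (I.objective T) S)
      ≤ ENNReal.ofReal (7 / 8 * δ) := by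
  have hδ1 : δ < 1 := by linarith
  have hθ := thetaInit_pos hδ hδ1
  obtain ⟨h1, h2, -⟩ := iMax_spec hθ (thetaInit_lt_thetaMaxSentinel hn hk hkn hε hε1 hδ hδ1)
  simp only [Rand.Pr, sentinelSet, Rand.E_bind, Rand.E_tick]
  have hθ2 := ofReal_two_thirds hδ h1
  generalize iMax (I.thetaMaxSentinel k (ε / 2) δ) (thetaInit δ) = i at *
  obtain ⟨t, rfl⟩ : ∃ t, i = t + 1 := ⟨i - 1, by omega⟩
  refine (sentinelLoop_fail hn hk hkn hε hδ hδ1 h1 hT t hθ ∅).trans ?_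
  rw [hθ2]
  refine (add_le_add le_rfl (misleadsSentinel_le hn hk hkn hε hδ hδ2 hfm ?_)).trans ?_
  · push_cast
    rw [pow_succ] at h2
    linarith
  · rw [← ENNReal.ofReal_add (by positivity) (by positivity)]
    exact ENNReal.ofReal_le_ofReal (by linarith)

theorem sentinelSet_card {k : ℕ} (hk : 1 ≤ k) (hkn : k ≤ I.n) {ε₁ δ : ℝ} :
    ∀ S ∈ (I.sentinelSet k ε₁ δ).Supp, S.card ≤ k := by
  intro S hS
  simp only [sentinelSet, Rand.mem_Supp_bind, Rand.mem_Supp_tick] at hS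
  obtain ⟨_, _, Rs, hRs, hS⟩ := hS
  exact sentinelLoop_card hk hkn _ Rs (sampleMany_valid hRs) ∅ (by simp) S hS

/-- The constant 8/9 is 2/3 for failing confidence bounds plus 2/9 for a misleading last collection.
-/
theorem remainingSet_fail (hn : 0 < I.n) {k : ℕ} (hk : 1 ≤ k) (hkn : k ≤ I.n) {ε δ : ℝ}
    (hε : 0 < ε) (hε1 : ε < 1) (hδ : 0 < δ) (hδ2 : δ ≤ 1 / 2) {T : Finset I.Node}
    (hT : T.card ≤ k) (hfm : I.fmin k ≤ greedyConst * I.objective T) {S : Finset I.Node}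
    (hS : S.card ≤ k) (hgood : GoodSentinel k ε (I.objective T) S) :
    (I.remainingSet k S ε (ε / 2) δ).Pr
      (fun A => I.objective (S ∪ A) < (greedyConst - ε) * I.objective T)
      ≤ ENNReal.ofReal (8 / 9 * δ) := by
  have hδ1 : δ < 1 := by linarith
  have hθ := thetaInit_pos hδ hδ1
  obtain ⟨h1, h2, -⟩ :=
    iMax_spec hθ (thetaInit_lt_thetaMaxRemaining hn hk hkn S.card hε hε1 hδ hδ1)
  simp only [Rand.Pr, remainingSet, Rand.E_bind, Rand.E_tick]
  have hθ2 := ofReal_two_thirds hδ h1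
  generalize iMax (I.thetaMaxRemaining k S.card (ε / 2) δ) (thetaInit δ) = i at *
  obtain ⟨t, rfl⟩ : ∃ t, i = t + 1 := ⟨i - 1, by omega⟩
  refine (remainingLoop_fail hn hk hkn hS hδ hδ1 h1 hT t hθ ∅).trans ?_
  rw [hθ2]
  refine (add_le_add le_rfl (misleadsRemaining_le hn hk hkn hε hε1 hδ hδ2 hfm hS hgood ?_)).trans ?_
  · push_cast
    rw [pow_succ] at h2
    linarith
  · rw [← ENNReal.ofReal_add (by positivity) (by positivity)]
    exact ENNReal.ofReal_le_ofReal (by linarith)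

theorem remainingSet_card (hn : 0 < I.n) {k : ℕ} (hk : 1 ≤ k) (hkn : k ≤ I.n) {ε δ : ℝ}
    (hε : 0 < ε) (hε1 : ε < 1) (hδ : 0 < δ) (hδ1 : δ < 1) {S : Finset I.Node} (hS : S.card ≤ k) :
    ∀ T ∈ (I.remainingSet k S ε (ε / 2) δ).Supp, (S ∪ T).card = k := by
  intro T hT
  obtain ⟨h1, -, -⟩ := iMax_spec (thetaInit_pos hδ hδ1)
    (thetaInit_lt_thetaMaxRemaining hn hk hkn S.card hε hε1 hδ hδ1)
  simp only [remainingSet, Rand.mem_Supp_bind, Rand.mem_Supp_tick] at hT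
  obtain ⟨_, _, Rs, hRs, Rs₂, _, hT⟩ := hT
  exact remainingLoop_card hk hkn hS _ Rs Rs₂ (sampleMany_valid hRs) ∅ (by omega) T hT

theorem gHist_card (hn : 0 < I.n) {k : ℕ} (hk : 1 ≤ k) (hkn : k ≤ I.n) {ε δ : ℝ}
    (hε : 0 < ε) (hε1 : ε < 1) (hδ : 0 < δ) (hδ1 : δ < 1) :
    ∀ A ∈ (I.gHist k ε δ).Supp, A.card = k := by
  intro A hA
  simp only [gHist, Rand.mem_Supp_bind, Rand.mem_Supp_tick, Rand.mem_Supp_pure] at hA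
  obtain ⟨S, hS, T, hT, _, _, rfl⟩ := hA
  exact remainingSet_card hn hk hkn hε hε1 (by linarith) (by linarith)
    (sentinelSet_card hk hkn S hS) T hT

theorem isApproxSolution_of_le {k : ℕ} {ε : ℝ} {T A : Finset I.Node}
    (hmax : ∀ T' : Finset I.Node, T'.card ≤ k → I.objective T' ≤ I.objective T)
    (hA : A.card = k) (h : (greedyConst - ε) * I.objective T ≤ I.objective A) :
    I.IsApproxSolution k (1 - 1 / Real.exp 1 - ε) A := by
  refine ⟨hA.le, fun T' hT' => ?_⟩
  change (greedyConst - ε) * I.objective T' ≤ I.objective A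
  by_cases hc : 0 ≤ greedyConst - ε
  · exact (mul_le_mul_of_nonneg_left (hmax T' hT') hc).trans h
  · exact (mul_nonpos_of_nonpos_of_nonneg (not_le.1 hc).le (objective_nonneg T')).trans
      (objective_nonneg A)

/-- G-HIST fails with probability at most `δ`. -/
theorem gHist_fail (hn : 0 < I.n) {k : ℕ} (hk : 1 ≤ k) (hkn : k ≤ I.n) {ε δ : ℝ}
    (hε : 0 < ε) (hε1 : ε < 1) (hδ : 0 < δ) (hδ1 : δ < 1) :
    (I.gHist k ε δ).Pr (fun A => ¬ I.IsApproxSolution k (1 - 1 / Real.exp 1 - ε) A)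
      ≤ ENNReal.ofReal δ := by
  classical
  obtain ⟨T, hTm, hT⟩ := Finset.exists_max_image
    (Finset.univ.filter fun T : Finset I.Node => T.card ≤ k) I.objective ⟨∅, by simp⟩
  simp only [Finset.mem_filter, Finset.mem_univ, true_and] at hTm hT
  have hO := objective_nonneg T
  -- In the opposite case every k-set is worth at least `fmin` > cO, and the output, having exactly
  -- k nodes, succeeds with certainty.
  by_cases hfm : I.fmin k ≤ greedyConst * I.objective T
  · have hd2 : δ / 2 ≤ 1 / 2 := by linarith
    calc _ ≤ (I.gHist k ε δ).Pr
          (fun A => I.objective A < (greedyConst - ε) * I.objective T) := by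
          refine Rand.Pr_mono fun A hA hbad => ?_
          by_contra hcon
          exact hbad (isApproxSolution_of_le hT (gHist_card hn hk hkn hε hε1 hδ hδ1 A hA)
            (not_lt.1 hcon))
      _ ≤ (I.sentinelSet k (ε / 2) (δ / 2)).E (fun S =>
          (if ¬ GoodSentinel k ε (I.objective T) S then 1 else 0)
            + ENNReal.ofReal (8 / 9 * (δ / 2))) := by
          simp only [Rand.Pr, gHist, Rand.E_bind, Rand.E_tick, Rand.E_pure]
          refine Rand.E_mono fun S hS => ?_
          by_cases hg : GoodSentinel k ε (I.objective T) S
          · rw [if_neg (not_not.2 hg), zero_add]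
            exact remainingSet_fail hn hk hkn hε hε1 (by linarith) hd2 hTm hfm
              (sentinelSet_card hk hkn S hS) hg
          · rw [if_pos hg]
            exact (Rand.Pr_le_one _ _).trans le_self_add
      _ ≤ ENNReal.ofReal (7 / 8 * (δ / 2)) + ENNReal.ofReal (8 / 9 * (δ / 2)) := by
          rw [Rand.E_add, Rand.E_const]
          refine add_le_add (le_trans (le_of_eq ?_)
            (sentinelSet_fail hn hk hkn hε hε1 (by linarith) hd2 hTm hfm)) le_rfl
          unfold Rand.Pr
          congr!
      _ ≤ ENNReal.ofReal δ := by
          rw [← ENNReal.ofReal_add (by positivity) (by positivity)]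
          exact ENNReal.ofReal_le_ofReal (by linarith)
  · refine le_trans (le_of_eq ?_) zero_le
    rw [← Rand.E_const (I.gHist k ε δ) 0]
    refine Rand.E_congr fun A hA => if_neg (not_not.2 ?_)
    have hAk := gHist_card hn hk hkn hε hε1 hδ hδ1 A hA
    refine isApproxSolution_of_le hT hAk ?_
    have h1 := fmin_le_objective hn hAk
    nlinarith [mul_nonneg hε.le hO, not_le.1 hfm]

end Problem

end

end CCDIM

namespace CCDIM

open scoped ENNReal

/-! ## Expected running times of the building blocks -/

/-- A uniform pivot leaves on average at most 3/4 of the elements on the larger side, ties included.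
Induction by removing a minimum and a maximum together: each other element loses at most one rival
on either side, and the two removed ones count at most n - 1 each. -/
theorem sum_max_card_le {ι : Type} [DecidableEq ι] (f : ι → ℝ) (n : ℕ) (s : Finset ι)
    (hs : s.card = n) :
    4 * ∑ i ∈ s, max (s.filter fun j => f i < f j).card (s.filter fun j => f j < f i).card
      ≤ 3 * n ^ 2 := by
  induction n using Nat.strong_induction_on generalizing s with
  | _ n ih =>
  rcases lt_or_ge n 2 with hn | hn
  · have : ∀ i ∈ s, max (s.filter fun j => f i < f j).card (s.filter fun j => f j < f i).card = 0 := by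
      intro i hi
      have h1 : ∀ j ∈ s, j = i := fun j hj => Finset.card_le_one.1 (by omega) j hj i hi
      have h2 : (s.filter fun j => f i < f j) = ∅ :=
        Finset.filter_eq_empty_iff.2 fun j hj => by rw [h1 j hj]; exact lt_irrefl _
      have h3 : (s.filter fun j => f j < f i) = ∅ :=
        Finset.filter_eq_empty_iff.2 fun j hj => by rw [h1 j hj]; exact lt_irrefl _
      simp [h2, h3]
    rw [Finset.sum_eq_zero this]
    simp
  · obtain ⟨a, ha, hamin⟩ := Finset.exists_min_image s f (Finset.card_pos.1 (by omega))
    have hc1 : (s.erase a).card = n - 1 := by rw [Finset.card_erase_of_mem ha, hs]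
    obtain ⟨b, hb, hbmax⟩ := Finset.exists_max_image (s.erase a) f (Finset.card_pos.1 (by omega))
    set t := (s.erase a).erase b with ht
    have hc2 : t.card = n - 2 := by rw [ht, Finset.card_erase_of_mem hb, hc1]; omega
    have hbs : b ∈ s := Finset.mem_of_mem_erase hb
    have hbound : ∀ i ∈ s, max (s.filter fun j => f i < f j).card
        (s.filter fun j => f j < f i).card ≤ n - 1 := by
      intro i hi
      rw [← hs, ← Finset.card_erase_of_mem hi]
      refine max_le (Finset.card_le_card fun j hj => ?_) (Finset.card_le_card fun j hj => ?_)
      all_goals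
        rw [Finset.mem_filter] at hj
        exact Finset.mem_erase.2 ⟨by rintro rfl; exact lt_irrefl _ hj.2, hj.1⟩
    have hinner : ∀ i ∈ t, max (s.filter fun j => f i < f j).card
        (s.filter fun j => f j < f i).card
        ≤ max (t.filter fun j => f i < f j).card (t.filter fun j => f j < f i).card + 1 := by
      intro i hi
      have hi1 : i ∈ s.erase a := Finset.mem_of_mem_erase hi
      have hi2 : i ∈ s := Finset.mem_of_mem_erase hi1
      have h1 : (s.filter fun j => f i < f j) ⊆ insert b (t.filter fun j => f i < f j) := by
        intro j hj
        rw [Finset.mem_filter] at hj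
        have hja : j ≠ a := by
          rintro rfl
          exact absurd hj.2 (not_lt.2 (hamin i hi2))
        by_cases hjb : j = b
        · simp [hjb]
        · simp [ht, hja, hjb, hj.1, hj.2]
      have h2 : (s.filter fun j => f j < f i) ⊆ insert a (t.filter fun j => f j < f i) := by
        intro j hj
        rw [Finset.mem_filter] at hj
        have hjb : j ≠ b := by
          rintro rfl
          exact absurd hj.2 (not_lt.2 (hbmax i hi1))
        by_cases hja : j = a
        · simp [hja]
        · simp [ht, hja, hjb, hj.1, hj.2]
      have h3 := (Finset.card_le_card h1).trans (Finset.card_insert_le _ _)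
      have h4 := (Finset.card_le_card h2).trans (Finset.card_insert_le _ _)
      omega
    have hih := ih (n - 2) (by omega) t hc2
    have hsum := Finset.sum_le_sum hinner
    rw [Finset.sum_add_distrib, Finset.sum_const, hc2, smul_eq_mul, mul_one] at hsum
    rw [← Finset.add_sum_erase s _ ha, ← Finset.add_sum_erase (s.erase a) _ hb, ← ht]
    have h5 := hbound a ha
    have h6 := hbound b hbs
    obtain ⟨m, rfl⟩ : ∃ m, n = m + 2 := ⟨n - 2, by omega⟩
    simp only [Nat.add_sub_cancel, show m + 2 - 1 = m + 1 by omega] at *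
    nlinarith

theorem length_filter_eq_card (l : List ℝ) (p : ℝ → Prop) [DecidablePred p] :
    (l.filter fun z => p z).length = (Finset.univ.filter fun i : Fin l.length => p l[i.val]).card := by
  have h : l.filter (fun z => p z)
      = ((List.finRange l.length).filter fun i => p l[i.val]).map l.get := by
    conv_lhs => rw [← List.map_get_finRange l, List.filter_map]
    rfl
  rw [h, List.length_map, ← List.toFinset_card_of_nodup ((List.nodup_finRange _).filter _)]
  congr 1
  ext i
  simp

noncomputable section

namespace Problem

variable {I : Problem}

/-- For length L, one draw and 4L steps of partitioning, then at most 20 times the larger side,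
which averages 3L/4: 1 + 4L + 15L ≤ 20L. -/
theorem topSum_cost (fuel : ℕ) (l : List ℝ) (k : ℕ) :
    (topSum fuel l k).expectedCost ≤ ((20 * l.length : ℕ) : ℝ≥0∞) := by
  induction fuel generalizing l k with
  | zero => simp [topSum]
  | succ fuel ih =>
    match l with
    | [] => simp [topSum]
    | x :: l =>
      set xs := x :: l with hxs
      have hlen : xs.length = l.length + 1 := rfl
      have hrec : ∀ i : Fin (l.length + 1),
          (do
            Rand.tick (4 * (l.length + 1))
            let y := xs[i.val]
            let hi := xs.filter fun z => y < z
            let eq := xs.filter fun z => z = y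
            let lo := xs.filter fun z => z < y
            if k ≤ hi.length then topSum fuel hi k
            else if k ≤ hi.length + eq.length then
              pure (hi.sum + ((k - hi.length : ℕ) : ℝ) * y)
            else do
              let s ← topSum fuel lo (k - hi.length - eq.length)
              pure (hi.sum + (eq.length : ℝ) * y + s) : Rand ℝ).expectedCost
          ≤ ((4 * (l.length + 1) + 20 * max
              (Finset.univ.filter fun j : Fin xs.length => xs[i.val] < xs[j.val]).card
              (Finset.univ.filter fun j : Fin xs.length => xs[j.val] < xs[i.val]).card : ℕ) : ℝ≥0∞) := by
        intro i
        rw [← length_filter_eq_card xs (fun z => xs[i.val] < z),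
          ← length_filter_eq_card xs (fun z => z < xs[i.val])]
        rw [Nat.cast_add]
        refine Rand.expectedCost_bind_le (by rw [Rand.expectedCost_tick]) fun _ _ => ?_
        dsimp only
        split_ifs
        · refine (ih _ _).trans (Nat.cast_le.2 ?_)
          gcongr
          exact le_max_left _ _
        · simp
        · refine (Rand.expectedCost_bind_le ((ih _ _).trans (Nat.cast_le.2 ?_))
            fun _ _ => (Rand.expectedCost_pure _).le).trans (add_zero _).le
          gcongr
          exact le_max_right _ _
      have hsum := sum_max_card_le (fun i : Fin xs.length => xs[i.val]) xs.length Finset.univ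
        (by simp)
      rw [topSum, Rand.expectedCost_bind, Rand.expectedCost_draw, Rand.E_draw, tsum_fintype]
      refine (add_le_add le_rfl (Finset.sum_le_sum fun i _ => mul_le_mul_right (hrec i) _)).trans ?_
      simp only [PMF.uniformOfFintype_apply, Fintype.card_fin]
      rw [← Finset.mul_sum, ← Nat.cast_sum, Finset.sum_add_distrib, ← Finset.mul_sum _ _ 20]
      have hN : ((l.length + 1 : ℕ) : ℝ≥0∞)⁻¹ * ((∑ _i : Fin (l.length + 1), 4 * (l.length + 1)
          + 20 * ∑ i : Fin (l.length + 1), max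
            (Finset.univ.filter fun j : Fin xs.length => xs[i.val] < xs[j.val]).card
            (Finset.univ.filter fun j : Fin xs.length => xs[j.val] < xs[i.val]).card : ℕ) : ℝ≥0∞)
          ≤ ((19 * (l.length + 1) : ℕ) : ℝ≥0∞) := by
        rw [ENNReal.inv_mul_le_iff (by simp) (ENNReal.natCast_ne_top _), ← Nat.cast_mul]
        refine Nat.cast_le.2 ?_
        rw [Finset.sum_const, Finset.card_univ, Fintype.card_fin, smul_eq_mul]
        have hsum' : _ ≤ 3 * (l.length + 1) ^ 2 := hsum
        have h4 : 20 * ∑ i : Fin (l.length + 1), max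
            (Finset.univ.filter fun j : Fin xs.length => xs[i.val] < xs[j.val]).card
            (Finset.univ.filter fun j : Fin xs.length => xs[j.val] < xs[i.val]).card
            ≤ 15 * (l.length + 1) ^ 2 := by
          refine le_trans (le_of_eq ?_) ((Nat.mul_le_mul_left 5 hsum').trans (le_of_eq (by ring)))
          rw [← mul_assoc]
          rfl
        nlinarith
      refine (add_le_add le_rfl hN).trans ?_
      rw [← Nat.cast_one, ← Nat.cast_add]
      exact Nat.cast_le.2 (by omega)

end Problem

end

end CCDIM

namespace CCDIM

open scoped ENNReal

/-! ## The cost of sampling -/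

noncomputable section

namespace Problem

variable {I : Problem}

theorem sum_length_inNbrs : ∑ v, (I.inNbrs v).length = I.m := by
  have h : ∀ v, (I.inNbrs v).length = (I.E.filter fun e => e.2 = v).card := by
    intro v
    rw [← List.toFinset_card_of_nodup (inNbrs_nodup v)]
    refine Finset.card_bij (fun u _ => (u, v)) ?_ ?_ ?_
    · intro u hu
      simpa [mem_inNbrs] using hu
    · intro a _ b _ hab
      exact congrArg Prod.fst hab
    · rintro ⟨u, w⟩ he
      simp only [Finset.mem_filter] at he
      obtain ⟨h1, rfl⟩ := he
      exact ⟨u, by simpa [mem_inNbrs] using h1, rfl⟩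
  simp only [h]
  exact (Finset.card_eq_sum_card_fiberwise fun e _ => Finset.mem_univ e.2).symm

theorem sum_map_finRange {n : ℕ} (f : Fin n → ℕ) : ((List.finRange n).map f).sum = ∑ v, f v := by
  rw [← List.sum_toFinset _ (List.nodup_finRange n), List.toFinset_finRange]

/-- One round of the sampling of the live in-neighbours of `v`. -/
def coinStep (v : I.Node) (L : List I.Node) (u : I.Node) : Rand (List I.Node) := do
  Rand.tick 1
  let b ← Rand.draw (coin (I.p (u, v)))
  pure (if b then L ++ [u] else L)

/-- One round of the sampling of a realization. -/
def nodeStep (live : I.Node → List I.Node) (v : I.Node) : Rand (I.Node → List I.Node) := do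
  Rand.tick 1
  let L ← (I.inNbrs v).foldlM (coinStep v) []
  pure (Function.update live v L)

theorem sampleRealization_eq :
    I.sampleRealization = (List.finRange I.n).foldlM nodeStep (fun _ => []) := rfl

theorem coinStep_cost (v : I.Node) (L : List I.Node) (u : I.Node) :
    (coinStep v L u).expectedCost = 2 := by
  simp only [coinStep, Rand.expectedCost_bind, Rand.expectedCost_tick,
    Rand.expectedCost_draw, Rand.expectedCost_pure, Rand.E_const]
  norm_num

theorem coinStep_fold_length (v : I.Node) (l L : List I.Node) :
    ∀ L' ∈ (l.foldlM (coinStep v) L).Supp, L'.length ≤ L.length + l.length := by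
  induction l generalizing L with
  | nil =>
    intro L' hL'
    simp only [List.foldlM_nil, Rand.mem_Supp_pure] at hL'
    simp [hL']
  | cons u l ih =>
    intro L' hL'
    simp only [List.foldlM_cons, coinStep, Rand.mem_Supp_bind, Rand.mem_Supp_pure] at hL'
    obtain ⟨L₁, ⟨_, _, b, _, rfl⟩, hL'⟩ := hL'
    have := ih _ L' hL'
    rw [List.length_cons]
    split_ifs at this
    · rw [List.length_append, List.length_singleton] at this
      omega
    · omega

theorem nodeStep_cost (live : I.Node → List I.Node) (v : I.Node) :
    (nodeStep live v).expectedCost ≤ ((1 + 2 * (I.inNbrs v).length : ℕ) : ℝ≥0∞) := by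
  rw [Nat.cast_add]
  refine Rand.expectedCost_bind_le (by rw [Rand.expectedCost_tick]) fun _ _ => ?_
  refine (Rand.expectedCost_bind_le ?_ fun _ _ => (Rand.expectedCost_pure _).le).trans
    (add_zero _).le
  refine (Rand.expectedCost_foldlM_le (fun _ => True) (coinStep v) (fun _ => 2) (I.inNbrs v)
    (fun _ _ _ _ _ _ => trivial) (fun L u _ _ => (coinStep_cost v L u).le) [] trivial).trans ?_
  simp [mul_comm]

theorem sampleRealization_cost :
    I.sampleRealization.expectedCost ≤ ((I.n + 2 * I.m : ℕ) : ℝ≥0∞) := by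
  rw [sampleRealization_eq]
  refine (Rand.expectedCost_foldlM_le (fun _ => True) nodeStep _ _
    (fun _ _ _ _ _ _ => trivial) (fun live v _ _ => nodeStep_cost live v) _ trivial).trans ?_
  refine Nat.cast_le.2 (le_of_eq ?_)
  rw [sum_map_finRange, Finset.sum_add_distrib, ← Finset.mul_sum, sum_length_inNbrs]
  simp

theorem sampleRealization_length {live : I.Node → List I.Node}
    (h : live ∈ I.sampleRealization.Supp) (v : I.Node) :
    (live v).length ≤ (I.inNbrs v).length := by
  rw [sampleRealization_eq] at h
  refine Rand.Supp_foldlM (fun live => ∀ v, (live v).length ≤ (I.inNbrs v).length) nodeStep _ ?_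
    _ (by simp) live h v
  intro live u _ hlive live' h' v
  simp only [nodeStep, Rand.mem_Supp_bind, Rand.mem_Supp_pure] at h'
  obtain ⟨_, _, L, hL, rfl⟩ := h'
  by_cases hv : v = u
  · subst hv
    rw [Function.update_self]
    simpa using coinStep_fold_length v _ _ L hL
  · rw [Function.update_of_ne hv]
    exact hlive v

/-! ### Cost of the reverse search -/

theorem scan_cost (S : Finset I.Node) (ws H R : List I.Node) :
    (scan S ws H R).cost ≤ ws.length := by
  induction ws generalizing H R with
  | nil => simp [scan]
  | cons w ws ih =>
    simp only [scan, Timed.cost_bind, Timed.cost_tick, List.length_cons]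
    split_ifs
    · have := ih H R
      omega
    · simp
    · have := ih (H ++ [w]) (R ++ [w])
      omega

/-- Every popped node `u` is charged `1 + |live u|` steps. -/
theorem search_cost_aux (S : Finset I.Node) (live : I.Node → List I.Node) (fuel : ℕ)
    (P H R : List I.Node) (hR : R = P ++ H) (hnd : R.Nodup) :
    (search S live fuel H R).cost + (P.map fun u => 1 + (live u).length).sum
      ≤ ∑ v, (1 + (live v).length) := by
  have base : ∀ Q : List I.Node, Q.Nodup →
      (Q.map fun u => 1 + (live u).length).sum ≤ ∑ v, (1 + (live v).length) := by
    intro Q hQ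
    rw [← List.sum_toFinset _ hQ]
    exact Finset.sum_le_sum_of_subset (Finset.subset_univ _)
  have hP : P.Nodup := by
    rw [hR] at hnd
    exact hnd.of_append_left
  induction fuel generalizing P H R with
  | zero => simpa [search] using base P hP
  | succ fuel ih =>
    match H with
    | [] => simpa [search] using base P hP
    | u :: H =>
      have hPu : (P ++ [u]).Nodup := by
        rw [hR, List.append_cons] at hnd
        exact hnd.of_append_left
      have hscan := scan_cost S (live u) H R
      have hsum : ((P ++ [u]).map fun u => 1 + (live u).length).sum
          = (P.map fun u => 1 + (live u).length).sum + (1 + (live u).length) := by simp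
      rw [search]
      simp only [Timed.cost_bind, Timed.cost_tick]
      rcases hout : (scan S (live u) H R).val with _ | ⟨H', R'⟩
      · have := base _ hPu
        simp only [Timed.cost_pure]
        omega
      · obtain ⟨N, h1, h2, h3, -, -⟩ := scan_some hout
        have := ih (P ++ [u]) H' R' (by rw [h2, h1, hR]; simp) (h3 hnd) hPu
        simp only
        omega

theorem search_cost {S : Finset I.Node} {live : I.Node → List I.Node}
    (hlive : ∀ v, (live v).length ≤ (I.inNbrs v).length) (fuel : ℕ) (v : I.Node) :
    (search S live fuel [v] [v]).cost ≤ I.n + I.m := by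
  have h := search_cost_aux S live fuel [] [v] [v] rfl (List.nodup_singleton v)
  have h2 : ∑ v, (1 + (live v).length) ≤ I.n + I.m := by
    rw [Finset.sum_add_distrib, ← sum_length_inNbrs]
    simpa using Finset.sum_le_sum fun v (_ : v ∈ Finset.univ) => hlive v
  simp at h
  omega

theorem sampleStep_cost {S : Finset I.Node} {live : I.Node → List I.Node}
    (hlive : ∀ v, (live v).length ≤ (I.inNbrs v).length) (R : GRR I) (x : I.Key) :
    (sampleStep S live R x).expectedCost ≤ ((2 + 2 * I.n + I.m : ℕ) : ℝ≥0∞) := by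
  rw [show 2 + 2 * I.n + I.m = 1 + (1 + (I.n + ((I.n + I.m) + 0))) by ring]
  simp only [Nat.cast_add _ (1 + _), Nat.cast_add _ (I.n + _), Nat.cast_add _ ((I.n + I.m) + 0)]
  refine Rand.expectedCost_bind_le (by rw [Rand.expectedCost_tick]) fun _ _ => ?_
  refine Rand.expectedCost_bind_le (by rw [Rand.expectedCost_draw, Nat.cast_one]) fun v _ => ?_
  split_ifs
  · rw [Rand.expectedCost_pure]
    exact zero_le
  · refine Rand.expectedCost_bind_le (by rw [Rand.expectedCost_tick]) fun _ _ => ?_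
    rw [Nat.cast_add _ 0]
    refine Rand.expectedCost_bind_le ?_ fun _ _ => by simp
    rw [Rand.expectedCost_lift]
    exact Nat.cast_le.2 (search_cost hlive _ v)

theorem sampleGRR_cost (S : Finset I.Node) : (sampleGRR S).expectedCost
    ≤ ((I.n + 2 * I.m + I.numKeys * (2 + 2 * I.n + I.m) : ℕ) : ℝ≥0∞) := by
  rw [sampleGRR_eq, Nat.cast_add]
  refine Rand.expectedCost_bind_le sampleRealization_cost fun live hlive => ?_
  refine (Rand.expectedCost_foldlM_le (fun _ => True) (sampleStep S live) _ _
    (fun _ _ _ _ _ _ => trivial)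
    (fun R x _ _ => sampleStep_cost (sampleRealization_length hlive) R x) _ trivial).trans ?_
  rw [← length_keys]
  simp

theorem sampleMany_cost_le (S : Finset I.Node) {c : ℕ}
    (hc : (sampleGRR S).expectedCost ≤ c) (N : ℕ) :
    (sampleMany S N).expectedCost ≤ ((N * (1 + c) : ℕ) : ℝ≥0∞) := by
  induction N with
  | zero => simp [sampleMany]
  | succ N ih =>
    rw [sampleMany, show (N + 1) * (1 + c) = 1 + (c + N * (1 + c)) by ring]
    rw [Nat.cast_add 1, Nat.cast_add c]
    refine Rand.expectedCost_bind_le (by rw [Rand.expectedCost_tick]) fun _ _ => ?_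
    refine Rand.expectedCost_bind_le hc fun _ _ => ?_
    exact (Rand.expectedCost_bind_le ih fun _ _ => (Rand.expectedCost_pure _).le).trans
      (add_zero _).le

theorem numKeys_pos (hn : 0 < I.n) : 0 < I.numKeys := by
  rw [← length_keys]
  obtain ⟨x⟩ := nonempty_key hn
  exact List.length_pos_of_mem (mem_keys x)

/-- The hypothesis n ≤ 2m absorbs the per-node work (clearing marks, one visit per node) into the
number of edges. -/
theorem sampleMany_cost (hn : 0 < I.n) (hm : I.n ≤ 2 * I.m) (S : Finset I.Node) (N : ℕ) :
    (sampleMany S N).expectedCost ≤ ((12 * (N * (I.numKeys * I.m)) : ℕ) : ℝ≥0∞) := by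
  refine (sampleMany_cost_le S (sampleGRR_cost S) N).trans (Nat.cast_le.2 ?_)
  have hK := numKeys_pos hn
  have h1 : 1 + (I.n + 2 * I.m + I.numKeys * (2 + 2 * I.n + I.m)) ≤ 12 * (I.numKeys * I.m) := by
    have h2 : I.numKeys * (2 + 2 * I.n + I.m) ≤ I.numKeys * (7 * I.m) :=
      Nat.mul_le_mul_left _ (by omega)
    have h3 : I.m ≤ I.numKeys * I.m := Nat.le_mul_of_pos_left _ hK
    have h4 : I.numKeys * (7 * I.m) = 7 * (I.numKeys * I.m) := by ring
    omega
  calc _ ≤ N * (12 * (I.numKeys * I.m)) := Nat.mul_le_mul_left _ h1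
    _ = _ := by ring

end Problem

end

end CCDIM

namespace CCDIM

open scoped ENNReal

/-! ## The cost of the greedy algorithm -/

noncomputable section

namespace Problem

variable {I : Problem}

theorem ValidGRR.length_le {S : Finset I.Node} {R : GRR I} (hR : ValidGRR S R) {x : I.Key}
    {L : List I.Node} (h : R x = some L) : L.length ≤ I.n := by
  simpa using (hR x L h).1.length_le_card

theorem covered_cost {S A : Finset I.Node} {R : GRR I} (hR : ValidGRR S R) (x : I.Key) :
    (covered A (R x)).cost ≤ I.n := by
  rcases h : R x with _ | L
  · simp [covered]
  · rw [covered]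
    refine (Timed.cost_foldlM_le_length _ 1 L (fun b v _ => by simp) _).trans ?_
    rw [mul_one]
    exact hR.length_le h

theorem coverage_cost {S A : Finset I.Node} {Rs : List (GRR I)} (hRs : ∀ R ∈ Rs, ValidGRR S R) :
    (coverage A Rs).cost ≤ Rs.length * (I.numKeys * (1 + I.n)) := by
  refine Timed.cost_foldlM_le_length _ _ _ (fun Ω R hR => ?_) _
  rw [← length_keys]
  refine Timed.cost_foldlM_le_length _ _ _ (fun Ω x _ => ?_) _
  have := covered_cost (A := A) (hRs R hR) x
  simp only [Timed.cost_bind, Timed.cost_tick, Timed.cost_pure]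
  omega

theorem bump_cost (c : ℝ) (R : List I.Node) (g : I.Node → ℝ) : (bump c R g).cost ≤ R.length := by
  rw [← mul_one R.length]
  exact Timed.cost_foldlM_le_length _ 1 R (fun b v _ => by simp) _

/-- The total size of the uncovered reverse reachable sets. -/
def restSize (st : GreedyState I) : ℕ := (st.rest.map fun item => item.2.length).sum

theorem initStep_cost {S : Finset I.Node} {R : GRR I} (hR : ValidGRR S R) (st : GreedyState I)
    (x : I.Key) : (initStep R st x).cost ≤ 1 + I.n ∧
      (initStep R st x).val.rest.length ≤ st.rest.length + 1 ∧
      restSize (initStep R st x).val ≤ restSize st + I.n := by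
  unfold initStep
  simp only [Timed.cost_bind, Timed.cost_tick, Timed.val_bind]
  rcases h : R x with _ | L
  · simp [restSize]
  · have h1 := bump_cost (I.coef x) L st.gain
    have h2 := hR.length_le h
    simp only [Timed.cost_bind, Timed.cost_pure, Timed.val_bind, Timed.val_pure, restSize,
      List.map_cons, List.sum_cons, List.length_cons]
    omega

theorem initFold_cost {S : Finset I.Node} {R : GRR I} (hR : ValidGRR S R) (l : List I.Key)
    (st : GreedyState I) : (l.foldlM (initStep R) st).cost ≤ l.length * (1 + I.n) ∧
      (l.foldlM (initStep R) st).val.rest.length ≤ st.rest.length + l.length ∧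
      restSize (l.foldlM (initStep R) st).val ≤ restSize st + l.length * I.n := by
  refine ⟨Timed.cost_foldlM_le_length _ _ _ (fun st x _ => (initStep_cost hR st x).1) _, ?_⟩
  induction l generalizing st with
  | nil => simp
  | cons x l ih =>
    obtain ⟨-, h1, h2⟩ := initStep_cost hR st x
    obtain ⟨h3, h4⟩ := ih (initStep R st x).val
    simp only [List.foldlM_cons, Timed.val_bind, List.length_cons]
    refine ⟨by omega, ?_⟩
    rw [add_mul, one_mul]
    omega

theorem initState_cost (S₀ : Finset I.Node) {Rs : List (GRR I)} {S : Finset I.Node}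
    (hRs : ∀ R ∈ Rs, ValidGRR S R) :
    (initState S₀ Rs).cost ≤ I.n + Rs.length * (I.numKeys * (1 + I.n)) ∧
      (initState S₀ Rs).val.rest.length ≤ Rs.length * I.numKeys ∧
      restSize (initState S₀ Rs).val ≤ Rs.length * (I.numKeys * I.n) := by
  rw [initState_eq, ← length_keys]
  simp only [Timed.cost_bind, Timed.cost_tick, Timed.val_bind]
  refine ⟨Nat.add_le_add_left (Timed.cost_foldlM_le_length _ _ _
    (fun st R hR => (initFold_cost (hRs R hR) I.keys st).1) _) _, ?_⟩
  suffices h : ∀ st : GreedyState I,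
      (Rs.foldlM (fun st R => I.keys.foldlM (initStep R) st) st).val.rest.length
        ≤ st.rest.length + Rs.length * I.keys.length ∧
      restSize (Rs.foldlM (fun st R => I.keys.foldlM (initStep R) st) st).val
        ≤ restSize st + Rs.length * (I.keys.length * I.n) by
    simpa [restSize] using h ⟨S₀, 0, fun _ => 0, []⟩
  induction Rs with
  | nil => intro st; simp
  | cons R Rs ih =>
    intro st
    obtain ⟨-, h1, h2⟩ := initFold_cost (hRs R (by simp)) I.keys st
    obtain ⟨h3, h4⟩ := ih (fun R hR => hRs R (by simp [hR])) (I.keys.foldlM (initStep R) st).val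
    simp only [List.foldlM_cons, Timed.val_bind, List.length_cons, add_mul, one_mul]
    omega

theorem pickMax_cost (st : GreedyState I) : (pickMax st).cost ≤ I.n := by
  have h : (pickMax st).cost ≤ (List.finRange I.n).length * 1 := by
    refine Timed.cost_foldlM_le_length _ 1 _ (fun b v _ => ?_) _
    simp only [Timed.cost_bind, Timed.cost_tick]
    split_ifs
    · simp
    · rcases b with _ | u <;> simp
  simpa using h

/-- One round of the update of the gains. -/
def insertStep (v : I.Node) (s : GreedyState I) (item : ℝ × List I.Node) :
    Timed (GreedyState I) := do
  Timed.tick 1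
  if v ∈ item.2 then do
    let gain ← bump (-item.1) item.2 s.gain
    pure { s with cov := s.cov + item.1, gain := gain }
  else pure { s with rest := item :: s.rest }

theorem insertNode_eq (v : I.Node) (st : GreedyState I) : insertNode v st = (do
    Timed.tick 1
    st.rest.foldlM (insertStep v) { st with S := insert v st.S, rest := [] }) := rfl

/-- The total size of the uncovered sets is a potential: updating the gains along a newly covered
set is paid for by the removal of that set, so only the scan costs one step per item. -/
theorem insertFold_cost (v : I.Node) (l : List (ℝ × List I.Node)) (s : GreedyState I) :
    (l.foldlM (insertStep v) s).cost + restSize (l.foldlM (insertStep v) s).val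
      ≤ l.length + (l.map fun item => item.2.length).sum + restSize s ∧
    (l.foldlM (insertStep v) s).val.rest.length ≤ l.length + s.rest.length := by
  induction l generalizing s with
  | nil => simp
  | cons item l ih =>
    obtain ⟨h1, h2⟩ := ih (insertStep v s item).val
    have h3 : (insertStep v s item).cost + restSize (insertStep v s item).val
        ≤ 1 + item.2.length + restSize s ∧
        (insertStep v s item).val.rest.length ≤ 1 + s.rest.length := by
      unfold insertStep
      simp only [Timed.cost_bind, Timed.cost_tick, Timed.val_bind]
      split_ifs
      · have := bump_cost (-item.1) item.2 s.gain
        simp only [Timed.cost_bind, Timed.cost_pure, Timed.val_bind, Timed.val_pure, restSize]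
        omega
      · simp only [Timed.cost_pure, Timed.val_pure, restSize, List.map_cons, List.sum_cons,
          List.length_cons]
        omega
    simp only [List.foldlM_cons, Timed.cost_bind, Timed.val_bind, List.length_cons, List.map_cons,
      List.sum_cons]
    omega

theorem insertNode_cost (v : I.Node) (st : GreedyState I) :
    (insertNode v st).cost + restSize (insertNode v st).val ≤ 1 + st.rest.length + restSize st ∧
    (insertNode v st).val.rest.length ≤ st.rest.length := by
  rw [insertNode_eq]
  have h := insertFold_cost v st.rest { st with S := insert v st.S, rest := [] }
  simp only [Timed.cost_bind, Timed.cost_tick, Timed.val_bind]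
  have h0 : restSize { st with S := insert v st.S, rest := [] } = 0 := rfl
  rw [h0, List.length_nil] at h
  have : restSize st = (st.rest.map fun item => item.2.length).sum := rfl
  omega

theorem snapshot_cost (k : ℕ) (st : GreedyState I) :
    (snapshot k st).expectedCost ≤ ((22 * I.n : ℕ) : ℝ≥0∞) := by
  rw [snapshot, show 22 * I.n = 2 * I.n + 20 * I.n by ring, Nat.cast_add]
  refine Rand.expectedCost_bind_le (by rw [Rand.expectedCost_tick]) fun _ _ => ?_
  refine (Rand.expectedCost_bind_le (topSum_cost _ _ _) fun _ _ =>
    (Rand.expectedCost_pure _).le).trans ?_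
  simp

/-- By the potential argument the total size of the sets is paid once for the whole run; each step
pays only for its scan, its snapshot and the choice of a node. -/
theorem greedyLoop_cost (k j : ℕ) (st : GreedyState I) {X : ℕ} (hX : st.rest.length ≤ X) :
    (greedyLoop k j st).expectedCost
      ≤ (((j + 1) * (23 * I.n + 1 + X) + restSize st : ℕ) : ℝ≥0∞) := by
  induction j generalizing st with
  | zero =>
    rw [greedyLoop]
    refine (Rand.expectedCost_bind_le (snapshot_cost k st) fun _ _ =>
      (Rand.expectedCost_pure _).le).trans ?_
    rw [add_zero]
    exact Nat.cast_le.2 (by omega)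
  | succ j ih =>
    rw [greedyLoop, show (j + 1 + 1) * (23 * I.n + 1 + X) + restSize st = 22 * I.n + (I.n +
      (1 + X + restSize st + (j + 1) * (23 * I.n + 1 + X))) by ring]
    rw [Nat.cast_add, Nat.cast_add I.n]
    refine Rand.expectedCost_bind_le (snapshot_cost k st) fun s _ => ?_
    refine Rand.expectedCost_bind_le ?_ fun v _ => ?_
    · rw [Rand.expectedCost_lift]
      exact Nat.cast_le.2 (pickMax_cost st)
    rcases v with _ | v
    · simp only [Rand.expectedCost_pure]
      exact zero_le
    · obtain ⟨h1, h2⟩ := insertNode_cost v st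
      simp only [Rand.expectedCost_bind, Rand.expectedCost_lift, Rand.E_lift,
        Rand.expectedCost_pure, Rand.E_const, add_zero]
      refine (add_le_add le_rfl (ih (insertNode v st).val (h2.trans hX))).trans ?_
      rw [← Nat.cast_add]
      refine Nat.cast_le.2 ?_
      omega

theorem greedyLoop_length (k j : ℕ) (st : GreedyState I) :
    ∀ l ∈ (greedyLoop k j st).Supp, l.length ≤ j + 1 := by
  induction j generalizing st with
  | zero =>
    intro l hl
    simp only [greedyLoop, Rand.mem_Supp_bind, Rand.mem_Supp_pure] at hl
    obtain ⟨s, -, rfl⟩ := hl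
    simp
  | succ j ih =>
    intro l hl
    simp only [greedyLoop, Rand.mem_Supp_bind, Rand.mem_Supp_lift] at hl
    obtain ⟨s, -, v, -, hl⟩ := hl
    rcases v with _ | v
    · simp only [Rand.mem_Supp_pure] at hl
      simp [hl]
    · simp only [Rand.mem_Supp_bind, Rand.mem_Supp_lift, Rand.mem_Supp_pure] at hl
      obtain ⟨st', -, l', hl', rfl⟩ := hl
      simpa using ih _ l' hl'

theorem greedy_length {k j : ℕ} {S₀ : Finset I.Node} {Rs : List (GRR I)} {l : List (Snapshot I)}
    (hl : l ∈ (greedy k j S₀ Rs).Supp) : l.length ≤ j + 1 := by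
  simp only [greedy, Rand.mem_Supp_bind, Rand.mem_Supp_lift] at hl
  obtain ⟨st, -, hl⟩ := hl
  exact greedyLoop_length _ _ _ l hl

theorem greedy_cost (hm : I.n ≤ 2 * I.m) {k j : ℕ} (hk : 1 ≤ k) (hkn : k ≤ I.n) (hj : j ≤ k)
    (S₀ : Finset I.Node) {Rs : List (GRR I)} {S : Finset I.Node} (hRs : ∀ R ∈ Rs, ValidGRR S R) :
    (greedy k j S₀ Rs).expectedCost
      ≤ ((10 * (Rs.length * (I.numKeys * I.m)) + 49 * (k * I.n) : ℕ) : ℝ≥0∞) := by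
  obtain ⟨h1, h2, h3⟩ := initState_cost S₀ hRs
  rw [greedy]
  simp only [Rand.expectedCost_bind, Rand.expectedCost_lift, Rand.E_lift]
  refine (add_le_add (Nat.cast_le.2 h1) (greedyLoop_cost k j _ h2)).trans ?_
  rw [← Nat.cast_add]
  refine Nat.cast_le.2 ?_
  set Y := Rs.length * I.numKeys with hY
  have e1 : Rs.length * (I.numKeys * (1 + I.n)) = Y + Y * I.n := by rw [hY]; ring
  have e2 : Rs.length * (I.numKeys * I.n) = Y * I.n := by rw [hY]; ring
  have e3 : Rs.length * (I.numKeys * I.m) = Y * I.m := by rw [hY]; ring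
  -- The scans use j + 1 ≤ n + 1 passes over at most Y sets. Bounding the passes by n and then n by
  -- 2m makes them comparable to sampling.
  have e4 : (j + 1) * (23 * I.n + 1 + Y) ≤ (2 * k) * (24 * I.n) + (I.n + 1) * Y := by
    calc _ = (j + 1) * (23 * I.n + 1) + (j + 1) * Y := by ring
      _ ≤ _ := Nat.add_le_add (Nat.mul_le_mul (by omega) (by omega))
        (Nat.mul_le_mul_right _ (by omega))
  have e5 : Y * I.n ≤ Y * (2 * I.m) := Nat.mul_le_mul_left _ hm
  have e6 : Y ≤ Y * I.m := Nat.le_mul_of_pos_right _ (by omega)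
  have e7 : I.n ≤ k * I.n := Nat.le_mul_of_pos_left _ hk
  rw [e2] at h3
  rw [e1, e3]
  nlinarith

theorem bestUb_cost (l : List (Snapshot I)) : (bestUb l).cost ≤ l.length := by
  rcases l with _ | ⟨s, l⟩
  · simp [bestUb]
  · rw [bestUb]
    refine (Timed.cost_foldlM_le_length _ 1 l (fun b v _ => by simp) _).trans ?_
    simp

theorem chooseSentinel_cost (k : ℕ) (ε₁ δl fu : ℝ) (θ : ℕ) (l : List (Snapshot I)) :
    (chooseSentinel k ε₁ δl fu θ l).cost ≤ l.length := by
  have h : (chooseSentinel k ε₁ δl fu θ l).cost ≤ l.zipIdx.length * 1 :=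
    Timed.cost_foldlM_le_length _ 1 _ (fun b v _ => by simp) _
  simpa using h

end Problem

end

end CCDIM

namespace CCDIM

open scoped ENNReal

/-! ## The cost of the two stages -/

noncomputable section

theorem Rand.expectedCost_bind_le_nat {α β : Type} {x : Rand α} {f : α → Rand β} {a b c : ℕ}
    (hx : x.expectedCost ≤ a) (hf : ∀ y ∈ x.Supp, (f y).expectedCost ≤ b) (h : a + b ≤ c) :
    (x >>= f).expectedCost ≤ c := by
  refine (Rand.expectedCost_bind_le hx hf).trans ?_
  rw [← Nat.cast_add]
  exact Nat.cast_le.2 h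

theorem Rand.expectedCost_lift_bind_le {α β : Type} {x : Timed α} {f : α → Rand β} {a b c : ℕ}
    (hx : x.cost ≤ a) (hf : (f x.val).expectedCost ≤ b) (h : a + b ≤ c) :
    (Rand.lift x >>= f).expectedCost ≤ c := by
  refine Rand.expectedCost_bind_le_nat (a := a) ?_ (fun y hy => ?_) h
  · rw [Rand.expectedCost_lift]
    exact Nat.cast_le.2 hx
  · rw [Rand.mem_Supp_lift] at hy
    rwa [hy]

namespace Problem

variable {I : Problem}

theorem coverage_cost_le (hm : I.n ≤ 2 * I.m) (hn : 0 < I.n) {S A : Finset I.Node}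
    {Rs : List (GRR I)} (hRs : ∀ R ∈ Rs, ValidGRR S R) :
    (coverage A Rs).cost ≤ 3 * (Rs.length * (I.numKeys * I.m)) := by
  refine (coverage_cost hRs).trans ?_
  calc _ ≤ Rs.length * (I.numKeys * (3 * I.m)) :=
        Nat.mul_le_mul_left _ (Nat.mul_le_mul_left _ (by omega))
    _ = _ := by ring

/-- The work of a round is linear in the current collection, which doubles, so the rounds sum to a
geometric series. In units of N · `numKeys` · m a round costs 10 for greedy, 12 + 3 and 36 + 12 for
the two tests, and 12 for doubling. -/
theorem sentinelLoop_cost (hm : I.n ≤ 2 * I.m) {k : ℕ} (hk : 1 ≤ k) (hkn : k ≤ I.n) {ε₁ δ : ℝ}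
    {imax : ℕ} (t : ℕ) {N : ℕ} (Rs : List (GRR I)) (hN : Rs.length = N)
    (hRs : ∀ R ∈ Rs, ValidGRR ∅ R) (S₀ : Finset I.Node) :
    (sentinelLoop k ε₁ δ imax t Rs S₀).expectedCost
      ≤ ((85 * ((2 ^ t - 1) * (N * (I.numKeys * I.m))) + 54 * (t * (k * I.n)) : ℕ) : ℝ≥0∞) := by
  have hn : 0 < I.n := by omega
  induction t generalizing Rs S₀ N with
  | zero => simp [sentinelLoop]
  | succ t ih =>
    set W := I.numKeys * I.m with hW
    set A := k * I.n with hA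
    have hsm : ∀ (S : Finset I.Node) (N : ℕ),
        (sampleMany S N).expectedCost ≤ ((12 * (N * W) : ℕ) : ℝ≥0∞) := sampleMany_cost hn hm
    have hgr : ∀ (j : ℕ) (S₀ S : Finset I.Node) (Rs : List (GRR I)), j ≤ k →
        (∀ R ∈ Rs, ValidGRR S R) → (greedy k j S₀ Rs).expectedCost
          ≤ ((10 * (Rs.length * W) + 49 * A : ℕ) : ℝ≥0∞) :=
      fun j S₀ S Rs hj h => greedy_cost hm hk hkn hj S₀ h
    have hcov : ∀ (A S : Finset I.Node) (Rs : List (GRR I)), (∀ R ∈ Rs, ValidGRR S R) →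
        (coverage A Rs).cost ≤ 3 * (Rs.length * W) := fun A S Rs h => coverage_cost_le hm hn h
    set Z := 85 * ((2 ^ t - 1) * ((N + N) * W)) + 54 * (t * A) with hZ
    have hA1 : k + 1 ≤ 2 * A := by
      have : k ≤ A := Nat.le_mul_of_pos_right _ hn
      omega
    have htotal : 85 * (N * W) + 54 * A + Z
        = 85 * ((2 ^ (t + 1) - 1) * (N * W)) + 54 * ((t + 1) * A) := by
      obtain ⟨p, hp⟩ : ∃ p, 2 ^ t = p + 1 := ⟨2 ^ t - 1, by have := Nat.one_le_two_pow (n := t); omega⟩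
      have hp' : 2 ^ (t + 1) - 1 = 2 * p + 1 := by rw [pow_succ, hp]; omega
      rw [hZ, hp', hp, Nat.add_sub_cancel]
      ring
    rw [sentinelLoop, ← htotal]
    refine Rand.expectedCost_bind_le_nat (a := 1) (b := 85 * (N * W) + 53 * A + Z)
      (by rw [Rand.expectedCost_tick]) (fun _ _ => ?_) (by omega)
    dsimp only
    refine Rand.expectedCost_bind_le_nat (b := 75 * (N * W) + 4 * A + Z)
      (hgr k ∅ ∅ Rs le_rfl hRs) (fun l hl => ?_) (by rw [hN]; omega)
    have hlen := greedy_length hl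
    refine Rand.expectedCost_lift_bind_le (b := 75 * (N * W) + 2 * A + Z)
      ((bestUb_cost l).trans hlen) ?_ (by omega)
    refine Rand.expectedCost_lift_bind_le (b := 75 * (N * W) + Z)
      ((chooseSentinel_cost _ _ _ _ _ l).trans hlen) ?_ (by omega)
    generalize (chooseSentinel k ε₁ _ _ Rs.length l).val = bS
    obtain ⟨b, S⟩ := bS
    rw [hN]
    refine Rand.expectedCost_bind_le_nat (b := 63 * (N * W) + Z) (hsm S N)
      (fun R₂ hR₂ => ?_) (by omega)
    have hlen₂ := sampleMany_length hR₂
    have hc₂ := hcov S S R₂ (sampleMany_valid hR₂)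
    rw [hlen₂] at hc₂
    refine Rand.expectedCost_lift_bind_le (b := 60 * (N * W) + Z) hc₂ ?_ (by omega)
    split_ifs
    · rw [Rand.expectedCost_pure]
      exact zero_le
    have e3 : 12 * (3 * N * W) = 36 * (N * W) := by ring
    refine Rand.expectedCost_bind_le_nat (b := 24 * (N * W) + Z) (hsm S (3 * N))
      (fun R₂' hR₂' => ?_) (by omega)
    have hvalid : ∀ R ∈ R₂ ++ R₂', ValidGRR S R := fun R hR =>
      (List.mem_append.1 hR).elim (sampleMany_valid hR₂ R) (sampleMany_valid hR₂' R)
    have hc₃ := hcov S S _ hvalid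
    rw [List.length_append, hlen₂, sampleMany_length hR₂',
      show 3 * ((N + 3 * N) * W) = 12 * (N * W) by ring] at hc₃
    refine Rand.expectedCost_lift_bind_le (b := 12 * (N * W) + Z) hc₃ ?_ (by omega)
    split_ifs
    · rw [Rand.expectedCost_pure]
      exact zero_le
    refine Rand.expectedCost_bind_le_nat (b := Z) (hsm ∅ N)
      (fun R₁' hR₁' => ?_) (by omega)
    exact ih (Rs ++ R₁') (by rw [List.length_append, hN, sampleMany_length hR₁'])
      (fun R hR => (List.mem_append.1 hR).elim (hRs R) (sampleMany_valid hR₁' R)) S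

/-- A round is cheaper here than in the sentinel stage; the same constants are kept so that both
stages share one final estimate. -/
theorem remainingLoop_cost (hm : I.n ≤ 2 * I.m) {k : ℕ} (hk : 1 ≤ k) (hkn : k ≤ I.n)
    (S : Finset I.Node) {ε δ : ℝ} {imax : ℕ} (t : ℕ) {N : ℕ} (Rs Rs₂ : List (GRR I))
    (hN : Rs.length = N) (hN₂ : Rs₂.length = N)
    (hRs : ∀ R ∈ Rs, ValidGRR S R) (hRs₂ : ∀ R ∈ Rs₂, ValidGRR S R) (T₀ : Finset I.Node) :
    (remainingLoop k S ε δ imax t Rs Rs₂ T₀).expectedCost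
      ≤ ((85 * ((2 ^ t - 1) * (N * (I.numKeys * I.m))) + 54 * (t * (k * I.n)) : ℕ) : ℝ≥0∞) := by
  have hn : 0 < I.n := by omega
  induction t generalizing Rs Rs₂ T₀ N with
  | zero => simp [remainingLoop]
  | succ t ih =>
    set W := I.numKeys * I.m with hW
    set A := k * I.n with hA
    have hsm : ∀ (S : Finset I.Node) (N : ℕ),
        (sampleMany S N).expectedCost ≤ ((12 * (N * W) : ℕ) : ℝ≥0∞) := sampleMany_cost hn hm
    have hgr : ∀ (j : ℕ) (S₀ S : Finset I.Node) (Rs : List (GRR I)), j ≤ k →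
        (∀ R ∈ Rs, ValidGRR S R) → (greedy k j S₀ Rs).expectedCost
          ≤ ((10 * (Rs.length * W) + 49 * A : ℕ) : ℝ≥0∞) :=
      fun j S₀ S Rs hj h => greedy_cost hm hk hkn hj S₀ h
    have hcov : ∀ (A S : Finset I.Node) (Rs : List (GRR I)), (∀ R ∈ Rs, ValidGRR S R) →
        (coverage A Rs).cost ≤ 3 * (Rs.length * W) := fun A S Rs h => coverage_cost_le hm hn h
    set Z := 85 * ((2 ^ t - 1) * ((N + N) * W)) + 54 * (t * A) with hZ
    have hA1 : k + 1 ≤ 2 * A := by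
      have : k ≤ A := Nat.le_mul_of_pos_right _ hn
      omega
    have hA2 : I.n + 1 ≤ 2 * A := by
      have : I.n ≤ A := Nat.le_mul_of_pos_left _ hk
      omega
    have htotal : 85 * (N * W) + 54 * A + Z
        = 85 * ((2 ^ (t + 1) - 1) * (N * W)) + 54 * ((t + 1) * A) := by
      obtain ⟨p, hp⟩ : ∃ p, 2 ^ t = p + 1 := ⟨2 ^ t - 1, by have := Nat.one_le_two_pow (n := t); omega⟩
      have hp' : 2 ^ (t + 1) - 1 = 2 * p + 1 := by rw [pow_succ, hp]; omega
      rw [hZ, hp', hp, Nat.add_sub_cancel]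
      ring
    rw [remainingLoop, ← htotal]
    refine Rand.expectedCost_bind_le_nat (b := 85 * (N * W) + 52 * A + Z)
      (by rw [Rand.expectedCost_tick]) (fun _ _ => ?_) (show I.n + 1 + _ ≤ _ by omega)
    dsimp only
    refine Rand.expectedCost_bind_le_nat (b := 75 * (N * W) + 3 * A + Z)
      (hgr (k - S.card) S S Rs (Nat.sub_le k S.card) hRs) (fun l hl => ?_) (by rw [hN]; omega)
    have hlen := greedy_length hl
    refine Rand.expectedCost_lift_bind_le (b := 75 * (N * W) + Z)
      ((bestUb_cost l).trans hlen) ?_ (by omega)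
    have hc := hcov ((l.getLast?.map Snapshot.S).getD S) S Rs₂ hRs₂
    rw [hN₂] at hc
    refine Rand.expectedCost_lift_bind_le (b := 72 * (N * W) + Z) hc ?_ (by omega)
    split_ifs
    · rw [Rand.expectedCost_pure]
      exact zero_le
    rw [hN, hN₂]
    refine Rand.expectedCost_bind_le_nat (b := 60 * (N * W) + Z) (hsm S N)
      (fun R₁' hR₁' => ?_) (by omega)
    refine Rand.expectedCost_bind_le_nat (b := Z) (hsm S N)
      (fun R₂' hR₂' => ?_) (by omega)
    exact ih (Rs ++ R₁') (Rs₂ ++ R₂')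
      (by rw [List.length_append, hN, sampleMany_length hR₁'])
      (by rw [List.length_append, hN₂, sampleMany_length hR₂'])
      (fun R hR => (List.mem_append.1 hR).elim (hRs R) (sampleMany_valid hR₁' R))
      (fun R hR => (List.mem_append.1 hR).elim (hRs₂ R) (sampleMany_valid hR₂' R)) _

theorem numKeys_add_le (hm : I.n ≤ 2 * I.m) {k : ℕ} (hk : 1 ≤ k) (hkn : k ≤ I.n) {θ : ℕ}
    (hθ : 0 < θ) : I.numKeys + I.n + k + 1 ≤ θ * (I.numKeys * I.m) + 3 * (k * I.n) := by
  have hn : 0 < I.n := by omega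
  have h1 : I.n ≤ k * I.n := Nat.le_mul_of_pos_left _ hk
  have h2 : I.numKeys ≤ I.numKeys * I.m := Nat.le_mul_of_pos_right _ (by omega)
  have h3 : I.numKeys * I.m ≤ θ * (I.numKeys * I.m) := Nat.le_mul_of_pos_left _ hθ
  omega

theorem sentinelSet_cost (hm : I.n ≤ 2 * I.m) {k : ℕ} (hk : 1 ≤ k) (hkn : k ≤ I.n) {ε₁ δ : ℝ}
    (hδ : 0 < δ) (hδ1 : δ < 1) (i : ℕ) (hi : iMax (I.thetaMaxSentinel k ε₁ δ) (thetaInit δ) = i) :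
    (I.sentinelSet k ε₁ δ).expectedCost
      ≤ ((85 * (thetaInit δ * 2 ^ i * (I.numKeys * I.m)) + 57 * ((i + 1) * (k * I.n)) : ℕ) : ℝ≥0∞) := by
  have hn : 0 < I.n := by omega
  have h0 := numKeys_add_le hm hk hkn (thetaInit_pos hδ hδ1)
  rw [sentinelSet]
  dsimp only
  rw [hi]
  generalize thetaInit δ = θ at h0 ⊢
  set W := I.numKeys * I.m
  set A := k * I.n
  have hsm : ∀ (S : Finset I.Node) (N : ℕ),
      (sampleMany S N).expectedCost ≤ ((12 * (N * W) : ℕ) : ℝ≥0∞) := sampleMany_cost hn hm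
  have htotal : 85 * (θ * W) + 57 * A + (85 * ((2 ^ i - 1) * (θ * W)) + 54 * (i * A))
      ≤ 85 * (θ * 2 ^ i * W) + 57 * ((i + 1) * A) := by
    obtain ⟨p, hp⟩ : ∃ p, 2 ^ i = p + 1 := ⟨2 ^ i - 1, by have := Nat.one_le_two_pow (n := i); omega⟩
    rw [hp, Nat.add_sub_cancel]
    have : 0 ≤ i * A := zero_le
    ring_nf at this ⊢
    omega
  refine Rand.expectedCost_bind_le_nat (a := θ * W + 3 * A)
    (b := 12 * (θ * W) + (85 * ((2 ^ i - 1) * (θ * W)) + 54 * (i * A))) ?_ (fun _ _ => ?_)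
    (le_trans (by omega) htotal)
  · rw [Rand.expectedCost_tick]
    exact Nat.cast_le.2 (by omega)
  · refine Rand.expectedCost_bind_le_nat (hsm ∅ θ) (fun Rs hRs => ?_) le_rfl
    exact sentinelLoop_cost hm hk hkn i Rs (sampleMany_length hRs) (sampleMany_valid hRs) ∅

theorem remainingSet_cost (hm : I.n ≤ 2 * I.m) {k : ℕ} (hk : 1 ≤ k) (hkn : k ≤ I.n)
    (S : Finset I.Node) {ε ε₂ δ : ℝ} (hδ : 0 < δ) (hδ1 : δ < 1) (i : ℕ)
    (hi : iMax (I.thetaMaxRemaining k S.card ε₂ δ) (thetaInit δ) = i) :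
    (I.remainingSet k S ε ε₂ δ).expectedCost
      ≤ ((85 * (thetaInit δ * 2 ^ i * (I.numKeys * I.m)) + 57 * ((i + 1) * (k * I.n)) : ℕ) : ℝ≥0∞) := by
  have hn : 0 < I.n := by omega
  have h0 := numKeys_add_le hm hk hkn (thetaInit_pos hδ hδ1)
  rw [remainingSet]
  dsimp only
  rw [hi]
  generalize thetaInit δ = θ at h0 ⊢
  set W := I.numKeys * I.m
  set A := k * I.n
  have hsm : ∀ (S : Finset I.Node) (N : ℕ),
      (sampleMany S N).expectedCost ≤ ((12 * (N * W) : ℕ) : ℝ≥0∞) := sampleMany_cost hn hm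
  have htotal : 85 * (θ * W) + 57 * A + (85 * ((2 ^ i - 1) * (θ * W)) + 54 * (i * A))
      ≤ 85 * (θ * 2 ^ i * W) + 57 * ((i + 1) * A) := by
    obtain ⟨p, hp⟩ : ∃ p, 2 ^ i = p + 1 := ⟨2 ^ i - 1, by have := Nat.one_le_two_pow (n := i); omega⟩
    rw [hp, Nat.add_sub_cancel]
    have : 0 ≤ i * A := zero_le
    ring_nf at this ⊢
    omega
  refine Rand.expectedCost_bind_le_nat (a := θ * W + 3 * A)
    (b := 24 * (θ * W) + (85 * ((2 ^ i - 1) * (θ * W)) + 54 * (i * A))) ?_ (fun _ _ => ?_)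
    (le_trans (by omega) htotal)
  · rw [Rand.expectedCost_tick]
    exact Nat.cast_le.2 (by omega)
  · refine Rand.expectedCost_bind_le_nat
      (b := 12 * (θ * W) + (85 * ((2 ^ i - 1) * (θ * W)) + 54 * (i * A)))
      (hsm S θ) (fun Rs hRs => ?_) (by omega)
    refine Rand.expectedCost_bind_le_nat (hsm S θ) (fun Rs₂ hRs₂ => ?_) le_rfl
    exact remainingLoop_cost hm hk hkn S i Rs Rs₂ (sampleMany_length hRs)
      (sampleMany_length hRs₂) (sampleMany_valid hRs) (sampleMany_valid hRs₂) ∅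

end Problem

end

end CCDIM

namespace CCDIM

open scoped ENNReal

/-! ## The time bound -/

noncomputable section

namespace Problem

variable {I : Problem}

/-- An edge exists and is not a loop. This keeps log n away from 0, so that constants can be
absorbed into it. -/
theorem two_le_n (hn : 0 < I.n) (hm : I.n ≤ 2 * I.m) : 2 ≤ I.n := by
  obtain ⟨⟨u, v⟩, he⟩ : I.E.Nonempty := Finset.card_pos.1 (show 0 < I.m by omega)
  have huv : u ≠ v := by
    rintro rfl
    exact I.loopless u he
  have := u.2
  have := v.2
  have : u.val ≠ v.val := fun h => huv (Fin.ext h)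
  omega

/-- The only place where the ratio of the coefficients enters: all of them are at most ρ times the
smallest, so the total diversity is at most ρn times the smallest. -/
theorem le_fmin (hn : 0 < I.n) (k : ℕ) {ρ : ℝ} (hρ1 : 1 ≤ ρ)
    (hρ : ∀ x y : I.Key, I.a x.1 x.2 ≤ ρ * I.a y.1 y.2) : (k : ℝ) / (ρ * I.n) ≤ I.fmin k := by
  have hn' : (0 : ℝ) < I.n := by exact_mod_cast hn
  have ha := aMin_pos hn
  obtain ⟨y, hy⟩ := exists_aMin hn
  have h1 : I.diversityTotal ≤ ρ * I.aMin * I.n :=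
    le_community_mul _ fun x => hy ▸ hρ x y
  have h2 := diversityTotal_pos hn
  have h3 : (k : ℝ) / (ρ * I.n) ≤ k / I.n := by
    gcongr
    exact le_mul_of_one_le_left hn'.le hρ1
  have h4 : (k : ℝ) / (ρ * I.n) ≤ I.aMin * k / I.diversityTotal := by
    rw [div_le_div_iff₀ (by positivity) h2]
    calc (k : ℝ) * I.diversityTotal ≤ k * (ρ * I.aMin * I.n) := by gcongr
      _ = _ := by ring
  rw [fmin_eq]
  have h5 := I.lam_nonneg
  have h6 : 0 ≤ 1 - I.lam := by linarith [I.lam_le_one]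
  calc (k : ℝ) / (ρ * I.n) = (1 - I.lam) * (k / (ρ * I.n)) + I.lam * (k / (ρ * I.n)) := by ring
    _ ≤ _ := by gcongr

theorem sq_add_sqrt_le {a b : ℝ} (ha : 0 ≤ a) (hb : 0 ≤ b) : (√a + √b) ^ 2 ≤ 2 * (a + b) := by
  nlinarith [Real.sq_sqrt ha, Real.sq_sqrt hb, sq_nonneg (√a - √b)]

theorem log_choose_le {n k : ℕ} (hn : 1 ≤ n) (N j : ℕ) (hN : N ≤ n) (hj : j ≤ k) :
    Real.log (N.choose j) ≤ k * Real.log n := by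
  rw [← Real.log_pow]
  rcases Nat.eq_zero_or_pos (N.choose j) with h | h
  · rw [h, Nat.cast_zero, Real.log_zero]
    exact Real.log_nonneg (one_le_pow₀ (by exact_mod_cast hn))
  · refine Real.log_le_log (by exact_mod_cast h) ?_
    have h1 : N.choose j ≤ n ^ k :=
      (Nat.choose_le_pow N j).trans ((Nat.pow_le_pow_left hN j).trans (Nat.pow_le_pow_right hn hj))
    exact_mod_cast h1

/-- The dominating factor of the number of samples. -/
def sampleBound (I : Problem) (k : ℕ) (ε δ : ℝ) : ℝ :=
  (I.n : ℝ) * ((k : ℝ) * Real.log I.n + Real.log (1 / δ)) / (ε ^ 2 * k)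

theorem timeBound_eq (k : ℕ) (ε δ : ℝ) :
    I.timeBound k ε δ = I.numKeys * I.m * I.sampleBound k ε δ := by
  unfold timeBound sampleBound
  ring

/-- With c ≤ 9, a ≤ 5 log n + log(1/δ), so 2(√a + √b)² ≤ 4(a + b) ≤ 44(k log n + log(1/δ)); the
factor 176 = 4 · 44 comes from ε/2. -/
theorem thetaMax_le_aux (hn : 2 ≤ I.n) {k : ℕ} (hk : 1 ≤ k) {ε δ ρ : ℝ} (hε : 0 < ε)
    (hδ : 0 < δ) (hδ1 : δ < 1) (hρ1 : 1 ≤ ρ)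
    (hρ : ∀ x y : I.Key, I.a x.1 x.2 ≤ ρ * I.a y.1 y.2) {a b c : ℝ} (hc : c ≤ 9) (hc0 : 1 ≤ c)
    (ha : a = Real.log (c / (δ / 2))) (hb0 : 0 ≤ b) (hb : b ≤ k * Real.log I.n + a) :
    2 * (√a + √b) ^ 2 / ((ε / 2) ^ 2 * I.fmin k) ≤ 176 * ρ * I.sampleBound k ε δ := by
  have hn' : (2 : ℝ) ≤ I.n := by exact_mod_cast hn
  have hk' : (1 : ℝ) ≤ k := by exact_mod_cast hk
  have hlog : Real.log 2 ≤ Real.log I.n := Real.log_le_log (by norm_num) hn'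
  have hlog2 : 0 < Real.log 2 := Real.log_pos (by norm_num)
  have hd : 0 ≤ Real.log (1 / δ) := Real.log_nonneg (by rw [le_div_iff₀ hδ]; linarith)
  have ha0 : 0 ≤ a := by
    rw [ha]
    exact Real.log_nonneg (by rw [le_div_iff₀ (by positivity)]; linarith)
  have ha1 : a ≤ 5 * Real.log I.n + Real.log (1 / δ) := by
    have h1 : a ≤ Real.log (2 ^ 5 * (1 / δ)) := by
      rw [ha]
      refine Real.log_le_log (by positivity) ?_
      rw [show c / (δ / 2) = (2 * c) * (1 / δ) by field_simp]
      gcongr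
      linarith
    rw [Real.log_mul (by positivity) (by positivity), Real.log_pow] at h1
    push_cast at h1
    linarith
  have hkl : Real.log I.n ≤ k * Real.log I.n := le_mul_of_one_le_left (by linarith) hk'
  have hsum : 2 * (√a + √b) ^ 2 ≤ 44 * (k * Real.log I.n + Real.log (1 / δ)) := by
    have := sq_add_sqrt_le ha0 hb0
    linarith
  have hf := le_fmin (by omega : 0 < I.n) k hρ1 hρ
  have hY : 0 ≤ k * Real.log I.n + Real.log (1 / δ) := by
    have : 0 ≤ k * Real.log I.n := by linarith
    linarith
  calc _ ≤ 44 * (k * Real.log I.n + Real.log (1 / δ)) / ((ε / 2) ^ 2 * (k / (ρ * I.n))) := by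
        gcongr
    _ = 176 * ρ * I.sampleBound k ε δ := by
        unfold sampleBound
        field_simp
        ring

theorem thetaMaxSentinel_le (hn : 2 ≤ I.n) {k : ℕ} (hk : 1 ≤ k) {ε δ ρ : ℝ}
    (hε : 0 < ε) (hδ : 0 < δ) (hδ1 : δ < 1) (hρ1 : 1 ≤ ρ)
    (hρ : ∀ x y : I.Key, I.a x.1 x.2 ≤ ρ * I.a y.1 y.2) :
    I.thetaMaxSentinel k (ε / 2) (δ / 2) ≤ 176 * ρ * I.sampleBound k ε δ := by
  have h0 : 0 ≤ Real.log (6 / (δ / 2)) :=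
    Real.log_nonneg (by rw [le_div_iff₀ (by positivity)]; linarith)
  have h1 := log_choose_nonneg I.n k
  refine thetaMax_le_aux hn hk hε hδ hδ1 hρ1 hρ (by norm_num) (by norm_num) rfl (by positivity) ?_
  have := log_choose_le (by omega : 1 ≤ I.n) I.n k le_rfl le_rfl
  linarith

theorem thetaMaxRemaining_le (hn : 2 ≤ I.n) {k : ℕ} (hk : 1 ≤ k) (b : ℕ) {ε δ ρ : ℝ}
    (hε : 0 < ε) (hδ : 0 < δ) (hδ1 : δ < 1) (hρ1 : 1 ≤ ρ)
    (hρ : ∀ x y : I.Key, I.a x.1 x.2 ≤ ρ * I.a y.1 y.2) :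
    I.thetaMaxRemaining k b (ε / 2) (δ / 2) ≤ 176 * ρ * I.sampleBound k ε δ := by
  have h0 : 0 ≤ Real.log (9 / (δ / 2)) :=
    Real.log_nonneg (by rw [le_div_iff₀ (by positivity)]; linarith)
  have h1 := log_choose_nonneg (I.n - b) (k - b)
  have h2 := greedyConst_gt
  have h3 := greedyConst_lt
  unfold greedyConst at h2 h3
  refine thetaMax_le_aux hn hk hε hδ hδ1 hρ1 hρ le_rfl (by norm_num) rfl
    (mul_nonneg (by linarith) (by positivity)) ?_
  have := log_choose_le (by omega : 1 ≤ I.n) (I.n - b) (k - b) (Nat.sub_le _ _) (Nat.sub_le k b)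
  refine (mul_le_of_le_one_left (by positivity) (by linarith)).trans ?_
  linarith

/-- The initial size is at least log(1/δ), which removes δ from the quotient: θ_max/θ is at most
176ρn²/ε². Its logarithm is O(log n / ε²), a crude bound that suffices. -/
theorem iMax_le (hn : 2 ≤ I.n) {k : ℕ} (hk : 1 ≤ k) {ε δ ρ θmax : ℝ} (hε : 0 < ε)
    (hε1 : ε < 1) (hδ : 0 < δ) (hδ1 : δ < 1) (hρ1 : 1 ≤ ρ)
    (hlt : (thetaInit (δ / 2) : ℝ) < θmax) (hθ : θmax ≤ 176 * ρ * I.sampleBound k ε δ) :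
    (iMax θmax (thetaInit (δ / 2)) : ℝ)
      ≤ (4 * Real.log (176 * ρ) + 14) * (Real.log I.n / ε ^ 2) := by
  have hn' : (2 : ℝ) ≤ I.n := by exact_mod_cast hn
  have hk' : (1 : ℝ) ≤ k := by exact_mod_cast hk
  have hlog : Real.log 2 ≤ Real.log I.n := Real.log_le_log (by norm_num) hn'
  have hlog2 : 1 / 2 < Real.log 2 := by linarith [Real.log_two_gt_d9]
  have hd : 0 ≤ Real.log (1 / δ) := Real.log_nonneg (by rw [le_div_iff₀ hδ]; linarith)
  have hθ0 : (0 : ℝ) < thetaInit (δ / 2) := by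
    exact_mod_cast thetaInit_pos (by positivity : 0 < δ / 2) (by linarith)
  have hθ1 : (1 : ℝ) ≤ thetaInit (δ / 2) := by
    exact_mod_cast thetaInit_pos (by positivity : 0 < δ / 2) (by linarith)
  have hθ2 : Real.log (1 / δ) ≤ thetaInit (δ / 2) := by
    have h1 : 3 * Real.log (1 / (δ / 2)) ≤ (thetaInit (δ / 2) : ℕ) := Nat.le_ceil _
    have h2 : Real.log (1 / δ) ≤ Real.log (1 / (δ / 2)) :=
      Real.log_le_log (by positivity) (by gcongr; linarith)
    linarith
  set θ : ℝ := (thetaInit (δ / 2) : ℝ) with hθdef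
  have hx1 : 1 < θmax / θ := by rwa [one_lt_div hθ0]
  have hx2 : θmax / θ ≤ 176 * ρ * (I.n ^ 2 * (1 / ε) ^ 2) := by
    rw [div_le_iff₀ hθ0]
    refine hθ.trans ?_
    have h1 : Real.log I.n + 1 ≤ I.n := by linarith [Real.log_le_sub_one_of_pos (by linarith : (0 : ℝ) < I.n)]
    have h2 : (k : ℝ) * Real.log I.n + Real.log (1 / δ) ≤ k * I.n * θ := by
      calc (k : ℝ) * Real.log I.n + Real.log (1 / δ) ≤ k * Real.log I.n * θ + k * θ := by
            refine add_le_add (le_mul_of_one_le_right (by nlinarith) hθ1) ?_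
            exact hθ2.trans (le_mul_of_one_le_left hθ0.le hk')
        _ = k * (Real.log I.n + 1) * θ := by ring
        _ ≤ k * I.n * θ := by gcongr
    have h3 : I.sampleBound k ε δ ≤ I.n ^ 2 * (1 / ε) ^ 2 * θ := by
      calc I.sampleBound k ε δ ≤ I.n * (k * I.n * θ) / (ε ^ 2 * k) := by
            unfold sampleBound
            gcongr
        _ = _ := by field_simp
    calc 176 * ρ * I.sampleBound k ε δ ≤ 176 * ρ * (I.n ^ 2 * (1 / ε) ^ 2 * θ) := by gcongr
      _ = _ := by ring
  have hlogx : Real.log (θmax / θ)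
      ≤ Real.log (176 * ρ) + 2 * Real.log I.n + 2 * Real.log (1 / ε) := by
    refine (Real.log_le_log (by linarith) hx2).trans (le_of_eq ?_)
    rw [Real.log_mul (x := 176 * ρ) (by positivity) (by positivity),
      Real.log_mul (x := (I.n : ℝ) ^ 2) (by positivity) (by positivity), Real.log_pow, Real.log_pow]
    push_cast
    ring
  have hC0 : 0 ≤ Real.log (176 * ρ) := Real.log_nonneg (by linarith)
  have hε2 : 1 ≤ 1 / ε ^ 2 := by
    rw [le_div_iff₀ (by positivity), one_mul]
    exact pow_le_one₀ hε.le hε1.le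
  set y := Real.log I.n / ε ^ 2 with hy
  have hy' : y = Real.log I.n * (1 / ε ^ 2) := by rw [hy]; ring
  have hy1 : Real.log I.n ≤ y := by
    rw [hy']
    exact le_mul_of_one_le_right (by linarith) hε2
  have hy2 : 1 / ε ^ 2 ≤ 2 * y := by
    rw [hy']
    nlinarith
  have hlε : Real.log (1 / ε) ≤ 1 / ε ^ 2 := by
    have h1 := Real.log_le_sub_one_of_pos (by positivity : 0 < 1 / ε)
    have h2 : 1 / ε ≤ 1 / ε ^ 2 := by
      gcongr
      nlinarith
    linarith
  have hi : (iMax θmax (thetaInit (δ / 2)) : ℝ) < Real.logb 2 (θmax / θ) + 1 :=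
    Nat.ceil_lt_add_one (Real.logb_pos (by norm_num) hx1).le
  have hlb : Real.logb 2 (θmax / θ) ≤ 2 * Real.log (θmax / θ) := by
    rw [Real.logb, div_le_iff₀ (by linarith)]
    have := Real.log_pos hx1
    nlinarith
  have h5 : Real.log (176 * ρ) ≤ 2 * Real.log (176 * ρ) * y := by
    have : 0 ≤ Real.log (176 * ρ) * (2 * y - 1) := mul_nonneg hC0 (by linarith)
    linarith
  linarith

/-- Sampling is governed by θ·2^i ≤ 2θ_max, giving 85 · 352 = 29920. The overhead (i + 1)kn is
bounded with k ≤ n ≤ 2m by a multiple of mn log n / ε², which is the k log n part of the time bound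
after division by k. -/
theorem stage_cost_le (hn : 2 ≤ I.n) (hm : I.n ≤ 2 * I.m) {k : ℕ} (hk : 1 ≤ k) (hkn : k ≤ I.n)
    {ε δ ρ θmax : ℝ} (hε : 0 < ε) (hε1 : ε < 1) (hδ : 0 < δ) (hδ1 : δ < 1) (hρ1 : 1 ≤ ρ)
    (hlt : (thetaInit (δ / 2) : ℝ) < θmax) (hθ : θmax ≤ 176 * ρ * I.sampleBound k ε δ) :
    ((85 * (thetaInit (δ / 2) * 2 ^ iMax θmax (thetaInit (δ / 2)) * (I.numKeys * I.m))
        + 57 * ((iMax θmax (thetaInit (δ / 2)) + 1) * (k * I.n)) : ℕ) : ℝ)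
      ≤ (29920 * ρ + 228 * (4 * Real.log (176 * ρ) + 14)) * I.timeBound k ε δ := by
  have h1 := iMax_le hn hk hε hε1 hδ hδ1 hρ1 hlt hθ
  obtain ⟨h2, -, h3⟩ := iMax_spec (thetaInit_pos (by positivity : 0 < δ / 2) (by linarith)) hlt
  generalize iMax θmax (thetaInit (δ / 2)) = i at h1 h2 h3 ⊢
  have hn' : (2 : ℝ) ≤ I.n := by exact_mod_cast hn
  have hk' : (1 : ℝ) ≤ k := by exact_mod_cast hk
  have hm' : (I.n : ℝ) ≤ 2 * I.m := by exact_mod_cast hm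
  have hi' : (1 : ℝ) ≤ i := by exact_mod_cast h2
  have hK : (1 : ℝ) ≤ I.numKeys := by exact_mod_cast numKeys_pos (by omega : 0 < I.n)
  have hd : 0 ≤ Real.log (1 / δ) := Real.log_nonneg (by rw [le_div_iff₀ hδ]; linarith)
  have hl : 0 ≤ Real.log I.n := Real.log_nonneg (by linarith)
  have hC0 : 0 ≤ Real.log (176 * ρ) := Real.log_nonneg (by linarith)
  set D := 4 * Real.log (176 * ρ) + 14 with hD
  have hD0 : 0 ≤ D := by linarith
  set y := Real.log I.n / ε ^ 2 with hy
  have hy0 : 0 ≤ y := by positivity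
  have hs : I.n * y ≤ I.sampleBound k ε δ := by
    calc I.n * y = I.n * (k * Real.log I.n) / (ε ^ 2 * k) := by rw [hy]; field_simp
      _ ≤ _ := by
        unfold sampleBound
        gcongr
        linarith
  have ht : (I.m : ℝ) * (I.n * y) ≤ I.timeBound k ε δ := by
    rw [timeBound_eq]
    have : (I.m : ℝ) ≤ I.numKeys * I.m := le_mul_of_one_le_left (by positivity) hK
    gcongr
  have e1 : (thetaInit (δ / 2) : ℝ) * 2 ^ i * (I.numKeys * I.m)
      ≤ 352 * ρ * I.timeBound k ε δ := by
    rw [timeBound_eq]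
    calc _ ≤ 2 * (176 * ρ * I.sampleBound k ε δ) * (I.numKeys * I.m) :=
          mul_le_mul_of_nonneg_right (by linarith) (by positivity)
      _ = _ := by ring
  have e2 : ((i : ℝ) + 1) * (k * I.n) ≤ 4 * D * I.timeBound k ε δ := by
    have hkm : (k : ℝ) ≤ 2 * I.m := le_trans (by exact_mod_cast hkn) hm'
    calc ((i : ℝ) + 1) * (k * I.n) ≤ (2 * (D * y)) * ((2 * I.m) * I.n) := by
          gcongr
          linarith
      _ = 4 * D * (I.m * (I.n * y)) := by ring
      _ ≤ _ := by gcongr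
  push_cast
  linarith

theorem n_add_one_le (hn : 2 ≤ I.n) (hm : I.n ≤ 2 * I.m) {k : ℕ} (hk : 1 ≤ k) {ε δ : ℝ}
    (hε : 0 < ε) (hε1 : ε < 1) (hδ : 0 < δ) (hδ1 : δ < 1) :
    ((I.n + 1 : ℕ) : ℝ) ≤ 4 * I.timeBound k ε δ := by
  have hn' : (2 : ℝ) ≤ I.n := by exact_mod_cast hn
  have hk' : (1 : ℝ) ≤ k := by exact_mod_cast hk
  have hm' : (1 : ℝ) ≤ I.m := by exact_mod_cast (by omega : 1 ≤ I.m)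
  have hK : (1 : ℝ) ≤ I.numKeys := by exact_mod_cast numKeys_pos (by omega : 0 < I.n)
  have hd : 0 ≤ Real.log (1 / δ) := Real.log_nonneg (by rw [le_div_iff₀ hδ]; linarith)
  have hl : 1 / 2 ≤ Real.log I.n := by
    linarith [Real.log_two_gt_d9, Real.log_le_log (by norm_num) hn']
  have hε2 : ε ^ 2 ≤ 1 := pow_le_one₀ hε.le hε1.le
  have h1 : (I.n : ℝ) * (1 / 2) ≤ I.sampleBound k ε δ := by
    unfold sampleBound
    rw [le_div_iff₀ (by positivity)]
    calc (I.n : ℝ) * (1 / 2) * (ε ^ 2 * k) ≤ I.n * (1 / 2) * (1 * k) := by gcongr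
      _ = I.n * (k * (1 / 2)) := by ring
      _ ≤ I.n * (k * Real.log I.n + Real.log (1 / δ)) := by
        have : (k : ℝ) * (1 / 2) ≤ k * Real.log I.n := by gcongr
        gcongr
        linarith
  have h2 : I.sampleBound k ε δ ≤ I.timeBound k ε δ := by
    rw [timeBound_eq]
    refine le_mul_of_one_le_left (le_trans (by positivity) h1) ?_
    exact one_le_mul_of_one_le_of_one_le hK hm'
  push_cast
  linarith

/-- The expected running time of G-HIST. -/
theorem gHist_cost (hm : I.n ≤ 2 * I.m) {k : ℕ} (hk : 1 ≤ k) (hkn : k ≤ I.n) {ε δ ρ : ℝ}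
    (hε : 0 < ε) (hε1 : ε < 1) (hδ : 0 < δ) (hδ1 : δ < 1) (hρ1 : 1 ≤ ρ)
    (hρ : ∀ x y : I.Key, I.a x.1 x.2 ≤ ρ * I.a y.1 y.2) :
    (I.gHist k ε δ).expectedCost ≤ ENNReal.ofReal
      ((2 * (29920 * ρ + 228 * (4 * Real.log (176 * ρ) + 14)) + 4) * I.timeBound k ε δ) := by
  have hn0 : 0 < I.n := by omega
  have hn := two_le_n hn0 hm
  have hδ0 : 0 < δ / 2 := by positivity
  have hδ2 : δ / 2 < 1 := by linarith
  have nat_le : ∀ (c : ℕ) (x : ℝ), (c : ℝ) ≤ x → (c : ℝ≥0∞) ≤ ENNReal.ofReal x := by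
    intro c x h
    rw [← ENNReal.ofReal_natCast]
    exact ENNReal.ofReal_le_ofReal h
  set C := 29920 * ρ + 228 * (4 * Real.log (176 * ρ) + 14) with hC
  have hl : 0 ≤ Real.log (176 * ρ) := Real.log_nonneg (by linarith)
  have hC0 : 0 ≤ C := by positivity
  have h4 := n_add_one_le hn hm hk hε hε1 hδ hδ1
  have ht : 0 ≤ I.timeBound k ε δ := by
    have : (0 : ℝ) ≤ ((I.n + 1 : ℕ) : ℝ) := by positivity
    linarith
  have hsplit : ENNReal.ofReal ((2 * C + 4) * I.timeBound k ε δ)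
      = ENNReal.ofReal (C * I.timeBound k ε δ) + (ENNReal.ofReal (C * I.timeBound k ε δ)
        + ENNReal.ofReal (4 * I.timeBound k ε δ)) := by
    rw [← ENNReal.ofReal_add (by positivity) (by positivity),
      ← ENNReal.ofReal_add (by positivity) (by positivity)]
    congr 1
    ring
  rw [hsplit, gHist]
  refine Rand.expectedCost_bind_le ?_ fun S _ => Rand.expectedCost_bind_le ?_ fun T _ => ?_
  · exact (sentinelSet_cost hm hk hkn hδ0 hδ2 _ rfl).trans (nat_le _ _
      (stage_cost_le hn hm hk hkn hε hε1 hδ hδ1 hρ1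
        (thetaInit_lt_thetaMaxSentinel hn0 hk hkn hε hε1 hδ0 hδ2)
        (thetaMaxSentinel_le hn hk hε hδ hδ1 hρ1 hρ)))
  · exact (remainingSet_cost hm hk hkn S hδ0 hδ2 _ rfl).trans (nat_le _ _
      (stage_cost_le hn hm hk hkn hε hε1 hδ hδ1 hρ1
        (thetaInit_lt_thetaMaxRemaining hn0 hk hkn S.card hε hε1 hδ0 hδ2)
        (thetaMaxRemaining_le hn hk S.card hε hδ hδ1 hρ1 hρ)))
  · refine (Rand.expectedCost_bind_le (Rand.expectedCost_tick _).le fun _ _ =>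
      (Rand.expectedCost_pure _).le).trans ?_
    rw [add_zero]
    exact nat_le _ _ h4

end Problem

end

end CCDIM

theorem mainTheorem1 :
    (∀ (I : CCDIM.Problem) (k : ℕ) (ε δ : ℝ), 1 ≤ k → k ≤ I.n → 0 < ε → ε < 1 → 0 < δ → δ < 1 →
      ENNReal.ofReal (1 - δ) ≤
        (I.gHist k ε δ).prob {S | I.IsApproxSolution k (1 - 1 / Real.exp 1 - ε) S}) ∧
    (∀ ρ : ℝ, ∃ C : ℝ, 0 < C ∧
      ∀ (I : CCDIM.Problem) (k : ℕ) (ε δ : ℝ), 1 ≤ k → k ≤ I.n → 0 < ε → ε < 1 → 0 < δ → δ < 1 →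
        I.n ≤ 2 * I.m →
        (∀ x y : I.Key, I.a x.1 x.2 ≤ ρ * I.a y.1 y.2) →
        (I.gHist k ε δ).expectedCost ≤ ENNReal.ofReal (C * I.timeBound k ε δ)) := by
  refine ⟨fun I k ε δ hk hkn hε hε1 hδ hδ1 => ?_, fun ρ => ?_⟩
  · have hn : 0 < I.n := by omega
    rw [CCDIM.Rand.prob_eq_Pr]
    have h1 := CCDIM.Rand.Pr_add_Pr_not (I.gHist k ε δ)
      (I.IsApproxSolution k (1 - 1 / Real.exp 1 - ε))
    have h2 := CCDIM.Problem.gHist_fail hn hk hkn hε hε1 hδ hδ1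
    rw [ENNReal.ofReal_sub _ hδ.le, ENNReal.ofReal_one, tsub_le_iff_right, ← h1]
    exact add_le_add le_rfl h2
  -- The given ρ is arbitrary. Raising it to at least 1 weakens the hypothesis and keeps the
  -- logarithm in the constant nonnegative.
  · have hρ1 : 1 ≤ max ρ 1 := le_max_right _ _
    have hl : 0 ≤ Real.log (176 * max ρ 1) := Real.log_nonneg (by linarith)
    refine ⟨2 * (29920 * max ρ 1 + 228 * (4 * Real.log (176 * max ρ 1) + 14)) + 4, by positivity,
      fun I k ε δ hk hkn hε hε1 hδ hδ1 hm hρ => ?_⟩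
    refine CCDIM.Problem.gHist_cost hm hk hkn hε hε1 hδ hδ1 hρ1 fun x y => (hρ x y).trans ?_
    exact mul_le_mul_of_nonneg_right (le_max_left _ _) (I.a_pos _ _).le
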